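/- Let $\mathcal Z$ be a locally compact, separable, metrizable space and let $\mathcal M$ be a compact metrizable $p$-dimensional foliated space modelled transversely on $\mathcal Z$: $\mathcal M$ is covered by the domains of charts $\varphi=(y,z)\colon U\to B_1\times B_2$ (homeomorphisms onto products of a connected open set $B_1\subset\mathbb R^p$ and an open set $B_2\subset\mathcal Z$) whose coordinate changes are leafwise smooth, i.e. locally of the form $(y,z)\mapsto(f_1(y,z),f_2(z))$ with $f_2$ continuous and $f_1$ smooth in $y$ with all $y$-derivatives jointly continuous in $(y,z)$. A real function on $\mathcal M$ is leafwise $C^k$ if in every chart it is $C^k$ in $y$ and its $y$-derivatives up to order $k$ are jointly continuous in $(y,z)$. A leafwise $C^k$ vector field assigns to each $m\in\mathcal M$ a tangent vector at $m$ of the leaf through $m$, with leafwise $C^k$ components with respect to $\partial/\partial y^1,\dots,\partial/\partial y^p$ in every chart. Let $1/3<\alpha<1/2$, $T>0$, $d\ge 0$. An $\alpha$-Hölder rough path on $[0,T]$ is a pair $\mathbf w=(\mathbf w^1,\mathbf w^2)$ of continuous maps from $\{0\le s\le t\le T\}$ to $\mathbb R^d$ and $\mathbb R^d\otimes\mathbb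 R^d$ with $\mathbf w^1_{s,t}=\mathbf w^1_{s,u}+\mathbf w^1_{u,t}$ and $\mathbf w^2_{s,t}=\mathbf w^2_{s,u}+\mathbf w^2_{u,t}+\mathbf w^1_{s,u}\otimes\mathbf w^1_{u,t}$ for $s\le u\le t$, and $\|\mathbf w^i\|_{i\alpha}:=\sup_{s<t}|\mathbf w^i_{s,t}|/(t-s)^{i\alpha}<\infty$ for $i=1,2$. The natural lift of a Lipschitz path $w\colon[0,T]\to\mathbb R^d$ with $w_0=0$ is given by $\mathbf w^1_{s,t}=w_t-w_s$ and $\mathbf w^2_{s,t}=\int_s^t(w_u-w_s)\otimes dw_u$ (Riemann–Stieltjes integral). The rough path $\mathbf w$ is geometric if it lies in the closure of the set of these lifts with respect to the distance $\max_{i=1,2}\|\mathbf w^i-\hat{\mathbf w}^i\|_{i\alpha}$. Let $V_0,V_1,\dots,V_d$ be leafwise $C^3$ vector fields on $\mathcal M$, let $\mathbf w$ be a geometric $\alpha$-Hölder rough path, let $0\le a<b\le T$ and $m\in\mathcal M$. A continuous path $x\colon[a,b]\to\mathcal M$ is a solution with initial condition $m$ of the rough differential equation $$dx_t=\sum_{i=1}^d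 V_i(x_t)\,dw^i_t+V_0(x_t)\,dt \qquad (\ast)$$ if $x_a=m$ and, for every leafwise $C^3$ function $f\colon\mathcal M\to\mathbb R$, there is a constant $C$ such that for all $a\le s\le t\le b$ $$\Bigl|f(x_t)-f(x_s)-\sum_{i=1}^d V_if(x_s)\,\mathbf w^{1,i}_{s,t}-\sum_{j,k=1}^d V_jV_kf(x_s)\,\mathbf w^{2,jk}_{s,t}-V_0f(x_s)(t-s)\Bigr|\le C\,(t-s)^{3\alpha}.$$ Then for every $m\in\mathcal M$ there exists a unique solution $(x_t)_{t\in[a,b]}$ of $(\ast)$ with $x_a=m$. Moreover, if $\mathbf w$ is the natural lift of a Lipschitz path $w$ with $w_0=0$, then $(\ast)$ understood as an ODE in the Riemann–Stieltjes sense also has a unique solution with $x_a=m$, and the two solutions coincide. Here a continuous path $x\colon[a,b]\to\mathcal M$ with $x_a=m$ solves the ODE in the Riemann–Stieltjes sense if, on every subinterval $[s,t]\subset[a,b]$ on which $x$ stays in a chart $(y,z)$ in which $V_i$ has component vector $\tilde V_i(y,z)$, the transverse coordinate satisfies $z(x_t)=z(x_s)$ and $$y(x_t)-y(x_s)=\sum_{i=1}^d\int_s^t\tilde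 V_i(y(x_u),z(x_u))\,dw^i_u+\int_s^t\tilde V_0(y(x_u),z(x_u))\,du .$$ -/

import Mathlib

open Set Topology
open scoped ENNReal

namespace FoliatedRDE

/-- Euclidean space of dimension `p`. -/
abbrev E (p : ℕ) : Type := EuclideanSpace ℝ (Fin p)

section Foliated

variable {p : ℕ} {W W' F : Type*} [TopologicalSpace W] [TopologicalSpace W']
  [NormedAddCommGroup F] [NormedSpace ℝ F]

/-- `f` is of class `C_L^k` on the open set `U ⊆ ℝ^p × W`: it is `C^k` in the first variable, and
its partial derivatives in the first variable, up to order `k`, are jointly continuous on `U`. -/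
def LeafwiseContDiffOn (k : ℕ) (f : E p × W → F) (U : Set (E p × W)) : Prop :=
  (∀ z : W, ContDiffOn ℝ k (fun y => f (y, z)) {y | (y, z) ∈ U}) ∧
  ∀ l ≤ k, ContinuousOn (fun q : E p × W => iteratedFDeriv ℝ l (fun y => f (y, q.2)) q.1) U

/-- A map `f : U → ℝ^p × W'` on the open set `U ⊆ ℝ^p × W` is leafwise smooth: locally it is of
the form `(y, z) ↦ (f₁ (y, z), f₂ z)` with `f₂` continuous and `f₁` of class `C_L^k` for all
finite `k`. -/
def LeafwiseSmoothMapOn (f : E p × W → E p × W') (U : Set (E p × W)) : Prop :=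
  (∀ k : ℕ, LeafwiseContDiffOn k (fun q => (f q).1) U) ∧
  ∀ q ∈ U, ∃ N ⊆ U, IsOpen N ∧ q ∈ N ∧ ∃ f₂ : W → W',
    ContinuousOn f₂ (Prod.snd '' N) ∧ ∀ q' ∈ N, (f q').2 = f₂ q'.2

end Foliated

/-- A foliated atlas of dimension `p`, modelled transversely on `Z`, on the space `M`. -/
structure FoliatedAtlas (p : ℕ) (Z M : Type*) [TopologicalSpace Z] [TopologicalSpace M] where
  charts : Set (OpenPartialHomeomorph M (E p × Z))
  cover : ∀ m : M, ∃ φ ∈ charts, m ∈ φ.source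
  target_eq_prod : ∀ φ ∈ charts, ∃ (B₁ : Set (E p)) (B₂ : Set Z),
    IsOpen B₁ ∧ IsConnected B₁ ∧ IsOpen B₂ ∧ φ.target = B₁ ×ˢ B₂
  compatible : ∀ φ ∈ charts, ∀ ψ ∈ charts,
    LeafwiseSmoothMapOn (fun q => ψ (φ.symm q)) (φ.symm.trans ψ).source

namespace FoliatedAtlas

variable {p : ℕ} {Z M : Type*} [TopologicalSpace Z] [TopologicalSpace M]

/-- A foliated chart around `m`. -/
noncomputable def chartAt (A : FoliatedAtlas p Z M) (m : M) : OpenPartialHomeomorph M (E p × Z) :=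
  Classical.choose (A.cover m)

lemma chartAt_mem (A : FoliatedAtlas p Z M) (m : M) : A.chartAt m ∈ A.charts :=
  (Classical.choose_spec (A.cover m)).1

lemma mem_chartAt_source (A : FoliatedAtlas p Z M) (m : M) : m ∈ (A.chartAt m).source :=
  (Classical.choose_spec (A.cover m)).2

/-- A function on `M` is leafwise `C^k` if it is of class `C_L^k` in every chart. -/
def LeafwiseContDiff (A : FoliatedAtlas p Z M) (k : ℕ) (f : M → ℝ) : Prop :=
  ∀ φ ∈ A.charts, LeafwiseContDiffOn k (fun q => f (φ.symm q)) φ.target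

/-- The tangent space at `m` of the leaf through `m`. A tangent vector is given by its components
`coord φ` with respect to the bases `∂/∂y¹, …, ∂/∂yᵖ` of the charts `φ` around `m`; they
transform by the leafwise derivative of the coordinate change. (Indices `φ` that are not charts
around `m` carry the value `0`.) -/
@[ext] structure LeafTangent (A : FoliatedAtlas p Z M) (m : M) where
  coord : OpenPartialHomeomorph M (E p × Z) → E p
  coord_eq_zero : ∀ φ, ¬ (φ ∈ A.charts ∧ m ∈ φ.source) → coord φ = 0
  coord_change : ∀ φ ∈ A.charts, ∀ ψ ∈ A.charts, m ∈ φ.source → m ∈ ψ.source →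
    coord ψ =
      fderiv ℝ (fun y => (ψ (φ.symm (y, (φ m).2))).1) (φ m).1 (coord φ)

/-- A vector field along the leaves, `V m ∈ T_m L_m`. -/
abbrev LeafVectorField (A : FoliatedAtlas p Z M) := ∀ m : M, A.LeafTangent m

/-- The components `(y, z) ↦ Ṽ (y, z)` of `V` in the chart `φ`. -/
def LeafVectorField.inChart {A : FoliatedAtlas p Z M} (V : A.LeafVectorField)
    (φ : OpenPartialHomeomorph M (E p × Z)) : E p × Z → E p :=
  fun q => (V (φ.symm q)).coord φ

/-- `V` is leafwise `C^k`: its components in every chart are of class `C_L^k`. -/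
def LeafVectorField.IsLeafwiseContDiff {A : FoliatedAtlas p Z M} (V : A.LeafVectorField)
    (k : ℕ) : Prop :=
  ∀ φ ∈ A.charts, LeafwiseContDiffOn k (V.inChart φ) φ.target

/-- The function `V f`, the derivative of `f` along `V`: in a chart `(y, z)` around `m` it is
`∑ᵢ Ṽⁱ ∂f/∂yⁱ`. -/
noncomputable def LeafVectorField.deriv {A : FoliatedAtlas p Z M} (V : A.LeafVectorField)
    (f : M → ℝ) : M → ℝ :=
  fun m => fderiv ℝ (fun y => f ((A.chartAt m).symm (y, (A.chartAt m m).2)))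
    (A.chartAt m m).1 ((V m).coord (A.chartAt m))

end FoliatedAtlas

section RoughPaths

/-- `I` is the Riemann–Stieltjes integral `∫_a^b f dg`: the limit of the Riemann–Stieltjes sums
over tagged partitions `a = t 0 ≤ ⋯ ≤ t n = b`, as the mesh tends to zero. -/
def HasRSIntegral {F : Type*} [NormedAddCommGroup F] [NormedSpace ℝ F]
    (f : ℝ → F) (g : ℝ → ℝ) (a b : ℝ) (I : F) : Prop :=
  ∀ ε > 0, ∃ δ > 0, ∀ (n : ℕ) (t ξ : ℕ → ℝ), t 0 = a → t n = b →
    (∀ k < n, ξ k ∈ Icc (t k) (t (k + 1))) → (∀ k < n, t (k + 1) - t k < δ) →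
    ‖∑ k ∈ Finset.range n, (g (t (k + 1)) - g (t k)) • f (ξ k) - I‖ < ε

/-- The simplex `{(s, t) : 0 ≤ s ≤ t ≤ T}`. -/
def simplex (T : ℝ) : Set (ℝ × ℝ) := {q | 0 ≤ q.1 ∧ q.1 ≤ q.2 ∧ q.2 ≤ T}

/-- `sup_{0 ≤ s < t ≤ T} |F s t| / (t - s)^β`. -/
noncomputable def holderNorm {F : Type*} [NormedAddCommGroup F] (T β : ℝ) (w : ℝ → ℝ → F) :
    ℝ≥0∞ :=
  ⨆ (s : ℝ) (t : ℝ) (_ : 0 ≤ s) (_ : s < t) (_ : t ≤ T),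
    ENNReal.ofReal (‖w s t‖ / (t - s) ^ β)

/-- An `α`-Hölder rough path over `ℝ^d` on `[0, T]`. The space `ℝ^d ⊗ ℝ^d` is identified with
`d × d` arrays. Only the values on the simplex are relevant. -/
structure RoughPath (α T : ℝ) (d : ℕ) where
  fst : ℝ → ℝ → E d
  snd : ℝ → ℝ → EuclideanSpace ℝ (Fin d × Fin d)
  continuousOn_fst : ContinuousOn (fun q : ℝ × ℝ => fst q.1 q.2) (simplex T)
  continuousOn_snd : ContinuousOn (fun q : ℝ × ℝ => snd q.1 q.2) (simplex T)
  chen_fst : ∀ s u t, 0 ≤ s → s ≤ u → u ≤ t → t ≤ T → fst s t = fst s u + fst u t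
  chen_snd : ∀ s u t, 0 ≤ s → s ≤ u → u ≤ t → t ≤ T → ∀ j k,
    snd s t (j, k) = snd s u (j, k) + snd u t (j, k) + fst s u j * fst u t k
  holder_fst : holderNorm T α fst < ⊤
  holder_snd : holderNorm T (2 * α) snd < ⊤

namespace RoughPath

variable {α T : ℝ} {d : ℕ}

/-- The distance `d_α` between rough paths. -/
noncomputable def hdist (w v : RoughPath α T d) : ℝ≥0∞ :=
  max (holderNorm T α (fun s t => w.fst s t - v.fst s t))
    (holderNorm T (2 * α) (fun s t => w.snd s t - v.snd s t))

end RoughPath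

/-- Lipschitz paths on `[0, T]` that start at `0`. -/
def IsLipschitzPath (T : ℝ) {d : ℕ} (w : ℝ → E d) : Prop :=
  w 0 = 0 ∧ ∃ K, LipschitzOnWith K w (Icc 0 T)

namespace RoughPath

variable {α T : ℝ} {d : ℕ}

/-- The rough path is the natural lift of the path `w`:
`𝐰¹_{s,t} = w_t - w_s` and `𝐰²_{s,t} = ∫_s^t (w_u - w_s) ⊗ dw_u`. -/
def IsLiftOf (W : RoughPath α T d) (w : ℝ → E d) : Prop :=
  ∀ s t, 0 ≤ s → s ≤ t → t ≤ T →
    W.fst s t = w t - w s ∧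
    ∀ j k, HasRSIntegral (fun u => w u j - w s j) (fun u => w u k) s t (W.snd s t (j, k))

/-- Geometric rough paths: the `d_α`-closure of the lifts of the Lipschitz paths from `0`. -/
def IsGeometric (W : RoughPath α T d) : Prop :=
  ∀ ε > 0, ∃ (w : ℝ → E d) (v : RoughPath α T d),
    IsLipschitzPath T w ∧ v.IsLiftOf w ∧ hdist W v < ε

end RoughPath

end RoughPaths

section Equations

variable {p d : ℕ} {Z M : Type*} [TopologicalSpace Z] [TopologicalSpace M]

/-- `x : [a, b] → M` solves `dx = ∑ᵢ Vᵢ(x) dwⁱ + V₀(x) dt`, `x_a = m`, driven by the rough path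
`W`. -/
def IsRDESolution (A : FoliatedAtlas p Z M) (V : Fin d → A.LeafVectorField)
    (V₀ : A.LeafVectorField) {α T : ℝ} (W : RoughPath α T d) (a b : ℝ) (m : M)
    (x : ℝ → M) : Prop :=
  ContinuousOn x (Icc a b) ∧ x a = m ∧
  ∀ f : M → ℝ, A.LeafwiseContDiff 3 f →
    ∃ C : ℝ, ∀ s t, a ≤ s → s ≤ t → t ≤ b →
      |f (x t) - f (x s)
        - (∑ i, (V i).deriv f (x s) * W.fst s t i
          + ∑ j, ∑ k, (V j).deriv ((V k).deriv f) (x s) * W.snd s t (j, k)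
          + V₀.deriv f (x s) * (t - s))| ≤ C * (t - s) ^ (3 * α)

/-- `x : [a, b] → M` solves `dx = ∑ᵢ Vᵢ(x) dwⁱ + V₀(x) dt`, `x_a = m`, in the Riemann–Stieltjes
sense: as long as `x` is in a chart, it moves in a plaque (`z` is constant), and its leaf
coordinate satisfies
`y_t - y_s = ∑ᵢ ∫_s^t Ṽᵢ(y_u, z) dwⁱ_u + ∫_s^t Ṽ₀(y_u, z) du`. -/
def IsODESolution (A : FoliatedAtlas p Z M) (V : Fin d → A.LeafVectorField)
    (V₀ : A.LeafVectorField) (w : ℝ → E d) (a b : ℝ) (m : M) (x : ℝ → M) : Prop :=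
  ContinuousOn x (Icc a b) ∧ x a = m ∧
  ∀ φ ∈ A.charts, ∀ s t, a ≤ s → s ≤ t → t ≤ b → (∀ u ∈ Icc s t, x u ∈ φ.source) →
    (φ (x t)).2 = (φ (x s)).2 ∧
    ∃ (I : Fin d → E p) (I₀ : E p),
      (∀ i, HasRSIntegral (fun u => (V i).inChart φ (φ (x u))) (fun u => w u i) s t (I i)) ∧
      HasRSIntegral (fun u => V₀.inChart φ (φ (x u))) (fun u => u) s t I₀ ∧
      (φ (x t)).1 - (φ (x s)).1 = ∑ i, I i + I₀

end Equations

end FoliatedRDE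

/-! In a chart the equation is a rough differential equation in `ℝ^p` with the transverse coordinate
as a frozen parameter. It is solved there, and the pieces are glued by compactness of `M`.

The definition of a solution only tests against leafwise functions, so it must first be shown that a
solution stays in its plaque. A localized distance to the initial transverse coordinate `z₀` has
vanishing leafwise derivatives. Hence its increments along a solution are `O((t - s)^(3α))`, and as
`3α > 1` it is constant, equal to `0`. Testing with localized leaf coordinates then shows that
`y(x_t)` differs from the second order Euler step `y + roughIncr` started at `y(x_s)` by `O((t -
s)^(3α))` (`IsRDESolution.isLocalSolutionAt`). Conversely, a path with these two local properties is
a solution (`isRDESolution_of_isLocalSolutionAt`). This is a second order Taylor expansion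
(`BddFields.chain_rule`), and geometricity enters because the symmetric part of `𝐰²` must be `½ 𝐰¹ ⊗
𝐰¹`. So being a solution is a local statement about the Euler scheme.

After a cut-off in the leaf variable, the Euler steps `S s t` form an almost flow. By Chen's
relation the terms of first and second order in `S u t ∘ S s u - S s t` cancel, which leaves a
defect of order `3α` in Lipschitz norm (`BddFields.eulerIncr_defect`). Two abstract facts about
almost flows do the analysis. Euler polygons on uniform grids satisfy the `3α`-estimate uniformly in
the mesh, so limits of them follow the almost flow (`IsAlmostFlow.exists_path`). The difference of
the remainders of two such paths from the same point obeys a contracting estimate under bisection,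
so the paths agree for a short time (`IsAlmostFlow.unique`).

The constants depend only on `𝐰` and on bounds for the fields, which are uniform over compact sets
of plaques. Thus solutions live for a time that is locally uniform in the starting point, hence
uniform on the compact space `M`, and `IsRDESolution.concat` extends them to `[a, b]`. Uniqueness
spreads from short times to `[a, b]` by a closed-open argument.

For the lift of a Lipschitz path, `𝐰²` is `O((t - s)²)`, so the Euler step reduces to its first
order part. Following it up to an order above one is the same as solving the Riemann–Stieltjes
equation: integrals are approximated by frozen integrands in one direction, and Riemann sums
telescope in the other. Both equations therefore have the same solutions, and the ODE inherits
existence and uniqueness from the rough equation. -/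

namespace FoliatedRDE

/-! ### Calculus of functions that are smooth along the leaf variable only -/

section LeafwiseCalculus

variable {p : ℕ} {Z W' F G H : Type*} [TopologicalSpace Z] [TopologicalSpace W']
  [NormedAddCommGroup F] [NormedSpace ℝ F] [NormedAddCommGroup G] [NormedSpace ℝ G]
  [NormedAddCommGroup H] [NormedSpace ℝ H]

/-- The derivative in the leaf variable. -/
noncomputable def leafFDeriv (f : E p × Z → F) : E p × Z → (E p →L[ℝ] F) :=
  fun q => fderiv ℝ (fun y => f (y, q.2)) q.1

lemma isOpen_slice {U : Set (E p × Z)} (hU : IsOpen U) (z : Z) : IsOpen {y | (y, z) ∈ U} :=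
  hU.preimage (by fun_prop : Continuous fun y : E p => (y, z))

lemma slice_mem_nhds {U : Set (E p × Z)} (hU : IsOpen U) {q : E p × Z} (hq : q ∈ U) :
    ∀ᶠ y in 𝓝 q.1, (y, q.2) ∈ U :=
  (isOpen_slice hU q.2).mem_nhds hq

lemma leafwiseContDiffOn_zero {f : E p × Z → F} {U : Set (E p × Z)} :
    LeafwiseContDiffOn 0 f U ↔ ContinuousOn f U := by
  constructor
  · rintro ⟨-, h⟩
    have := h 0 le_rfl
    simp only [iteratedFDeriv_zero_eq_comp, Function.comp_def] at this
    exact (continuousMultilinearCurryFin0 ℝ (E p) F).symm.toHomeomorph.isInducing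
      |>.continuousOn_iff.2 this
  · intro h
    refine ⟨fun z => ?_, fun l hl => ?_⟩
    · simp only [Nat.cast_zero, contDiffOn_zero]
      exact h.comp (by fun_prop) fun y hy => hy
    · obtain rfl : l = 0 := by omega
      simp only [iteratedFDeriv_zero_eq_comp, Function.comp_def]
      exact (continuousMultilinearCurryFin0 ℝ (E p) F).symm.continuous.comp_continuousOn h

/-- Up to a linear isometry, the iterated derivative of order `l + 1` is the one of order `l` of the
derivative, and isometries preserve joint continuity. The recursion turns the Leibniz and chain
rules into inductions on `k` that need no formula for higher derivatives. -/
lemma leafwiseContDiffOn_succ {k : ℕ} {f : E p × Z → F} {U : Set (E p × Z)} (hU : IsOpen U) :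
    LeafwiseContDiffOn (k + 1) f U ↔ ContinuousOn f U ∧
      (∀ q ∈ U, DifferentiableAt ℝ (fun y => f (y, q.2)) q.1) ∧
      LeafwiseContDiffOn k (leafFDeriv f) U := by
  have key : ∀ l : ℕ, ContinuousOn
      (fun q : E p × Z => iteratedFDeriv ℝ (l + 1) (fun y => f (y, q.2)) q.1) U ↔
      ContinuousOn (fun q : E p × Z =>
        iteratedFDeriv ℝ l (fun y => leafFDeriv f (y, q.2)) q.1) U := by
    intro l
    have : (fun q : E p × Z => iteratedFDeriv ℝ (l + 1) (fun y => f (y, q.2)) q.1) =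
        fun q : E p × Z => (continuousMultilinearCurryRightEquiv' ℝ l (E p) F).symm
          (iteratedFDeriv ℝ l (fun y => leafFDeriv f (y, q.2)) q.1) := by
      funext q
      rw [iteratedFDeriv_succ_eq_comp_right]
      rfl
    rw [this]
    exact (continuousMultilinearCurryRightEquiv' ℝ l (E p) F).symm.toHomeomorph.isInducing
      |>.continuousOn_iff.symm
  constructor
  · rintro ⟨h1, h2⟩
    refine ⟨leafwiseContDiffOn_zero.1 ⟨fun z => (h1 z).of_le (by simp), fun l hl =>
      h2 l (by omega)⟩, fun q hq => ?_, fun z => ?_, fun l hl => (key l).1 (h2 _ (by omega))⟩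
    · exact (((h1 q.2).differentiableOn (by simp)) q.1 hq).differentiableAt
        ((isOpen_slice hU q.2).mem_nhds hq)
    · have := h1 z
      push_cast at this
      exact ((contDiffOn_succ_iff_fderiv_of_isOpen (isOpen_slice hU z)).1 this).2.2
  · rintro ⟨h0, h1, h2, h3⟩
    refine ⟨fun z => ?_, fun l hl => ?_⟩
    · push_cast
      refine (contDiffOn_succ_iff_fderiv_of_isOpen (isOpen_slice hU z)).2
        ⟨fun y hy => (h1 (y, z) hy).differentiableWithinAt, by simp, h2 z⟩
    · cases l with
      | zero => exact (leafwiseContDiffOn_zero.2 h0).2 0 le_rfl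
      | succ l => exact (key l).2 (h3 l (by omega))

namespace LeafwiseContDiffOn

lemma of_le {k l : ℕ} (hl : l ≤ k) {f : E p × Z → F} {U : Set (E p × Z)}
    (h : LeafwiseContDiffOn k f U) : LeafwiseContDiffOn l f U :=
  ⟨fun z => (h.1 z).of_le (by exact_mod_cast hl), fun i hi => h.2 i (hi.trans hl)⟩

lemma continuousOn {k : ℕ} {f : E p × Z → F} {U : Set (E p × Z)}
    (h : LeafwiseContDiffOn k f U) : ContinuousOn f U :=
  leafwiseContDiffOn_zero.1 (h.of_le (Nat.zero_le _))

lemma differentiableAt {k : ℕ} (hk : 1 ≤ k) {f : E p × Z → F} {U : Set (E p × Z)} (hU : IsOpen U)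
    (h : LeafwiseContDiffOn k f U) {q : E p × Z} (hq : q ∈ U) :
    DifferentiableAt ℝ (fun y => f (y, q.2)) q.1 :=
  ((leafwiseContDiffOn_succ hU).1 (h.of_le (l := 0 + 1) hk)).2.1 q hq

lemma leafFDeriv {k : ℕ} {f : E p × Z → F} {U : Set (E p × Z)} (hU : IsOpen U)
    (h : LeafwiseContDiffOn (k + 1) f U) : LeafwiseContDiffOn k (leafFDeriv f) U :=
  ((leafwiseContDiffOn_succ hU).1 h).2.2

lemma of_locally {k : ℕ} {f : E p × Z → F} {U : Set (E p × Z)}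
    (h : ∀ q ∈ U, ∃ N, IsOpen N ∧ q ∈ N ∧ LeafwiseContDiffOn k f N) :
    LeafwiseContDiffOn k f U := by
  refine ⟨fun z y hy => ?_, fun l hl q hq => ?_⟩
  · obtain ⟨N, hN, hqN, hf⟩ := h (y, z) hy
    exact ((hf.1 z).contDiffAt ((isOpen_slice hN z).mem_nhds hqN)).contDiffWithinAt
  · obtain ⟨N, hN, hqN, hf⟩ := h q hq
    exact ((hf.2 l hl).continuousAt (hN.mem_nhds hqN)).continuousWithinAt

lemma congr {k : ℕ} {f g : E p × Z → F} {U : Set (E p × Z)} (hU : IsOpen U)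
    (h : LeafwiseContDiffOn k f U) (hfg : ∀ q ∈ U, g q = f q) : LeafwiseContDiffOn k g U := by
  refine ⟨fun z => (h.1 z).congr fun y hy => hfg _ hy, fun l hl => (h.2 l hl).congr ?_⟩
  intro q hq
  refine Filter.EventuallyEq.eq_of_nhds (Filter.EventuallyEq.iteratedFDeriv ℝ ?_ l)
  filter_upwards [slice_mem_nhds hU hq] with y hy using hfg _ hy

lemma add {k : ℕ} {f g : E p × Z → F} {U : Set (E p × Z)} (hU : IsOpen U)
    (hf : LeafwiseContDiffOn k f U) (hg : LeafwiseContDiffOn k g U) :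
    LeafwiseContDiffOn k (fun q => f q + g q) U := by
  refine ⟨fun z => (hf.1 z).add (hg.1 z), fun l hl => ?_⟩
  refine ((hf.2 l hl).add (hg.2 l hl)).congr fun q hq => ?_
  have h1 := (((hf.1 q.2).of_le (by exact_mod_cast hl)).contDiffAt
    ((isOpen_slice hU q.2).mem_nhds hq) : ContDiffAt ℝ l _ q.1)
  have h2 := (((hg.1 q.2).of_le (by exact_mod_cast hl)).contDiffAt
    ((isOpen_slice hU q.2).mem_nhds hq) : ContDiffAt ℝ l _ q.1)
  exact iteratedFDeriv_add_apply h1 h2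

/-- A function that is locally constant in the leaf variable. -/
lemma of_transverse {k : ℕ} {f : E p × Z → F} {U : Set (E p × Z)} (hU : IsOpen U)
    (hc : ContinuousOn f U)
    (h : ∀ q ∈ U, ∀ᶠ y in 𝓝 q.1, f (y, q.2) = f q) : LeafwiseContDiffOn k f U := by
  induction k with
  | zero => exact leafwiseContDiffOn_zero.2 hc
  | succ k _ =>
    have hd : ∀ q ∈ U, HasFDerivAt (fun y => f (y, q.2)) (0 : E p →L[ℝ] F) q.1 := fun q hq =>
      (hasFDerivAt_const (f q) q.1).congr_of_eventuallyEq (h q hq)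
    refine (leafwiseContDiffOn_succ hU).2 ⟨hc, fun q hq => (hd q hq).differentiableAt, ?_⟩
    have h0 : LeafwiseContDiffOn k (fun _ : E p × Z => (0 : E p →L[ℝ] F)) U :=
      ⟨fun z => contDiffOn_const, fun l _ => by
        simp only [iteratedFDeriv_fun_zero]; exact continuousOn_const⟩
    exact h0.congr hU fun q hq => (hd q hq).fderiv

end LeafwiseContDiffOn

end LeafwiseCalculus

/-! ### Leibniz and chain rules in the leaf variable -/

section LeafwiseBilinear

universe u v
variable {p : ℕ} {Z : Type v} [TopologicalSpace Z]

/-- The derivative is a sum of two expressions of the same kind, with `B` replaced by `B.precompR`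
and `B.precompL`. The spaces stay free in the induction to absorb this change of bilinear map. -/
lemma LeafwiseContDiffOn.bilinear {k : ℕ} {F G H : Type u}
    [NormedAddCommGroup F] [NormedSpace ℝ F] [NormedAddCommGroup G] [NormedSpace ℝ G]
    [NormedAddCommGroup H] [NormedSpace ℝ H] (B : F →L[ℝ] G →L[ℝ] H)
    {f : E p × Z → F} {g : E p × Z → G} {U : Set (E p × Z)} (hU : IsOpen U)
    (hf : LeafwiseContDiffOn k f U) (hg : LeafwiseContDiffOn k g U) :
    LeafwiseContDiffOn k (fun q => B (f q) (g q)) U := by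
  induction k generalizing F G H with
  | zero =>
    rw [leafwiseContDiffOn_zero] at *
    exact B.continuous₂.comp_continuousOn (hf.prodMk hg)
  | succ k ih =>
    have hc : ContinuousOn (fun q => B (f q) (g q)) U :=
      B.continuous₂.comp_continuousOn (hf.continuousOn.prodMk hg.continuousOn)
    have hd : ∀ q ∈ U, HasFDerivAt (fun y => B (f (y, q.2)) (g (y, q.2)))
        (B.precompR (E p) (f q) (FoliatedRDE.leafFDeriv g q) +
          B.precompL (E p) (FoliatedRDE.leafFDeriv f q) (g q)) q.1 := fun q hq =>
      B.hasFDerivAt_of_bilinear (hf.differentiableAt (by omega) hU hq).hasFDerivAt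
        (hg.differentiableAt (by omega) hU hq).hasFDerivAt
    refine (leafwiseContDiffOn_succ hU).2 ⟨hc, fun q hq => (hd q hq).differentiableAt, ?_⟩
    have h1 := ih (B.precompR (E p)) (hf.of_le (Nat.le_succ k)) (hg.leafFDeriv hU)
    have h2 := ih (B.precompL (E p)) (hf.leafFDeriv hU) (hg.of_le (Nat.le_succ k))
    exact (h1.add hU h2).congr hU fun q hq => (hd q hq).fderiv

lemma LeafwiseContDiffOn.contDiff_comp {k : ℕ} {F G : Type u}
    [NormedAddCommGroup F] [NormedSpace ℝ F] [NormedAddCommGroup G] [NormedSpace ℝ G]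
    {g : F → G} (hg : ContDiff ℝ k g) {f : E p × Z → F} {U : Set (E p × Z)} (hU : IsOpen U)
    (hf : LeafwiseContDiffOn k f U) : LeafwiseContDiffOn k (fun q => g (f q)) U := by
  induction k generalizing G with
  | zero =>
    rw [leafwiseContDiffOn_zero] at *
    exact hg.continuous.comp_continuousOn hf
  | succ k ih =>
    have hd : ∀ q ∈ U, HasFDerivAt (fun y => g (f (y, q.2)))
        ((fderiv ℝ g (f q)).comp (FoliatedRDE.leafFDeriv f q)) q.1 := fun q hq =>
      ((hg.differentiable (by simp)).differentiableAt.hasFDerivAt).comp q.1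
        (hf.differentiableAt (by omega) hU hq).hasFDerivAt
    refine (leafwiseContDiffOn_succ hU).2 ⟨hg.continuous.comp_continuousOn hf.continuousOn,
      fun q hq => (hd q hq).differentiableAt, ?_⟩
    have hg' : ContDiff ℝ k (fderiv ℝ g) := hg.fderiv_right (by simp)
    have h1 := ih hg' (hf.of_le (Nat.le_succ k))
    exact (h1.bilinear (ContinuousLinearMap.compL ℝ (E p) F G) hU (hf.leafFDeriv hU)).congr hU
      fun q hq => (hd q hq).fderiv

end LeafwiseBilinear

/-! ### Chart independence of derivatives, and extension of functions from a chart -/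

namespace FoliatedAtlas

variable {p : ℕ} {Z M : Type*} [TopologicalSpace Z] [TopologicalSpace M]
  {A : FoliatedAtlas p Z M}

/-- The transverse part of a coordinate change depends on `z` alone only locally, so along a plaque
of `φ` the transverse coordinate of `ψ` is locally constant, not necessarily constant. -/
lemma transverse_eventually_eq {φ ψ : OpenPartialHomeomorph M (E p × Z)} (hφ : φ ∈ A.charts)
    (hψ : ψ ∈ A.charts) {q : E p × Z} (hq : q ∈ φ.target) (hq' : φ.symm q ∈ ψ.source) :
    ∀ᶠ y in 𝓝 q.1, (ψ (φ.symm (y, q.2))).2 = (ψ (φ.symm q)).2 := by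
  have hqs : q ∈ (φ.symm.trans ψ).source := by simp [hq, hq']
  obtain ⟨N, -, hN, hqN, f₂, -, hf⟩ := (A.compatible φ hφ ψ hψ).2 q hqs
  filter_upwards [slice_mem_nhds hN hqN] with y hy
  rw [hf _ hy, hf _ hqN]

lemma LeafwiseContDiff.continuous {k : ℕ} {f : M → ℝ} (hf : A.LeafwiseContDiff k f) :
    Continuous f := by
  refine continuous_iff_continuousAt.2 fun m => ?_
  obtain ⟨φ, hφ, hm⟩ := A.cover m
  have h1 : ContinuousAt (fun q => f (φ.symm q)) (φ m) :=
    (hf φ hφ).continuousOn.continuousAt (φ.open_target.mem_nhds (φ.map_source hm))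
  refine (h1.comp (φ.continuousAt hm)).congr ?_
  filter_upwards [φ.open_source.mem_nhds hm] with m' hm'
  simp [φ.left_inv hm']

/-- The derivative along a leafwise vector field may be computed in any chart. -/
lemma deriv_symm_apply {k : ℕ} (hk : 1 ≤ k) {f : M → ℝ} (hf : A.LeafwiseContDiff k f)
    (V : A.LeafVectorField) {φ : OpenPartialHomeomorph M (E p × Z)} (hφ : φ ∈ A.charts)
    {q : E p × Z} (hq : q ∈ φ.target) :
    V.deriv f (φ.symm q) = leafFDeriv (fun q => f (φ.symm q)) q (V.inChart φ q) := by
  set m := φ.symm q with hm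
  set ψ := A.chartAt m with hψdef
  have hψ : ψ ∈ A.charts := A.chartAt_mem m
  have hmψ : m ∈ ψ.source := A.mem_chartAt_source m
  have hmφ : m ∈ φ.source := φ.map_target hq
  have hφm : φ m = q := φ.right_inv hq
  have hqs : q ∈ (φ.symm.trans ψ).source := by simpa [hq] using hmψ
  have hT : DifferentiableAt ℝ (fun y => (ψ (φ.symm (y, q.2))).1) q.1 :=
    ((A.compatible φ hφ ψ hψ).1 1).differentiableAt le_rfl (φ.symm.trans ψ).open_source hqs
  have hfψ : DifferentiableAt ℝ (fun y => f (ψ.symm (y, (ψ m).2))) (ψ m).1 :=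
    (hf ψ hψ).differentiableAt hk ψ.open_target (ψ.map_source hmψ)
  have hcc := (V m).coord_change φ hφ ψ hψ hmφ hmψ
  rw [hφm] at hcc
  -- Near `q.1` the transverse coordinate in `ψ` is fixed, so `f` on the plaque of `φ` is its
  -- expression on a single plaque of `ψ` composed with the leafwise coordinate change. The
  -- resulting factor is the one in `coord_change`.
  have hcomp : HasFDerivAt (fun y => f (φ.symm (y, q.2)))
      ((fderiv ℝ (fun y => f (ψ.symm (y, (ψ m).2))) (ψ m).1).comp
        (fderiv ℝ (fun y => (ψ (φ.symm (y, q.2))).1) q.1)) q.1 := by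
    refine (HasFDerivAt.comp (g := fun y => f (ψ.symm (y, (ψ m).2))) q.1 hfψ.hasFDerivAt
      hT.hasFDerivAt).congr_of_eventuallyEq ?_
    filter_upwards [transverse_eventually_eq hφ hψ hq hmψ,
      slice_mem_nhds (φ.symm.trans ψ).open_source hqs] with y hy hys
    have hys' : φ.symm (y, q.2) ∈ ψ.source := by
      have := hys; simp at this; exact this.2
    have : ((ψ (φ.symm (y, q.2))).1, (ψ m).2) = ψ (φ.symm (y, q.2)) := by
      rw [hm, ← hy]
    simp only [Function.comp_apply]
    rw [this, ψ.left_inv hys']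
  unfold LeafVectorField.deriv leafFDeriv LeafVectorField.inChart
  rw [hcomp.fderiv, ← hm, ← hψdef, hcc]
  rfl

lemma LeafwiseContDiff.deriv {k : ℕ} {f : M → ℝ} (hf : A.LeafwiseContDiff (k + 1) f)
    {V : A.LeafVectorField} (hV : V.IsLeafwiseContDiff k) :
    A.LeafwiseContDiff k (V.deriv f) := by
  intro φ hφ
  refine (((hf φ hφ).leafFDeriv φ.open_target).bilinear (ContinuousLinearMap.id ℝ (E p →L[ℝ] ℝ))
    φ.open_target (hV φ hφ)).congr φ.open_target fun q hq => ?_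
  exact deriv_symm_apply (Nat.le_add_left 1 k) hf V hφ hq

lemma LeafVectorField.IsLeafwiseContDiff.of_le {k l : ℕ} {V : A.LeafVectorField}
    (hV : V.IsLeafwiseContDiff k) (hl : l ≤ k) : V.IsLeafwiseContDiff l :=
  fun φ hφ => (hV φ hφ).of_le hl

open Classical in
/-- A compactly supported product function in a chart extends to a leafwise smooth function. -/
lemma exists_leafwiseContDiff_extension [T2Space M]
    {φ : OpenPartialHomeomorph M (E p × Z)} (hφ : φ ∈ A.charts) {K₁ : Set (E p)} {K₂ : Set Z}
    (hK₁ : IsCompact K₁) (hK₂ : IsCompact K₂) (hK : K₁ ×ˢ K₂ ⊆ φ.target)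
    {G : E p → ℝ} (hG : ∀ k : ℕ, ContDiff ℝ k G) (hG0 : ∀ y ∉ K₁, G y = 0)
    {c : Z → ℝ} (hc : Continuous c) (hc0 : ∀ z ∉ K₂, c z = 0) :
    ∃ f : M → ℝ, (∀ k, A.LeafwiseContDiff k f) ∧
      ∀ q ∈ φ.target, f (φ.symm q) = G q.1 * c q.2 := by
  set f : M → ℝ := fun m => if m ∈ φ.source then G (φ m).1 * c (φ m).2 else 0 with hf
  refine ⟨f, fun k ψ hψ => ?_, fun q hq => ?_⟩
  swap
  · simp [hf, φ.map_target hq, φ.right_inv hq]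
  refine LeafwiseContDiffOn.of_locally fun q hq => ?_
  by_cases hqφ : ψ.symm q ∈ φ.source
  · have hqs : q ∈ (ψ.symm.trans φ).source := by simp [hq, hqφ]
    refine ⟨_, (ψ.symm.trans φ).open_source, hqs, ?_⟩
    have hO := (ψ.symm.trans φ).open_source
    have h1 := ((A.compatible ψ hψ φ hφ).1 k).contDiff_comp (hG k) hO
    -- The transverse factor is locally constant along plaques, which is why mere continuity of `c`
    -- suffices.
    have h2 : LeafwiseContDiffOn k (fun q => c (φ (ψ.symm q)).2) (ψ.symm.trans φ).source := by
      refine LeafwiseContDiffOn.of_transverse hO ?_ fun q' hq' => ?_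
      · exact hc.comp_continuousOn (continuous_snd.comp_continuousOn
          (ψ.symm.trans φ).continuousOn)
      · have hq'' : q' ∈ ψ.target ∧ ψ.symm q' ∈ φ.source := by simpa using hq'
        filter_upwards [transverse_eventually_eq hψ hφ hq''.1 hq''.2] with y hy
        rw [hy]
    refine (h1.bilinear (ContinuousLinearMap.mul ℝ ℝ) hO h2).congr hO fun q' hq' => ?_
    have hq'' : q' ∈ ψ.target ∧ ψ.symm q' ∈ φ.source := by simpa using hq'
    simp [hf, hq''.2]
  -- Outside `φ.source`: the compact set `K` is closed because `M` is Hausdorff, and `f` vanishes on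
  -- its open complement.
  · set K : Set M := φ.symm '' (K₁ ×ˢ K₂)
    have hKc : IsClosed K :=
      ((hK₁.prod hK₂).image_of_continuousOn (φ.continuousOn_symm.mono hK)).isClosed
    have hO : IsOpen (ψ.target ∩ ψ.symm ⁻¹' Kᶜ) :=
      ψ.continuousOn_symm.isOpen_inter_preimage ψ.open_target hKc.isOpen_compl
    refine ⟨_, hO, ⟨hq, ?_⟩, ?_⟩
    · rintro ⟨q', hq', h⟩
      exact hqφ (h ▸ φ.map_target (hK hq'))
    · have h0 : LeafwiseContDiffOn k (fun _ : E p × Z => (0 : ℝ)) (ψ.target ∩ ψ.symm ⁻¹' Kᶜ) :=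
        LeafwiseContDiffOn.of_transverse hO continuousOn_const fun q _ =>
          Filter.Eventually.of_forall fun _ => rfl
      refine h0.congr hO fun q' hq' => ?_
      simp only [hf]
      split_ifs with hs
      · by_cases h1 : (φ (ψ.symm q')).1 ∈ K₁
        · by_cases h2 : (φ (ψ.symm q')).2 ∈ K₂
          · exact absurd ⟨φ (ψ.symm q'), ⟨h1, h2⟩, φ.left_inv hs⟩ hq'.2
          · simp [hc0 _ h2]
        · simp [hG0 _ h1]
      · rfl

end FoliatedAtlas

/-! ### Almost flows and the uniqueness of paths that follow them -/

section AlmostFlow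

variable {X Y : Type*} [NormedAddCommGroup X] [NormedAddCommGroup Y]

/-- `f` is bounded by `c` and `c`-Lipschitz. -/
structure BddLip (c : ℝ) (f : X → Y) : Prop where
  norm_le : ∀ x, ‖f x‖ ≤ c
  lip : ∀ x y, ‖f x - f y‖ ≤ c * ‖x - y‖

/-- Maps `S s t`, `a ≤ s ≤ t ≤ b`, that satisfy the flow property up to an error of order
`(t - s) ^ (3 * α)` in Lipschitz norm. -/
structure IsAlmostFlow (α K a b : ℝ) (S : ℝ → ℝ → X → X) : Prop where
  incr : ∀ s t, a ≤ s → s ≤ t → t ≤ b → BddLip (K * (t - s) ^ α) (fun y => S s t y - y)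
  four_point : ∀ s t, a ≤ s → s ≤ t → t ≤ b → ∀ x r y r',
    ‖(S s t (x + r) - (x + r) - (S s t x - x)) - (S s t (y + r') - (y + r') - (S s t y - y))‖ ≤
      K * (t - s) ^ α * (‖r - r'‖ + ‖r'‖ * ‖x - y‖)
  defect : ∀ s u t, a ≤ s → s ≤ u → u ≤ t → t ≤ b →
    BddLip (K * (t - s) ^ (3 * α)) (fun y => S u t (S s u y) - S s t y)

/-- The gain `(2 / 3) ^ (θ - 1) < 1` from cutting an interval drives both the existence and the
uniqueness argument. It comes from `x ^ θ = x * x ^ (θ - 1)`, bounding the second factor by the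
maximal length of a piece and summing the first. The bound `2 / 3` instead of `1 / 2` leaves room
for cutting an odd number of grid steps. -/
lemma rpow_split {θ c s u t : ℝ} (hθ : 1 < θ) (hc : 0 ≤ c) (hsu : s ≤ u) (hut : u ≤ t)
    (h1 : u - s ≤ 2 / 3 * (t - s)) (h2 : t - u ≤ 2 / 3 * (t - s)) :
    (1 + c) * (u - s) ^ θ + (t - u) ^ θ ≤ (2 / 3) ^ (θ - 1) * (1 + c) * (t - s) ^ θ := by
  have key : ∀ x : ℝ, 0 ≤ x → x ≤ 2 / 3 * (t - s) →
      x ^ θ ≤ x * ((2 / 3) ^ (θ - 1) * (t - s) ^ (θ - 1)) := by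
    intro x hx hxt
    rw [← Real.mul_rpow (by norm_num) (by linarith)]
    calc x ^ θ = x * x ^ (θ - 1) := by
          rw [← Real.rpow_one_add' hx (by linarith)]; congr 1; ring
      _ ≤ _ := by gcongr
  have hts : (t - s) ^ θ = (t - s) * (t - s) ^ (θ - 1) := by
    rw [← Real.rpow_one_add' (by linarith) (by linarith)]; congr 1; ring
  have k1 := key (u - s) (by linarith) h1
  have k2 := key (t - u) (by linarith) h2
  have h0 : 0 ≤ (t - u) * ((2 / 3 : ℝ) ^ (θ - 1) * (t - s) ^ (θ - 1)) := by
    have : 0 ≤ t - s := by linarith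
    have : 0 ≤ t - u := by linarith
    positivity
  rw [hts]
  nlinarith [mul_le_mul_of_nonneg_left k1 (by linarith : (0 : ℝ) ≤ 1 + c),
    mul_nonneg hc h0]

lemma two_thirds_rpow_lt_one {θ : ℝ} (hθ : 1 < θ) : (2 / 3 : ℝ) ^ (θ - 1) < 1 :=
  Real.rpow_lt_one (by norm_num) (by norm_num) (by linarith)

lemma exists_pos_rpow_le {β ε : ℝ} (hβ : 0 < β) (hε : 0 < ε) :
    ∃ h > 0, h ≤ 1 ∧ ∀ x, 0 ≤ x → x ≤ h → x ^ β ≤ ε := by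
  refine ⟨min 1 (ε ^ β⁻¹), by positivity, min_le_left _ _, fun x hx hxh => ?_⟩
  calc x ^ β ≤ (ε ^ β⁻¹) ^ β := by gcongr; exact hxh.trans (min_le_right _ _)
    _ = ε := Real.rpow_inv_rpow hε.le hβ.ne'

namespace IsAlmostFlow

variable {α K a b : ℝ} {S : ℝ → ℝ → X → X}

lemma self_apply (hS : IsAlmostFlow α K a b S) (hα : 1 / 3 < α) {s : ℝ} (h1 : a ≤ s) (h2 : s ≤ b)
    (y : X) : S s s y = y := by
  have := (hS.incr s s h1 le_rfl h2).norm_le y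
  rw [sub_self, Real.zero_rpow (by linarith), mul_zero] at this
  exact sub_eq_zero.1 (norm_le_zero_iff.1 this)

lemma apply_sub_le (hS : IsAlmostFlow α K a b S) {s t : ℝ} (h1 : a ≤ s)
    (h2 : s ≤ t) (h3 : t ≤ b) (x y : X) :
    ‖S s t x - S s t y‖ ≤ (1 + K * (t - s) ^ α) * ‖x - y‖ := by
  have h := (hS.incr s t h1 h2 h3).lip x y
  calc ‖S s t x - S s t y‖ = ‖(S s t x - x - (S s t y - y)) + (x - y)‖ := by congr 1; abel
    _ ≤ _ := (norm_add_le _ _).trans (by linarith)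

/-- The error of a concatenation. -/
lemma concat_le (hS : IsAlmostFlow α K a b S) {s u t : ℝ} (h1 : a ≤ s) (h2 : s ≤ u)
    (h3 : u ≤ t) (h4 : t ≤ b) (x y z : X) :
    ‖z - S s t x‖ ≤ ‖z - S u t y‖ + (1 + K * (t - u) ^ α) * ‖y - S s u x‖ +
      K * (t - s) ^ (3 * α) := by
  have e1 := hS.apply_sub_le (h1.trans h2) h3 h4 y (S s u x)
  have e2 := (hS.defect s u t h1 h2 h3 h4).norm_le x
  calc ‖z - S s t x‖ = ‖(z - S u t y) + (S u t y - S u t (S s u x)) +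
        (S u t (S s u x) - S s t x)‖ := by congr 1; abel
    _ ≤ ‖z - S u t y‖ + ‖S u t y - S u t (S s u x)‖ + ‖S u t (S s u x) - S s t x‖ :=
        norm_add₃_le
    _ ≤ _ := by linarith

/-- The one-step contraction behind uniqueness. -/
lemma unique_step (hS : IsAlmostFlow α K a b S) (hα : 1 / 3 < α) (hK : 0 ≤ K) {x y : ℝ → X}
    {C M D h e : ℝ} (hC : 0 ≤ C) (hM : 0 ≤ M) (hD : 0 ≤ D) (hh1 : h ≤ 1)
    (hy : ∀ s t, a ≤ s → s ≤ t → t ≤ b → ‖y t - S s t (y s)‖ ≤ C * (t - s) ^ (3 * α))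
    (he : ∀ r, 0 ≤ r → r ≤ h → K * r ^ α ≤ e)
    (hQ : ∀ s t, a ≤ s → s ≤ t → t ≤ b → t ≤ a + h → ‖x t - y t‖ ≤ D ∧
      ‖(x t - S s t (x s)) - (y t - S s t (y s))‖ ≤ M * D * (t - s) ^ (3 * α))
    {s t : ℝ} (hs : a ≤ s) (hst : s ≤ t) (ht : t ≤ b) (hth : t ≤ a + h) :
    ‖(x t - S s t (x s)) - (y t - S s t (y s))‖ ≤
      ((2 / 3) ^ (3 * α - 1) * (1 + e) * M + K * (C * (1 + K) + 1)) * D * (t - s) ^ (3 * α) := by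
  set u := (s + t) / 2 with hu
  have hsu : s ≤ u := by linarith
  have hut : u ≤ t := by linarith
  have hub : u ≤ b := by linarith
  have hau : a ≤ u := by linarith
  set a' := S s u (x s) with ha'
  set b' := S s u (y s) with hb'
  have hRsu := (hQ s u hs hsu hub (by linarith)).2
  have hRut := (hQ u t hau hut ht hth).2
  have hΔs := (hQ s s hs le_rfl (by linarith) (by linarith)).1
  have hfour := hS.four_point u t hau hut ht a' (x u - a') b' (y u - b')
  simp only [add_sub_cancel] at hfour
  have hdef := (hS.defect s u t hs hsu hut ht).lip (x s) (y s)
  have hr := hy s u hs hsu hub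
  have hab := hS.apply_sub_le hs hsu hub (x s) (y s)
  have hKu : K * (u - s) ^ α ≤ K :=
    mul_le_of_le_one_right hK (Real.rpow_le_one (by linarith) (by linarith) (by linarith))
  have hKt : K * (t - u) ^ α ≤ K :=
    mul_le_of_le_one_right hK (Real.rpow_le_one (by linarith) (by linarith) (by linarith))
  have hKte : K * (t - u) ^ α ≤ e := he _ (by linarith) (by linarith)
  have hKt0 : 0 ≤ K * (t - u) ^ α := by
    have : 0 ≤ t - u := by linarith
    positivity
  have hus : (u - s) ^ (3 * α) ≤ (t - s) ^ (3 * α) :=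
    Real.rpow_le_rpow (by linarith) (by linarith) (by linarith)
  have hus0 : 0 ≤ (u - s) ^ (3 * α) := Real.rpow_nonneg (by linarith) _
  have hsplit := rpow_split (θ := 3 * α) (c := e) (s := s) (u := u) (t := t) (by linarith)
    (hKt0.trans hKte) hsu hut (by linarith) (by linarith)
  -- The four summands are the difference of remainders on `[u, t]`, the same on `[s, u]`, a second
  -- difference of `S u t - id` controlled by `four_point`, and a difference of flow defects. The
  -- last two are small because the base points `a'`, `b'` are `O(D)` apart.
  have hdecomp : (x t - S s t (x s)) - (y t - S s t (y s)) =
      ((x t - S u t (x u)) - (y t - S u t (y u))) +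
      ((x u - a') - (y u - b')) +
      ((S u t (x u) - x u - (S u t a' - a')) - (S u t (y u) - y u - (S u t b' - b'))) +
      ((S u t a' - S s t (x s)) - (S u t b' - S s t (y s))) := by abel
  rw [hdecomp]
  have hn : ‖((x t - S u t (x u)) - (y t - S u t (y u))) +
      ((x u - a') - (y u - b')) +
      ((S u t (x u) - x u - (S u t a' - a')) - (S u t (y u) - y u - (S u t b' - b'))) +
      ((S u t a' - S s t (x s)) - (S u t b' - S s t (y s)))‖ ≤ _ := norm_add₄_le
  have hab' : ‖a' - b'‖ ≤ (1 + K) * D :=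
    hab.trans (by gcongr)
  have hrab : ‖y u - b'‖ * ‖a' - b'‖ ≤ C * (t - s) ^ (3 * α) * ((1 + K) * D) := by
    have : ‖y u - b'‖ ≤ C * (t - s) ^ (3 * α) := hr.trans (by gcongr)
    gcongr
  have he0 : 0 ≤ e := hKt0.trans hKte
  have hf2 : K * (t - u) ^ α * (‖x u - a' - (y u - b')‖ + ‖y u - b'‖ * ‖a' - b'‖) ≤
      e * (M * D * (u - s) ^ (3 * α)) + K * (C * (t - s) ^ (3 * α) * ((1 + K) * D)) := by
    rw [mul_add]
    gcongr
  have hd2 : ‖(S u t a' - S s t (x s)) - (S u t b' - S s t (y s))‖ ≤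
      K * (t - s) ^ (3 * α) * D :=
    hdef.trans (by
      have : 0 ≤ K * (t - s) ^ (3 * α) := mul_nonneg hK (hus0.trans hus)
      gcongr)
  have hMD : 0 ≤ M * D := by positivity
  have := mul_le_mul_of_nonneg_left hsplit hMD
  nlinarith [hn, hf2, hd2, hRsu, hRut, hfour]

/-- Paths that follow an almost flow up to order `3 * α` are locally determined by their starting
point. -/
lemma unique (hS : IsAlmostFlow α K a b S) (hα : 1 / 3 < α) (hK : 0 ≤ K) {x y : ℝ → X} {C : ℝ}
    (hx : ∀ s t, a ≤ s → s ≤ t → t ≤ b → ‖x t - S s t (x s)‖ ≤ C * (t - s) ^ (3 * α))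
    (hy : ∀ s t, a ≤ s → s ≤ t → t ≤ b → ‖y t - S s t (y s)‖ ≤ C * (t - s) ^ (3 * α))
    (h0 : x a = y a) : ∃ h > 0, ∀ t, a ≤ t → t ≤ b → t ≤ a + h → x t = y t := by
  wlog hC : 0 ≤ C generalizing C
  · refine this (C := |C|) (fun s t h1 h2 h3 => (hx s t h1 h2 h3).trans ?_)
      (fun s t h1 h2 h3 => (hy s t h1 h2 h3).trans ?_) (abs_nonneg C)
    all_goals
      have : 0 ≤ (t - s) ^ (3 * α) := Real.rpow_nonneg (by linarith) _
      gcongr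
      exact le_abs_self C
  set κ : ℝ := (2 / 3) ^ (3 * α - 1) with hκ
  have hκ1 : κ < 1 := two_thirds_rpow_lt_one (by linarith)
  have hκ0 : 0 ≤ κ := by positivity
  -- The constants are tuned so that `κ * (1 + e) * M + C₁ ≤ ρ * M`: since `ρ = κ + 2 * e`, one `e *
  -- M` absorbs `κ * e * M` and the other absorbs `C₁`. The summand `1` in `M * e` gives `M ≥ 1`,
  -- used to start the iteration.
  set e : ℝ := (1 - κ) / 4 with hedef
  have he0 : 0 < e := by simp only [hedef]; linarith
  set C₁ := K * (C * (1 + K) + 1)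
  have hC₁ : 0 ≤ C₁ := by positivity
  set M : ℝ := (C₁ + 2 * C + 1) / e with hMdef
  have hM : 0 < M := by positivity
  have hMe : M * e = C₁ + 2 * C + 1 := by rw [hMdef]; field_simp
  set ρ : ℝ := (1 + κ) / 2 with hρ
  have hρ0 : 0 < ρ := by positivity
  have hρ1 : ρ < 1 := by linarith
  obtain ⟨h₁, hh₁, hh₁1, hh₁e⟩ := exists_pos_rpow_le (β := α) (ε := e / (K + 1)) (by linarith)
    (by positivity)
  obtain ⟨h₂, hh₂, -, hh₂e⟩ := exists_pos_rpow_le (β := 3 * α) (ε := ρ / M) (by linarith)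
    (by positivity)
  set h := min h₁ h₂ with hhdef
  have hh : 0 < h := lt_min hh₁ hh₂
  have hh1 : h ≤ 1 := (min_le_left _ _).trans hh₁1
  have he : ∀ r, 0 ≤ r → r ≤ h → K * r ^ α ≤ e := by
    intro r hr hrh
    calc K * r ^ α ≤ (K + 1) * (e / (K + 1)) := by
          gcongr
          · linarith
          · exact hh₁e r hr (hrh.trans (min_le_left _ _))
      _ = e := by field_simp
  -- Each pass improves `D` to `ρ * D`. The remainders improve by `unique_step`. The paths improve
  -- because they start together, so their distance at `t` is a difference of remainders over `[a,
  -- t]`, and `M * h ^ (3 * α) ≤ ρ`.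
  set B : ℝ → ℝ → ℝ → Prop := fun D s t => ‖x t - y t‖ ≤ D ∧
      ‖(x t - S s t (x s)) - (y t - S s t (y s))‖ ≤ M * D * (t - s) ^ (3 * α) with hB
  have hR : ∀ s t, a ≤ s → s ≤ t → t ≤ b →
      ‖(x t - S s t (x s)) - (y t - S s t (y s))‖ ≤ 2 * C * (t - s) ^ (3 * α) := by
    intro s t h1 h2 h3
    refine (norm_sub_le _ _).trans ?_
    linarith [hx s t h1 h2 h3, hy s t h1 h2 h3]
  have hΔ : ∀ t, ‖x t - y t‖ = ‖(x t - S a t (x a)) - (y t - S a t (y a))‖ := by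
    intro t
    rw [h0]
    congr 1
    abel
  set D₀ : ℝ := 2 * C + 1 with hD₀
  have hD₀0 : 0 < D₀ := by positivity
  have hM1 : 1 ≤ M := by nlinarith
  have hMD₀ : 2 * C ≤ M * D₀ := by nlinarith
  have base : ∀ s t, a ≤ s → s ≤ t → t ≤ b → t ≤ a + h → B D₀ s t := by
    intro s t h1 h2 h3 h4
    constructor
    · rw [hΔ]
      refine (hR a t le_rfl (by linarith) h3).trans ?_
      have : (t - a) ^ (3 * α) ≤ 1 :=
        Real.rpow_le_one (by linarith) (by linarith) (by linarith)
      nlinarith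
    · refine (hR s t h1 h2 h3).trans ?_
      have : 0 ≤ (t - s) ^ (3 * α) := Real.rpow_nonneg (by linarith) _
      gcongr
  have step : ∀ D, 0 ≤ D → (∀ s t, a ≤ s → s ≤ t → t ≤ b → t ≤ a + h → B D s t) →
      ∀ s t, a ≤ s → s ≤ t → t ≤ b → t ≤ a + h → B (ρ * D) s t := by
    intro D hD hQ s t h1 h2 h3 h4
    constructor
    · rw [hΔ]
      refine ((hQ a t le_rfl (by linarith) h3 h4).2).trans ?_
      have : (t - a) ^ (3 * α) ≤ ρ / M :=
        hh₂e _ (by linarith) (by linarith [min_le_right h₁ h₂])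
      calc M * D * (t - a) ^ (3 * α) ≤ M * D * (ρ / M) := by gcongr
        _ = ρ * D := by field_simp
    · refine (hS.unique_step hα hK hC hM.le hD hh1 hy he hQ h1 h2 h3 h4).trans ?_
      have : 0 ≤ (t - s) ^ (3 * α) := Real.rpow_nonneg (by linarith) _
      have hc : κ * (1 + e) * M + C₁ ≤ M * ρ := by
        have h5 : κ * (e * M) ≤ 1 * (e * M) := by gcongr
        have h6 : ρ = κ + 2 * e := by simp only [hρ, hedef]; ring
        rw [h6]
        nlinarith
      calc (κ * (1 + e) * M + C₁) * D * (t - s) ^ (3 * α) ≤ (M * ρ) * D * (t - s) ^ (3 * α) := by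
            gcongr
        _ = _ := by ring
  have all : ∀ n : ℕ, ∀ s t, a ≤ s → s ≤ t → t ≤ b → t ≤ a + h → B (ρ ^ n * D₀) s t := by
    intro n
    induction n with
    | zero => simpa using base
    | succ n ih =>
      rw [pow_succ', mul_assoc]
      exact step _ (by positivity) ih
  refine ⟨h, hh, fun t h1 h2 h3 => ?_⟩
  have hlim : Filter.Tendsto (fun n : ℕ => ρ ^ n * D₀) Filter.atTop (𝓝 (0 * D₀)) :=
    (tendsto_pow_atTop_nhds_zero_of_lt_one hρ0.le hρ1).mul_const _
  have := ge_of_tendsto' hlim fun n => (all n t t h1 le_rfl h2 h3).1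
  rw [zero_mul] at this
  exact sub_eq_zero.1 (norm_le_zero_iff.1 this)

end IsAlmostFlow

end AlmostFlow

/-! ### Existence of paths that follow an almost flow -/

section AlmostFlowExistence

variable {X : Type*} [NormedAddCommGroup X]

/-- The Euler scheme of an almost flow along the times `τ k`. -/
def eulerScheme (S : ℝ → ℝ → X → X) (τ : ℕ → ℝ) (y₀ : X) : ℕ → X
  | 0 => y₀
  | k + 1 => S (τ k) (τ (k + 1)) (eulerScheme S τ y₀ k)

namespace IsAlmostFlow

variable {α K a b : ℝ} {S : ℝ → ℝ → X → X}

/-- A discrete sewing estimate, independent of the step length. The `n` steps are cut at `n / 2`,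
both halves are estimated inductively, and one flow defect is paid. The gain of `rpow_split` beats
the Lipschitz factor `1 + K * (b - a) ^ α`, and `K / (1 - κ)` solves `K₁ = κ * K₁ + K`. -/
lemma eulerScheme_le (hS : IsAlmostFlow α K a b S) (hα : 1 / 3 < α) (hK : 0 ≤ K) {κ : ℝ}
    (hκ : κ < 1) (hsmall : (2 / 3) ^ (3 * α - 1) * (1 + K * (b - a) ^ α) ≤ κ) {l : ℝ} (hl : 0 ≤ l)
    (y₀ : X) (n i : ℕ) (hN : a + (i + n : ℕ) * l ≤ b) :
    ‖eulerScheme S (fun k => a + k * l) y₀ (i + n) -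
      S (a + i * l) (a + (i + n : ℕ) * l) (eulerScheme S (fun k => a + k * l) y₀ i)‖ ≤
      K / (1 - κ) * ((a + (i + n : ℕ) * l) - (a + i * l)) ^ (3 * α) := by
  set Y := eulerScheme S (fun k => a + k * l) y₀ with hY
  have hκ' : 0 < 1 - κ := by linarith
  set K₁ := K / (1 - κ) with hK₁
  have hK₁0 : 0 ≤ K₁ := by positivity
  have hK₁e : K₁ * (1 - κ) = K := by rw [hK₁]; field_simp
  have hmono : ∀ {i j : ℕ}, i ≤ j → a + i * l ≤ a + j * l := by
    intro i j hij
    have : (i : ℝ) ≤ j := by exact_mod_cast hij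
    gcongr
  have hage : ∀ i : ℕ, a ≤ a + i * l := fun i => by
    have : 0 ≤ (i : ℝ) * l := by positivity
    linarith
  induction n using Nat.strong_induction_on generalizing i with
  | _ n ih =>
    have hR0 : 0 ≤ K₁ * ((a + (i + n : ℕ) * l) - (a + i * l)) ^ (3 * α) :=
      mul_nonneg hK₁0 (Real.rpow_nonneg (by linarith [hmono (Nat.le_add_right i n)]) _)
    obtain hn | hn | hn : n = 0 ∨ n = 1 ∨ 2 ≤ n := by omega
    · subst hn
      rw [add_zero] at *
      rw [hS.self_apply hα (hage i) hN, sub_self, norm_zero]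
      exact hR0
    · subst hn
      have : Y (i + 1) = S (a + i * l) (a + (i + 1 : ℕ) * l) (Y i) := rfl
      rw [this, sub_self, norm_zero]
      exact hR0
    · set m := n / 2 with hm
      have hmn : m < n := by omega
      have e1 := ih m hmn i ((hmono (by omega)).trans hN)
      have e2 := ih (n - m) (by omega) (i + m) (by
        rw [show i + m + (n - m) = i + n by omega]; exact hN)
      rw [show i + m + (n - m) = i + n by omega] at e2
      have him := hmono (Nat.le_add_right i m)
      have hmn' := hmono (show i + m ≤ i + n by omega)
      have hc := hS.concat_le (hage i) him hmn' hN (Y i) (Y (i + m)) (Y (i + n))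
      have hc0 : 0 ≤ K * ((a + (i + n : ℕ) * l) - (a + (i + m : ℕ) * l)) ^ α :=
        mul_nonneg hK (Real.rpow_nonneg (by linarith) _)
      -- The extreme case of unequal halves is `n = 3`, cut into `1` and `2`.
      have h3m : (m : ℝ) ≤ 2 / 3 * n := by
        have : 3 * m ≤ 2 * n := by omega
        have : 3 * (m : ℝ) ≤ 2 * n := by exact_mod_cast this
        linarith
      have h3m' : (n : ℝ) - m ≤ 2 / 3 * n := by
        have : n ≤ 3 * m := by omega
        have : (n : ℝ) ≤ 3 * m := by exact_mod_cast this
        linarith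
      have hsplit := rpow_split (θ := 3 * α) (s := a + i * l) (u := a + (i + m : ℕ) * l)
        (t := a + (i + n : ℕ) * l) (by linarith) hc0 him hmn'
        (by push_cast; nlinarith) (by push_cast; nlinarith)
      set P := ((a + (i + n : ℕ) * l) - (a + i * l)) ^ (3 * α) with hP
      have hP0 : 0 ≤ P := Real.rpow_nonneg (by linarith) _
      have hsm : (2 / 3) ^ (3 * α - 1) *
          (1 + K * ((a + (i + n : ℕ) * l) - (a + (i + m : ℕ) * l)) ^ α) * P ≤ κ * P := by
        refine mul_le_mul_of_nonneg_right (le_trans ?_ hsmall) hP0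
        have := hage (i + m)
        gcongr
      have h5 := mul_le_mul_of_nonneg_left (hsplit.trans hsm) hK₁0
      have h6 := mul_le_mul_of_nonneg_left e1 (by linarith : 0 ≤ 1 +
        K * ((a + (i + n : ℕ) * l) - (a + (i + m : ℕ) * l)) ^ α)
      calc _ ≤ _ := hc
        _ ≤ K₁ * (κ * P) + K * P := by nlinarith
        _ = K₁ * P := by rw [← hK₁e]; ring

/-- Existence of a path that follows an almost flow up to order `3 * α`. -/
lemma exists_path [ProperSpace X] (hS : IsAlmostFlow α K a b S) (hα : 1 / 3 < α) (hK : 0 ≤ K)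
    {κ : ℝ} (hκ : κ < 1) (hab : a < b)
    (hsmall : (2 / 3) ^ (3 * α - 1) * (1 + K * (b - a) ^ α) ≤ κ)
    (hcont : ContinuousOn (fun q : (ℝ × ℝ) × X => S q.1.1 q.1.2 q.2)
      {q | a ≤ q.1.1 ∧ q.1.1 ≤ q.1.2 ∧ q.1.2 ≤ b}) (y₀ : X) :
    ∃ y : ℝ → X, y a = y₀ ∧ ∀ s t, a ≤ s → s ≤ t → t ≤ b →
      ‖y t - S s t (y s)‖ ≤ K / (1 - κ) * (t - s) ^ (3 * α) := by
  have hba : 0 < b - a := by linarith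
  set K₁ := K / (1 - κ) with hK₁
  have hK₁0 : 0 ≤ K₁ := div_nonneg hK (by linarith)
  set l : ℕ → ℝ := fun N => (b - a) / (N + 1) with hl
  have hl0 : ∀ N, 0 < l N := fun N => by positivity
  set ix : ℕ → ℝ → ℕ := fun N t => ⌊(t - a) / l N⌋₊ with hix
  set τ : ℕ → ℝ → ℝ := fun N t => a + ix N t * l N with hτ
  set Y : ℕ → ℝ → X := fun N t => eulerScheme S (fun k => a + k * l N) y₀ (ix N t) with hY
  have hτle : ∀ N t, a ≤ t → τ N t ≤ t := by
    intro N t ht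
    have := Nat.floor_le (div_nonneg (sub_nonneg.2 ht) (hl0 N).le)
    rw [le_div_iff₀ (hl0 N)] at this
    simp only [hτ, hix]; linarith
  have hτge : ∀ N t, t - l N ≤ τ N t := by
    intro N t
    have := (Nat.lt_floor_add_one ((t - a) / l N)).le
    rw [div_le_iff₀ (hl0 N)] at this
    simp only [hτ, hix]; linarith
  have hτa : ∀ N t, a ≤ τ N t := fun N t => by
    have : 0 ≤ (ix N t : ℝ) * l N := mul_nonneg (Nat.cast_nonneg _) (hl0 N).le
    simp only [hτ]; linarith
  have hixmono : ∀ N {s t : ℝ}, s ≤ t → ix N s ≤ ix N t := by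
    intro N s t hst
    have := hl0 N
    exact Nat.floor_mono (by gcongr)
  have hest : ∀ N s t, a ≤ s → s ≤ t → t ≤ b → ‖Y N t - S (τ N s) (τ N t) (Y N s)‖ ≤
      K₁ * (τ N t - τ N s) ^ (3 * α) := by
    intro N s t h1 h2 h3
    obtain ⟨n, hn⟩ := Nat.exists_eq_add_of_le (hixmono N h2)
    have := hS.eulerScheme_le hα hK hκ hsmall (hl0 N).le y₀ n (ix N s) (by
      rw [← hn]; exact (hτle N t (h1.trans h2)).trans h3)
    rw [← hn] at this
    exact this
  have hix0 : ∀ N, ix N a = 0 := fun N => by simp [hix]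
  have hY0 : ∀ N, Y N a = y₀ := fun N => by simp only [hY, hix0]; rfl
  have hτ0 : ∀ N, τ N a = a := fun N => by simp [hτ, hix0]
  set R := K₁ * (b - a) ^ (3 * α) + K * (b - a) ^ α with hR
  have hbd : ∀ t, a ≤ t → t ≤ b → ∀ N, Y N t ∈ Metric.closedBall y₀ R := by
    intro t h1 h2 N
    have e1 := hest N a t le_rfl h1 h2
    rw [hY0, hτ0] at e1
    have e2 := (hS.incr a (τ N t) le_rfl (hτa N t) ((hτle N t h1).trans h2)).norm_le y₀
    have h3 : 0 ≤ τ N t - a := by linarith [hτa N t]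
    have h4 : τ N t - a ≤ b - a := by linarith [hτle N t h1]
    have e3 : K₁ * (τ N t - a) ^ (3 * α) ≤ K₁ * (b - a) ^ (3 * α) := by gcongr
    have e4 : K * (τ N t - a) ^ α ≤ K * (b - a) ^ α := by gcongr
    rw [Metric.mem_closedBall, dist_eq_norm]
    calc ‖Y N t - y₀‖ = ‖(Y N t - S a (τ N t) y₀) + (S a (τ N t) y₀ - y₀)‖ := by congr 1; abel
      _ ≤ R := (norm_add_le _ _).trans (by linarith)
  -- A nonprincipal ultrafilter yields limits of the bounded values `Y N t` for all `t`
  -- simultaneously, without equicontinuity or a diagonal sequence.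
  set U : Ultrafilter ℕ := Filter.hyperfilter ℕ with hU
  have hUle : (U : Filter ℕ) ≤ Filter.atTop := Nat.hyperfilter_le_atTop
  have hex : ∀ t, ∃ x : X, a ≤ t → t ≤ b → Filter.Tendsto (fun N => Y N t) U (𝓝 x) := by
    intro t
    by_cases ht : a ≤ t ∧ t ≤ b
    · obtain ⟨x, -, hx⟩ := (isCompact_closedBall y₀ R).ultrafilter_le_nhds
        (U.map (fun N => Y N t)) (by
          rw [Filter.le_principal_iff]
          exact Filter.mem_map.2 (Filter.Eventually.of_forall (hbd t ht.1 ht.2)))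
      exact ⟨x, fun _ _ => hx⟩
    · exact ⟨y₀, fun h1 h2 => absurd ⟨h1, h2⟩ ht⟩
  choose y hy using hex
  have hlto : Filter.Tendsto l Filter.atTop (𝓝 0) :=
    tendsto_const_nhds.div_atTop (tendsto_natCast_atTop_atTop.atTop_add tendsto_const_nhds)
  have hτto : ∀ t, a ≤ t → Filter.Tendsto (fun N => τ N t) U (𝓝 t) := by
    intro t ht
    refine Filter.Tendsto.mono_left ?_ hUle
    refine tendsto_of_tendsto_of_tendsto_of_le_of_le (g := fun N => t - l N) (h := fun _ => t)
      ?_ tendsto_const_nhds (fun N => hτge N t) (fun N => hτle N t ht)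
    simpa using hlto.const_sub t
  refine ⟨y, ?_, fun s t h1 h2 h3 => ?_⟩
  · refine tendsto_nhds_unique (hy a le_rfl hab.le) ?_
    simp only [hY0]
    exact tendsto_const_nhds
  · have hs := hy s h1 (h2.trans h3)
    have ht := hy t (h1.trans h2) h3
    have hS' : Filter.Tendsto (fun N => S (τ N s) (τ N t) (Y N s)) U (𝓝 (S s t (y s))) := by
      have hc := hcont ((s, t), y s) ⟨h1, h2, h3⟩
      refine hc.tendsto.comp (f := fun N => ((τ N s, τ N t), Y N s))
        (tendsto_nhdsWithin_iff.2 ⟨?_, ?_⟩)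
      · exact ((hτto s h1).prodMk_nhds (hτto t (h1.trans h2))).prodMk_nhds hs
      · refine Filter.Eventually.of_forall fun N => ⟨hτa N s, ?_, ?_⟩
        · have := hixmono N h2
          have h5 : (ix N s : ℝ) ≤ ix N t := by exact_mod_cast this
          have := hl0 N
          simp only [hτ]; gcongr
        · exact (hτle N t (h1.trans h2)).trans h3
    refine le_of_tendsto_of_tendsto (ht.sub hS').norm
      (Filter.Tendsto.const_mul K₁ ?_) (Filter.Eventually.of_forall fun N => hest N s t h1 h2 h3)
    exact ((hτto t (h1.trans h2)).sub (hτto s h1)).rpow_const (Or.inr (by linarith))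

end IsAlmostFlow

end AlmostFlowExistence

/-! ### Bounded Lipschitz maps and Taylor remainders in Lipschitz norm -/

section BddLip

namespace BddLip

variable {X Y : Type*} [NormedAddCommGroup X] [NormedAddCommGroup Y]

lemma nonneg {c : ℝ} {f : X → Y} (hf : BddLip c f) : 0 ≤ c :=
  (norm_nonneg _).trans (hf.norm_le 0)

lemma mono {c c' : ℝ} {f : X → Y} (hf : BddLip c f) (h : c ≤ c') : BddLip c' f :=
  ⟨fun x => (hf.norm_le x).trans h, fun x y => (hf.lip x y).trans (by gcongr)⟩

lemma add {c c' : ℝ} {f g : X → Y} (hf : BddLip c f) (hg : BddLip c' g) :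
    BddLip (c + c') (fun x => f x + g x) := by
  refine ⟨fun x => (norm_add_le _ _).trans (add_le_add (hf.norm_le x) (hg.norm_le x)),
    fun x y => ?_⟩
  calc ‖f x + g x - (f y + g y)‖ = ‖(f x - f y) + (g x - g y)‖ := by congr 1; abel
    _ ≤ _ := (norm_add_le _ _).trans (by linarith [hf.lip x y, hg.lip x y])

lemma sum {ι : Type*} [Fintype ι] {c : ℝ} {f : ι → X → Y} (hf : ∀ i, BddLip c (f i)) :
    BddLip (Fintype.card ι * c) (fun x => ∑ i, f i x) := by
  refine ⟨fun x => ?_, fun x y => ?_⟩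
  · refine (norm_sum_le _ _).trans ((Finset.sum_le_sum fun i _ => (hf i).norm_le x).trans ?_)
    simp
  · rw [← Finset.sum_sub_distrib]
    refine (norm_sum_le _ _).trans ((Finset.sum_le_sum fun i _ => (hf i).lip x y).trans ?_)
    simp [mul_assoc]

lemma zero {c : ℝ} (hc : 0 ≤ c) : BddLip c (fun _ : X => (0 : Y)) :=
  ⟨fun _ => by simpa using hc, fun x y => by simpa using mul_nonneg hc (norm_nonneg _)⟩

lemma smul {c m a : ℝ} [NormedSpace ℝ Y] (ha : |a| ≤ m) {f : X → Y} (hf : BddLip c f) :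
    BddLip (m * c) (fun x => a • f x) := by
  have hc := hf.nonneg
  have hm := (abs_nonneg a).trans ha
  refine ⟨fun x => ?_, fun x y => ?_⟩
  · rw [norm_smul, Real.norm_eq_abs]
    exact mul_le_mul ha (hf.norm_le x) (norm_nonneg _) hm
  · rw [← smul_sub, norm_smul, Real.norm_eq_abs, mul_assoc]
    exact mul_le_mul ha (hf.lip x y) (norm_nonneg _) hm

end BddLip

variable {X Y Y' Y'' : Type*} [NormedAddCommGroup X] [NormedAddCommGroup Y]
  [NormedSpace ℝ Y] [NormedAddCommGroup Y'] [NormedSpace ℝ Y'] [NormedAddCommGroup Y'']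
  [NormedSpace ℝ Y'']

namespace BddLip

lemma bilinear (B : Y →L[ℝ] Y' →L[ℝ] Y'') (hB : ∀ u w, ‖B u w‖ ≤ ‖u‖ * ‖w‖) {c c' : ℝ}
    {f : X → Y} {g : X → Y'} (hf : BddLip c f) (hg : BddLip c' g) :
    BddLip (2 * c * c') (fun x => B (f x) (g x)) := by
  have hc := hf.nonneg
  have hc' := hg.nonneg
  refine ⟨fun x => ?_, fun x y => ?_⟩
  · refine (hB _ _).trans ((mul_le_mul (hf.norm_le x) (hg.norm_le x) (norm_nonneg _) hc).trans ?_)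
    nlinarith [mul_nonneg hc hc']
  · have h1 : B (f x) (g x) - B (f y) (g y) = B (f x - f y) (g x) + B (f y) (g x - g y) := by
      simp
    rw [h1]
    refine (norm_add_le _ _).trans ((add_le_add (hB _ _) (hB _ _)).trans ?_)
    have h2 := mul_le_mul (hf.lip x y) (hg.norm_le x) (norm_nonneg _) (by positivity)
    have h3 := mul_le_mul (hf.norm_le y) (hg.lip x y) (norm_nonneg _) hc
    linarith

lemma clm_apply {c c' : ℝ} {f : X → Y →L[ℝ] Y'} {g : X → Y} (hf : BddLip c f) (hg : BddLip c' g) :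
    BddLip (2 * c * c') (fun x => f x (g x)) :=
  bilinear (ContinuousLinearMap.id ℝ (Y →L[ℝ] Y')) (fun u w => u.le_opNorm w) hf hg

end BddLip

variable [NormedSpace ℝ X]

lemma norm_sub_le_of_fderiv {f : X → Y} (hf : Differentiable ℝ f) {C : ℝ}
    (hC : ∀ x, ‖fderiv ℝ f x‖ ≤ C) (x y : X) : ‖f x - f y‖ ≤ C * ‖x - y‖ :=
  convex_univ.norm_image_sub_le_of_norm_fderiv_le (fun z _ => hf z) (fun z _ => hC z)
    (mem_univ y) (mem_univ x)

/-- Replacing `r` by `r'` costs `L * ‖r - r'‖`. Then `z ↦ f (z + r') - f z` has derivative at most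
`L * ‖r'‖`, because `Df` is Lipschitz. -/
lemma norm_four_point_le {f : X → Y} (hf : Differentiable ℝ f) {L : ℝ}
    (hL : BddLip L (fderiv ℝ f)) (x r y r' : X) :
    ‖(f (x + r) - f x) - (f (y + r') - f y)‖ ≤ L * (‖r - r'‖ + ‖r'‖ * ‖x - y‖) := by
  have h1 : ‖f (x + r) - f (x + r')‖ ≤ L * ‖r - r'‖ := by
    simpa using norm_sub_le_of_fderiv hf hL.norm_le (x + r) (x + r')
  have hd : ∀ z, HasFDerivAt (fun z => f (z + r') - f z)
      (fderiv ℝ f (z + r') - fderiv ℝ f z) z := fun z =>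
    ((hasFDerivAt_comp_add_right _).2 (hf (z + r')).hasFDerivAt).sub (hf z).hasFDerivAt
  have h2 := norm_sub_le_of_fderiv (f := fun z => f (z + r') - f z) (C := L * ‖r'‖)
    (fun z => (hd z).differentiableAt) (fun z => by
      rw [(hd z).fderiv]; simpa using hL.lip (z + r') z) x y
  calc _ = ‖(f (x + r) - f (x + r')) + ((f (x + r') - f x) - (f (y + r') - f y))‖ := by
        congr 1; abel
    _ ≤ _ := (norm_add_le _ _).trans (by linarith)

lemma BddLip.shift {f : X → Y} (hf : Differentiable ℝ f) {L c : ℝ}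
    (hL : BddLip L (fderiv ℝ f)) {δ : X → X} (hδ : BddLip c δ) :
    BddLip (2 * L * c) (fun y => f (y + δ y) - f y) := by
  have hL0 := hL.nonneg
  have hc := hδ.nonneg
  refine ⟨fun y => ?_, fun x y => ?_⟩
  · have := norm_sub_le_of_fderiv hf hL.norm_le (y + δ y) y
    rw [add_sub_cancel_left] at this
    refine this.trans ?_
    nlinarith [hδ.norm_le y, mul_nonneg hL0 hc, mul_le_mul_of_nonneg_left (hδ.norm_le y) hL0]
  · refine (norm_four_point_le hf hL x (δ x) y (δ y)).trans ?_
    calc _ ≤ L * (c * ‖x - y‖ + c * ‖x - y‖) := by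
          gcongr
          · exact hδ.lip x y
          · exact hδ.norm_le y
      _ = _ := by ring

lemma norm_taylor_one_le {f : X → Y} (hf : Differentiable ℝ f) {L : ℝ}
    (hL : BddLip L (fderiv ℝ f)) (y : X) {ρ : ℝ} {r r' : X} (hr : ‖r‖ ≤ ρ) (hr' : ‖r'‖ ≤ ρ) :
    ‖f (y + r) - f (y + r') - fderiv ℝ f y (r - r')‖ ≤ L * ρ * ‖r - r'‖ := by
  have hd : ∀ z, HasFDerivAt (fun z => f (y + z) - fderiv ℝ f y z)
      (fderiv ℝ f (y + z) - fderiv ℝ f y) z := fun z =>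
    ((hasFDerivAt_comp_add_left _).2 (hf (y + z)).hasFDerivAt).sub (fderiv ℝ f y).hasFDerivAt
  have hL0 := hL.nonneg
  have := (convex_closedBall (0 : X) ρ).norm_image_sub_le_of_norm_fderiv_le
    (f := fun z => f (y + z) - fderiv ℝ f y z) (C := L * ρ) (𝕜 := ℝ)
    (fun z _ => (hd z).differentiableAt) (fun z hz => by
      rw [(hd z).fderiv]
      refine (hL.lip _ _).trans ?_
      rw [add_sub_cancel_left]
      gcongr
      simpa using hz) (x := r') (y := r) (by simpa using hr') (by simpa using hr)
  refine le_trans (le_of_eq ?_) this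
  congr 1
  simp only [map_sub]
  abel

lemma norm_taylor_one_le' {f : X → Y} (hf : Differentiable ℝ f) {L : ℝ}
    (hL : BddLip L (fderiv ℝ f)) (y r : X) :
    ‖f (y + r) - f y - fderiv ℝ f y r‖ ≤ L * ‖r‖ ^ 2 := by
  have := norm_taylor_one_le hf hL y (le_refl ‖r‖) (r' := 0) (by simp)
  simp only [add_zero, sub_zero] at this
  refine this.trans (le_of_eq (by ring))

/-- The remainder is quadratic in `δ` also in Lipschitz norm. The variation of `δ` at a fixed base
point is a first order expansion of `f`. At a fixed shift, the derivative in the base point is, by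
symmetry of `D²f`, the first order remainder of `Df`, which needs `D²f` to be Lipschitz. -/
lemma BddLip.shift_sub_fderiv {f : X → Y} (hf : Differentiable ℝ f)
    (hf' : Differentiable ℝ (fderiv ℝ f)) {L c : ℝ} (hL : BddLip L (fderiv ℝ f))
    (hL' : BddLip L (fderiv ℝ (fderiv ℝ f))) {δ : X → X} (hδ : BddLip c δ) :
    BddLip (2 * L * c ^ 2) (fun y => f (y + δ y) - f y - fderiv ℝ f y (δ y)) := by
  have hL0 := hL.nonneg
  have hc := hδ.nonneg
  refine ⟨fun y => ?_, fun x y => ?_⟩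
  · refine (norm_taylor_one_le' hf hL y (δ y)).trans ?_
    have : ‖δ y‖ ^ 2 ≤ c ^ 2 := by gcongr; exact hδ.norm_le y
    nlinarith [mul_le_mul_of_nonneg_left this hL0, mul_nonneg hL0 (sq_nonneg c)]
  · have h1 := norm_taylor_one_le hf hL x (hδ.norm_le x) (hδ.norm_le y)
    have hd : ∀ z, HasFDerivAt (fun z => f (z + δ y) - f z - fderiv ℝ f z (δ y))
        (fderiv ℝ f (z + δ y) - fderiv ℝ f z - fderiv ℝ (fderiv ℝ f) z (δ y)) z := by
      intro z
      have h := (((hasFDerivAt_comp_add_right _).2 (hf (z + δ y)).hasFDerivAt).sub (hf z).hasFDerivAt).sub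
        ((hf' z).hasFDerivAt.clm_apply (hasFDerivAt_const (δ y) z))
      refine h.congr_fderiv ?_
      ext w
      have : fderiv ℝ (fderiv ℝ f) z w (δ y) = fderiv ℝ (fderiv ℝ f) z (δ y) w := by
        refine second_derivative_symmetric (f := f) (f' := fderiv ℝ f)
          (fun u => (hf u).hasFDerivAt) (hf' z).hasFDerivAt w (δ y)
      simp [this]
    have h2 := norm_sub_le_of_fderiv (f := fun z => f (z + δ y) - f z - fderiv ℝ f z (δ y))
      (C := L * c ^ 2) (fun z => (hd z).differentiableAt) (fun z => by
        rw [(hd z).fderiv]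
        refine (norm_taylor_one_le' hf' hL' z (δ y)).trans ?_
        gcongr
        exact hδ.norm_le y) x y
    have h3 : L * c * ‖δ x - δ y‖ ≤ L * c * (c * ‖x - y‖) := by gcongr; exact hδ.lip x y
    calc _ = ‖(f (x + δ x) - f (x + δ y) - fderiv ℝ f x (δ x - δ y)) +
          ((f (x + δ y) - f x - fderiv ℝ f x (δ y)) -
            (f (y + δ y) - f y - fderiv ℝ f y (δ y)))‖ := by
          congr 1; simp only [map_sub]; abel
      _ ≤ _ := (norm_add_le _ _).trans (by nlinarith)

/-- By symmetry of `D²f`, the derivative of the remainder in the increment is the first order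
remainder of `Df`, already known to be quadratic. The constant is not optimized. -/
lemma norm_taylor_two_le {f : X → Y} (hf : Differentiable ℝ f)
    (hf' : Differentiable ℝ (fderiv ℝ f)) {L : ℝ}
    (hL' : BddLip L (fderiv ℝ (fderiv ℝ f))) (y r : X) :
    ‖f (y + r) - f y - fderiv ℝ f y r - (1 / 2 : ℝ) • fderiv ℝ (fderiv ℝ f) y r r‖ ≤
      L * ‖r‖ ^ 3 := by
  have hsymm : ∀ u w, fderiv ℝ (fderiv ℝ f) y u w = fderiv ℝ (fderiv ℝ f) y w u := fun u w =>
    second_derivative_symmetric (f := f) (f' := fderiv ℝ f)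
      (fun u => (hf u).hasFDerivAt) (hf' y).hasFDerivAt u w
  have hd : ∀ z, HasFDerivAt (fun z => f (y + z) - f y - fderiv ℝ f y z -
        (1 / 2 : ℝ) • fderiv ℝ (fderiv ℝ f) y z z)
      (fderiv ℝ f (y + z) - fderiv ℝ f y - fderiv ℝ (fderiv ℝ f) y z) z := by
    intro z
    have h := ((((hasFDerivAt_comp_add_left _).2 (hf (y + z)).hasFDerivAt).sub_const (f y)).sub
      (fderiv ℝ f y).hasFDerivAt).sub ((((fderiv ℝ (fderiv ℝ f) y).hasFDerivAt (x := z)).clm_apply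
        (hasFDerivAt_id z)).const_smul (1 / 2 : ℝ))
    refine h.congr_fderiv ?_
    ext w
    have := hsymm w z
    simp only [sub_apply, smul_apply,
      add_apply, ContinuousLinearMap.comp_apply,
      ContinuousLinearMap.flip_apply, id_eq, ContinuousLinearMap.id_apply, this]
    rw [← two_smul ℝ, smul_smul]
    norm_num
  have hL0 := hL'.nonneg
  have := (convex_closedBall (0 : X) ‖r‖).norm_image_sub_le_of_norm_fderiv_le
    (f := fun z => f (y + z) - f y - fderiv ℝ f y z -
        (1 / 2 : ℝ) • fderiv ℝ (fderiv ℝ f) y z z) (C := L * ‖r‖ ^ 2) (𝕜 := ℝ)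
    (fun z _ => (hd z).differentiableAt) (fun z hz => by
      rw [(hd z).fderiv]
      refine (norm_taylor_one_le' hf' hL' y z).trans ?_
      gcongr
      simpa using hz) (x := 0) (y := r) (by simp) (by simp)
  simp only [add_zero, sub_self, map_zero, smul_zero,
    sub_zero] at this
  exact this.trans (le_of_eq (by ring))

end BddLip

/-! ### The second order Euler step: size, flow defect and chain rule -/

section Euler

variable {X Y : Type*} [NormedAddCommGroup X] [NormedAddCommGroup Y]
  [NormedSpace ℝ Y] {d : ℕ}

/-- The combination of first order, second order and drift terms with the increments of the
driving signal. -/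
def driven (u : Fin d → X → Y) (a : Fin d → Fin d → X → Y) (u₀ : X → Y) (w : Fin d → ℝ)
    (ww : Fin d → Fin d → ℝ) (τ : ℝ) : X → Y :=
  fun y => (∑ i, w i • u i y) + (∑ j, ∑ k, ww j k • a j k y) + τ • u₀ y

/-- The number of terms of `driven`. -/
def termCount (d : ℕ) : ℝ := d + d * d + 1

lemma termCount_nonneg (d : ℕ) : 0 ≤ termCount d := by unfold termCount; positivity

lemma BddLip.driven {u : Fin d → X → Y} {a : Fin d → Fin d → X → Y} {u₀ : X → Y} {w : Fin d → ℝ}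
    {ww : Fin d → Fin d → ℝ} {τ m L : ℝ} (hu : ∀ i, BddLip L (u i)) (ha : ∀ j k, BddLip L (a j k))
    (hu₀ : BddLip L u₀) (hw : ∀ i, |w i| ≤ m) (hww : ∀ j k, |ww j k| ≤ m) (hτ : |τ| ≤ m) :
    BddLip (termCount d * (m * L)) (driven u a u₀ w ww τ) := by
  refine (((BddLip.sum fun i => (hu i).smul (hw i)).add
    (BddLip.sum fun j => BddLip.sum fun k => (ha j k).smul (hww j k))).add
      (hu₀.smul hτ)).mono (le_of_eq ?_)
  simp only [Fintype.card_fin, termCount]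
  ring

variable [NormedSpace ℝ X]

lemma hasFDerivAt_driven {u : Fin d → X → Y} {a : Fin d → Fin d → X → Y} {u₀ : X → Y}
    (hu : ∀ i, Differentiable ℝ (u i)) (ha : ∀ j k, Differentiable ℝ (a j k))
    (hu₀ : Differentiable ℝ u₀) (w : Fin d → ℝ) (ww : Fin d → Fin d → ℝ) (τ : ℝ) (y : X) :
    HasFDerivAt (driven u a u₀ w ww τ)
      (driven (fun i => fderiv ℝ (u i)) (fun j k => fderiv ℝ (a j k)) (fderiv ℝ u₀) w ww τ y) y :=
  ((HasFDerivAt.fun_sum fun i _ => (hu i y).hasFDerivAt.const_smul (w i)).add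
    (HasFDerivAt.fun_sum fun j _ => HasFDerivAt.fun_sum fun k _ =>
      (ha j k y).hasFDerivAt.const_smul (ww j k))).add ((hu₀ y).hasFDerivAt.const_smul τ)

/-- The second order fields `(v_j v_k)(y) = Dv_k(y) v_j(y)`. -/
noncomputable def secondField (v : Fin d → X → X) (j k : Fin d) : X → X :=
  fun y => fderiv ℝ (v k) y (v j y)

/-- Vector fields with bounded derivatives; `L` bounds everything that the Euler scheme needs. -/
structure BddFields (L : ℝ) (v : Fin d → X → X) (v₀ : X → X) : Prop where
  diff : ∀ i, Differentiable ℝ (v i)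
  diff_fderiv : ∀ i, Differentiable ℝ (fderiv ℝ (v i))
  diff_zero : Differentiable ℝ v₀
  bdd : ∀ i, BddLip L (v i)
  bdd_fderiv : ∀ i, BddLip L (fderiv ℝ (v i))
  bdd_fderiv_fderiv : ∀ i, BddLip L (fderiv ℝ (fderiv ℝ (v i)))
  bdd_zero : BddLip L v₀
  bdd_zero_fderiv : BddLip L (fderiv ℝ v₀)

namespace BddFields

variable {L : ℝ} {v : Fin d → X → X} {v₀ : X → X}

lemma nonneg (h : BddFields L v v₀) : 0 ≤ L := h.bdd_zero.nonneg

lemma hasFDerivAt_secondField (h : BddFields L v v₀) (j k : Fin d) (y : X) :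
    HasFDerivAt (secondField v j k) ((fderiv ℝ (v k) y).comp (fderiv ℝ (v j) y) +
      (fderiv ℝ (fderiv ℝ (v k)) y).flip (v j y)) y :=
  (h.diff_fderiv k y).hasFDerivAt.clm_apply (h.diff j y).hasFDerivAt

lemma secondField_bdd (h : BddFields L v v₀) (j k : Fin d) :
    BddLip (L + 4 * L ^ 2) (secondField v j k) :=
  ((h.bdd_fderiv k).clm_apply (h.bdd j)).mono (by nlinarith [h.nonneg])

/-- The derivative involves `D²v_k`, so its Lipschitz bound uses the third order control of the
fields. Each of the two summands costs `2 * L ^ 2`; the extra `L` lets the same constant also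
dominate the fields themselves. -/
lemma secondField_fderiv_bdd (h : BddFields L v v₀) (j k : Fin d) :
    BddLip (L + 4 * L ^ 2) (fderiv ℝ (secondField v j k)) := by
  have h1 := BddLip.bilinear (ContinuousLinearMap.compL ℝ X X X)
    (fun u w => u.opNorm_comp_le w) (h.bdd_fderiv k) (h.bdd_fderiv j)
  have h2 := BddLip.bilinear
    ((ContinuousLinearMap.flipₗᵢ ℝ X X X).toContinuousLinearEquiv.toContinuousLinearMap)
    (fun u w => by
      refine (u.flip.le_opNorm w).trans ?_
      rw [ContinuousLinearMap.opNorm_flip]) (h.bdd_fderiv_fderiv k) (h.bdd j)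
  have h3 : fderiv ℝ (secondField v j k) = fun y => (fderiv ℝ (v k) y).comp (fderiv ℝ (v j) y) +
      (fderiv ℝ (fderiv ℝ (v k)) y).flip (v j y) :=
    funext fun y => (h.hasFDerivAt_secondField j k y).fderiv
  rw [h3]
  exact (h1.add h2).mono (by nlinarith [h.nonneg])

/-- The increment of one step of the Euler scheme. -/
noncomputable def _root_.FoliatedRDE.eulerIncr (v : Fin d → X → X) (v₀ : X → X) (w : Fin d → ℝ)
    (ww : Fin d → Fin d → ℝ) (τ : ℝ) : X → X :=
  driven v (secondField v) v₀ w ww τ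

lemma eulerIncr_bdd (h : BddFields L v v₀) {w : Fin d → ℝ} {ww : Fin d → Fin d → ℝ} {τ m : ℝ}
    (hw : ∀ i, |w i| ≤ m) (hww : ∀ j k, |ww j k| ≤ m) (hτ : |τ| ≤ m) :
    BddLip (termCount d * (m * (L + 4 * L ^ 2))) (eulerIncr v v₀ w ww τ) :=
  BddLip.driven (fun i => (h.bdd i).mono (by nlinarith [h.nonneg])) h.secondField_bdd
    (h.bdd_zero.mono (by nlinarith [h.nonneg])) hw hww hτ

lemma eulerIncr_four_point (h : BddFields L v v₀) {w : Fin d → ℝ} {ww : Fin d → Fin d → ℝ}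
    {τ m : ℝ} (hw : ∀ i, |w i| ≤ m) (hww : ∀ j k, |ww j k| ≤ m) (hτ : |τ| ≤ m) (x r y r' : X) :
    ‖(eulerIncr v v₀ w ww τ (x + r) - eulerIncr v v₀ w ww τ x) -
      (eulerIncr v v₀ w ww τ (y + r') - eulerIncr v v₀ w ww τ y)‖ ≤
      termCount d * (m * (L + 4 * L ^ 2)) * (‖r - r'‖ + ‖r'‖ * ‖x - y‖) := by
  have hd := hasFDerivAt_driven h.diff
    (fun j k y => (h.hasFDerivAt_secondField j k y).differentiableAt) h.diff_zero w ww τ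
  refine norm_four_point_le (fun y => (hd y).differentiableAt) ?_ x r y r'
  have : fderiv ℝ (driven v (secondField v) v₀ w ww τ) = _ := funext fun y => (hd y).fderiv
  rw [this]
  exact BddLip.driven (fun i => (h.bdd_fderiv i).mono (by nlinarith [h.nonneg]))
    h.secondField_fderiv_bdd (h.bdd_zero_fderiv.mono (by nlinarith [h.nonneg])) hw hww hτ

/-- The flow defect of the Euler scheme is of third order. -/
lemma eulerIncr_defect (h : BddFields L v v₀) {w w' : Fin d → ℝ} {ww ww' : Fin d → Fin d → ℝ}
    {τ τ' H η : ℝ} (hH : 0 ≤ H) (hη : 0 ≤ η) (hη1 : η ≤ 1) (hw : ∀ i, |w i| ≤ H * η)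
    (hww : ∀ j k, |ww j k| ≤ H * η ^ 2) (hτ : |τ| ≤ H * η ^ 2) (hw' : ∀ i, |w' i| ≤ H * η)
    (hww' : ∀ j k, |ww' j k| ≤ H * η ^ 2) (hτ' : |τ'| ≤ H * η ^ 2) :
    BddLip ((2 * d * H * (L + 4 * L ^ 2) * (termCount d * H * (L + 4 * L ^ 2)) ^ 2 +
      2 * d * H * (L + 4 * L ^ 2) * (termCount d * H * (L + 4 * L ^ 2)) +
      2 * termCount d * H * (L + 4 * L ^ 2) * (termCount d * H * (L + 4 * L ^ 2))) * η ^ 3)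
      (fun y => (y + eulerIncr v v₀ w ww τ y) +
        eulerIncr v v₀ w' ww' τ' (y + eulerIncr v v₀ w ww τ y) -
        (y + eulerIncr v v₀ (fun i => w i + w' i) (fun j k => ww j k + ww' j k + w j * w' k)
          (τ + τ') y)) := by
  set Λ := L + 4 * L ^ 2 with hΛ
  have hL := h.nonneg
  have hLΛ : L ≤ Λ := by nlinarith
  have hsq : H * η ^ 2 ≤ H * η := by
    have : η ^ 2 ≤ η := by nlinarith
    gcongr
  set K₁ := termCount d * H * Λ with hK₁
  have hδ : BddLip (K₁ * η) (eulerIncr v v₀ w ww τ) :=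
    (h.eulerIncr_bdd hw (fun j k => (hww j k).trans hsq) (hτ.trans hsq)).mono
      (le_of_eq (by rw [hK₁]; ring))
  set δ := eulerIncr v v₀ w ww τ with hδdef
  have ha := fun j k => (h.secondField_bdd j k)
  have hv₀ : BddLip Λ v₀ := h.bdd_zero.mono hLΛ
  have hΛ0 : 0 ≤ Λ := hL.trans hLΛ
  -- With `η` in the role of `(t - s) ^ α`, three errors of order `η ^ 3` remain: `T1`, first order
  -- signal times the quadratic Taylor remainder; `T2`, first order signal times `Dv_k` applied to
  -- the second order part of `δ`; `T3`, second order signal and drift times the change of the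
  -- fields under the shift by `δ`.
  have T1 := BddLip.sum fun k => (BddLip.shift_sub_fderiv (h.diff k) (h.diff_fderiv k)
    ((h.bdd_fderiv k).mono hLΛ) ((h.bdd_fderiv_fderiv k).mono hLΛ) hδ).smul (hw' k)
  have hrem : BddLip (termCount d * (H * η ^ 2 * Λ))
      (driven (fun _ _ => 0) (secondField v) v₀ 0 ww τ) :=
    BddLip.driven (fun i => BddLip.zero hΛ0) ha hv₀
      (fun i => by simpa using mul_nonneg hH (sq_nonneg η)) hww hτ
  have T2 := BddLip.sum fun k => (((h.bdd_fderiv k).mono hLΛ).clm_apply hrem).smul (hw' k)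
  have hK₁0 : 0 ≤ K₁ := by
    have := termCount_nonneg d
    positivity
  have T3 : BddLip (termCount d * (H * η ^ 2 * (2 * Λ * (K₁ * η))))
      (driven (fun _ _ => 0) (fun j k y => secondField v j k (y + δ y) - secondField v j k y)
        (fun y => v₀ (y + δ y) - v₀ y) 0 ww' τ') :=
    BddLip.driven (fun i => BddLip.zero (by positivity))
      (fun j k => BddLip.shift (fun y => (h.hasFDerivAt_secondField j k y).differentiableAt)
        (h.secondField_fderiv_bdd j k) hδ)
      (BddLip.shift h.diff_zero (h.bdd_zero_fderiv.mono hLΛ) hδ)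
      (fun i => by simpa using mul_nonneg hH (sq_nonneg η)) hww' hτ'
  have key := ((T1.add T2).add T3).mono (le_of_eq (show _ = (2 * d * H * Λ * K₁ ^ 2 +
      2 * d * H * Λ * K₁ + 2 * termCount d * H * Λ * K₁) * η ^ 3 by
    rw [Fintype.card_fin, hK₁]; ring))
  convert key using 2 with y
  have e1 : δ y = ∑ j, w j • v j y + driven (fun _ _ => 0) (secondField v) v₀ 0 ww τ y := by
    simp only [hδdef, eulerIncr, driven, Pi.zero_apply, zero_smul, Finset.sum_const_zero, zero_add]
    abel
  -- Applying `Dv_k` to the first order part of `δ` yields `w_j w'_k Dv_k v_j`, exactly the term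
  -- that Chen's relation adds to the second level.
  have e2 : ∑ k, w' k • (v k (y + δ y) - v k y - fderiv ℝ (v k) y (δ y)) +
      ∑ k, w' k • fderiv ℝ (v k) y (driven (fun _ _ => 0) (secondField v) v₀ 0 ww τ y) =
      ∑ k, w' k • v k (y + δ y) - ∑ k, w' k • v k y -
        ∑ j, ∑ k, (w j * w' k) • secondField v j k y := by
    rw [Finset.sum_comm (f := fun j k => (w j * w' k) • secondField v j k y),
      ← Finset.sum_add_distrib, ← Finset.sum_sub_distrib, ← Finset.sum_sub_distrib]
    refine Finset.sum_congr rfl fun k _ => ?_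
    have : fderiv ℝ (v k) y (δ y) = ∑ j, w j • secondField v j k y +
        fderiv ℝ (v k) y (driven (fun _ _ => 0) (secondField v) v₀ 0 ww τ y) := by
      rw [e1, map_add, map_sum]
      simp [secondField]
    rw [this, smul_sub, smul_sub, smul_add, Finset.smul_sum]
    simp only [smul_smul, mul_comm (w' k)]
    abel
  rw [e2]
  simp only [eulerIncr, driven, Pi.zero_apply, zero_smul, Finset.sum_const_zero, zero_add,
    add_smul, smul_sub, Finset.sum_add_distrib, Finset.sum_sub_distrib]
  have e3 : δ y = ∑ i, w i • v i y + ∑ j, ∑ k, ww j k • secondField v j k y + τ • v₀ y := rfl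
  nth_rewrite 1 [e3]
  abel

/-- Second order chain rule along an approximate Euler step of a weakly geometric signal. -/
lemma chain_rule (h : BddFields L v v₀) {F : X → ℝ} (hF : Differentiable ℝ F)
    (hF' : Differentiable ℝ (fderiv ℝ F)) (hF1 : BddLip L (fderiv ℝ F))
    (hF2 : BddLip L (fderiv ℝ (fderiv ℝ F))) {H C : ℝ} (hH : 0 ≤ H) (hC : 0 ≤ C) :
    ∃ C' : ℝ, ∀ (w : Fin d → ℝ) (ww : Fin d → Fin d → ℝ) (τ η : ℝ), 0 ≤ η → η ≤ 1 →
      (∀ i, |w i| ≤ H * η) → (∀ j k, |ww j k| ≤ H * η ^ 2) → |τ| ≤ H * η ^ 2 →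
      (∀ j k, ww j k + ww k j = w j * w k) → ∀ y y' : X,
      ‖y' - (y + eulerIncr v v₀ w ww τ y)‖ ≤ C * η ^ 3 →
      |F y' - F y - driven (fun i y => fderiv ℝ F y (v i y))
        (fun j k y => fderiv ℝ (fun y => fderiv ℝ F y (v k y)) y (v j y))
        (fun y => fderiv ℝ F y (v₀ y)) w ww τ y| ≤ C' * η ^ 3 := by
  set Λ := L + 4 * L ^ 2 with hΛ
  have hL := h.nonneg
  have hLΛ : L ≤ Λ := by nlinarith
  have hΛ0 : 0 ≤ Λ := hL.trans hLΛ
  set K₁ := termCount d * H * Λ with hK₁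
  have hK₁0 : 0 ≤ K₁ := by
    have := termCount_nonneg d
    positivity
  refine ⟨L * (K₁ + C) ^ 3 + L * C + L * ((K₁ + C) * (K₁ + C) + (K₁ + C) * (d * H * L)), ?_⟩
  intro w ww τ η hη hη1 hw hww hτ hsym y y' hyy'
  have hsq : H * η ^ 2 ≤ H * η := by
    have : η ^ 2 ≤ η := by nlinarith
    gcongr
  have hη3 : η ^ 3 ≤ η ^ 2 := by nlinarith [sq_nonneg η]
  have hη2 : η ^ 2 ≤ η := by nlinarith
  set δ := y' - y with hδ
  set I := eulerIncr v v₀ w ww τ y with hI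
  set β := ∑ i, w i • v i y with hβ
  set ε := y' - (y + I) with hε
  have hIn : ‖I‖ ≤ K₁ * η :=
    ((h.eulerIncr_bdd hw (fun j k => (hww j k).trans hsq) (hτ.trans hsq)).norm_le y).trans
      (le_of_eq (by rw [hK₁]; ring))
  have hδI : δ = I + ε := by rw [hδ, hε]; abel
  have hCη : C * η ^ 3 ≤ C * η := by gcongr; linarith
  have hδn : ‖δ‖ ≤ (K₁ + C) * η := by
    rw [hδI]
    refine (norm_add_le _ _).trans ?_
    linarith
  set R := driven (fun _ _ => 0) (secondField v) v₀ 0 ww τ y with hR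
  have hIβ : I = β + R := by
    simp only [hI, hβ, hR, eulerIncr, driven, Pi.zero_apply, zero_smul, Finset.sum_const_zero,
      zero_add]
    abel
  have hRn : ‖R‖ ≤ K₁ * η ^ 2 := by
    have := (BddLip.driven (u := fun (_ : Fin d) (_ : X) => (0 : X)) (w := 0)
      (fun i => BddLip.zero hΛ0) (fun j k => (h.secondField_bdd j k)) (h.bdd_zero.mono hLΛ)
      (fun i => by simpa using mul_nonneg hH (sq_nonneg η)) hww hτ).norm_le y
    exact this.trans (le_of_eq (by rw [hK₁]; ring))
  have hβn : ‖β‖ ≤ d * H * L * η := by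
    have := (BddLip.sum fun i => (h.bdd i).smul (hw i)).norm_le y
    exact this.trans (le_of_eq (by rw [Fintype.card_fin]; ring))
  -- The displacement is `β + γ` with `β` of order `η` and `γ` of order `η ^ 2`, so only `β` matters
  -- in the quadratic Taylor term.
  set γ := R + ε with hγ
  have hδβ : δ = β + γ := by rw [hδI, hIβ, hγ]; abel
  have hγn : ‖γ‖ ≤ (K₁ + C) * η ^ 2 := by
    refine (norm_add_le _ _).trans ?_
    have : C * η ^ 3 ≤ C * η ^ 2 := by gcongr
    linarith
  have hsymm : ∀ u w, fderiv ℝ (fderiv ℝ F) y u w = fderiv ℝ (fderiv ℝ F) y w u := fun u w =>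
    second_derivative_symmetric (f := F) (f' := fderiv ℝ F)
      (fun u => (hF u).hasFDerivAt) (hF' y).hasFDerivAt u w
  set Q := fderiv ℝ (fderiv ℝ F) y with hQ
  have hQn : ‖Q‖ ≤ L := hF2.norm_le y
  have hQb : ∀ u u', |Q u u'| ≤ L * (‖u‖ * ‖u'‖) := fun u u' => by
    rw [← Real.norm_eq_abs, ← mul_assoc]
    exact (Q.le_opNorm₂ u u').trans (by gcongr)
  -- The symmetric form `Q` only sees the symmetric part of the second level, which `hsym`
  -- identifies with half of `w ⊗ w`. Without weak geometricity a bracket term would appear here.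
  have hββ : Q β β = 2 * ∑ j, ∑ k, ww j k * Q (v j y) (v k y) := by
    have e1 : Q β β = ∑ j, ∑ k, (ww j k + ww k j) * Q (v j y) (v k y) := by
      simp only [hβ, map_sum, map_smul, sum_apply,
        smul_apply, smul_eq_mul, Finset.mul_sum, hsym]
      rw [Finset.sum_comm]
      exact Finset.sum_congr rfl fun j _ => Finset.sum_congr rfl fun k _ => by ring
    have e2 : ∑ j, ∑ k, ww k j * Q (v j y) (v k y) = ∑ j, ∑ k, ww j k * Q (v j y) (v k y) := by
      rw [Finset.sum_comm]
      exact Finset.sum_congr rfl fun j _ => Finset.sum_congr rfl fun k _ => by rw [hsymm]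
    rw [e1]
    simp only [add_mul, Finset.sum_add_distrib, e2]
    ring
  have hsecond : ∀ j k, fderiv ℝ (fun y => fderiv ℝ F y (v k y)) y (v j y) =
      Q (v j y) (v k y) + fderiv ℝ F y (secondField v j k y) := by
    intro j k
    rw [((hF' y).hasFDerivAt.clm_apply (h.diff k y).hasFDerivAt).fderiv]
    simp [secondField, hQ, add_comm]
  have hdr : driven (fun i y => fderiv ℝ F y (v i y))
        (fun j k y => fderiv ℝ (fun y => fderiv ℝ F y (v k y)) y (v j y))
        (fun y => fderiv ℝ F y (v₀ y)) w ww τ y = fderiv ℝ F y I + 1 / 2 * Q β β := by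
    have e1 : fderiv ℝ F y I = ∑ i, w i * fderiv ℝ F y (v i y) +
        ∑ j, ∑ k, ww j k * fderiv ℝ F y (secondField v j k y) + τ * fderiv ℝ F y (v₀ y) := by
      simp only [hI, eulerIncr, driven, map_add, map_sum, map_smul, smul_eq_mul]
    rw [e1, hββ]
    simp only [driven, hsecond, smul_eq_mul, mul_add, Finset.sum_add_distrib]
    ring
  have hT := norm_taylor_two_le hF hF' hF2 y δ
  have hyδ : y + δ = y' := by rw [hδ]; abel
  rw [hyδ, Real.norm_eq_abs, smul_eq_mul] at hT
  have hδ3 : L * ‖δ‖ ^ 3 ≤ L * ((K₁ + C) * η) ^ 3 := by gcongr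
  have hεL : |fderiv ℝ F y ε| ≤ L * (C * η ^ 3) := by
    rw [← Real.norm_eq_abs]
    exact (ContinuousLinearMap.le_opNorm _ _).trans
      (mul_le_mul (hF1.norm_le y) hyy' (norm_nonneg _) hL)
  have hq1 : |Q δ γ| ≤ L * (((K₁ + C) * η) * ((K₁ + C) * η ^ 2)) :=
    (hQb δ γ).trans (by gcongr)
  have hq2 : |Q γ β| ≤ L * (((K₁ + C) * η ^ 2) * (d * H * L * η)) :=
    (hQb γ β).trans (by gcongr)
  have hq : Q δ δ = Q β β + Q δ γ + Q γ β := by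
    have : Q δ δ = Q δ β + Q δ γ := by rw [← map_add, ← hδβ]
    rw [this]
    have : Q δ β = Q β β + Q γ β := by rw [← add_apply, ← map_add, ← hδβ]
    rw [this]; ring
  have hDδ : fderiv ℝ F y δ = fderiv ℝ F y I + fderiv ℝ F y ε := by rw [hδI, map_add]
  rw [hdr]
  rw [hq, hDδ] at hT
  have hq0 := abs_nonneg (Q δ γ)
  have hq0' := abs_nonneg (Q γ β)
  calc _ = |(F y' - F y - (fderiv ℝ F y I + fderiv ℝ F y ε) -
        1 / 2 * (Q β β + Q δ γ + Q γ β)) + fderiv ℝ F y ε + (1 / 2 * Q δ γ + 1 / 2 * Q γ β)| := by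
        congr 1; ring
    _ ≤ L * ‖δ‖ ^ 3 + |fderiv ℝ F y ε| + (|Q δ γ| + |Q γ β|) := by
        refine (abs_add_three _ _ _).trans ?_
        have : |1 / 2 * Q δ γ + 1 / 2 * Q γ β| ≤ |Q δ γ| + |Q γ β| := by
          refine (abs_add_le _ _).trans ?_
          rw [abs_mul, abs_mul, abs_of_pos (by norm_num : (0 : ℝ) < 1 / 2)]
          linarith
        linarith
    _ ≤ L * ((K₁ + C) * η) ^ 3 + L * (C * η ^ 3) + (L * (((K₁ + C) * η) * ((K₁ + C) * η ^ 2)) +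
          L * (((K₁ + C) * η ^ 2) * (d * H * L * η))) := by linarith
    _ = _ := by ring

end BddFields

end Euler

/-! ### Riemann–Stieltjes integrals against Lipschitz functions -/

section RiemannStieltjes

variable {F : Type*} [NormedAddCommGroup F] [NormedSpace ℝ F]

/-- The points of the uniform partition of `[a, b]` into `n` intervals. -/
noncomputable def unifPart (a b : ℝ) (n k : ℕ) : ℝ := a + k * ((b - a) / n)

lemma unifPart_zero (a b : ℝ) (n : ℕ) : unifPart a b n 0 = a := by simp [unifPart]

lemma unifPart_last (a b : ℝ) {n : ℕ} (hn : n ≠ 0) : unifPart a b n n = b := by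
  have : (n : ℝ) ≠ 0 := by exact_mod_cast hn
  unfold unifPart
  field_simp
  ring

lemma unifPart_succ_sub (a b : ℝ) (n k : ℕ) :
    unifPart a b n (k + 1) - unifPart a b n k = (b - a) / n := by
  simp only [unifPart]; push_cast; ring

lemma unifPart_le_succ {a b : ℝ} (hab : a ≤ b) (n k : ℕ) :
    unifPart a b n k ≤ unifPart a b n (k + 1) := by
  rw [← sub_nonneg, unifPart_succ_sub]
  exact div_nonneg (by linarith) (Nat.cast_nonneg n)

lemma unifPart_mem {a b : ℝ} (hab : a ≤ b) {n k : ℕ} (hk : k ≤ n) (hn : n ≠ 0) :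
    unifPart a b n k ∈ Icc a b := by
  have hmono : Monotone (unifPart a b n) := monotone_nat_of_le_succ (unifPart_le_succ hab n)
  constructor
  · exact (unifPart_zero a b n).ge.trans (hmono (Nat.zero_le k))
  · exact (hmono hk).trans (unifPart_last a b hn).le

lemma tendsto_unifPart_mesh (a b : ℝ) :
    Filter.Tendsto (fun n : ℕ => (b - a) / n) Filter.atTop (𝓝 0) :=
  tendsto_const_nhds.div_atTop tendsto_natCast_atTop_atTop

lemma mem_Icc_of_partition {t : ℕ → ℝ} {n : ℕ} {a b : ℝ} (h0 : t 0 = a) (hn : t n = b)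
    (h : ∀ k < n, t k ≤ t (k + 1)) {k : ℕ} (hk : k ≤ n) : t k ∈ Icc a b := by
  constructor
  · subst h0
    induction k with
    | zero => exact le_rfl
    | succ k ih => exact (ih (by omega)).trans (h k (by omega))
  · subst hn
    induction hk using Nat.decreasingInduction with
    | self => exact le_rfl
    | of_succ k hk ih => exact (h k hk).trans ih

lemma HasRSIntegral.tendsto {f : ℝ → F} {g : ℝ → ℝ} {a b : ℝ} {I : F}
    (h : HasRSIntegral f g a b I) {ξ : ℕ → ℕ → ℝ}
    (hξ : ∀ n, ∀ k < n, ξ n k ∈ Icc (unifPart a b n k) (unifPart a b n (k + 1))) :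
    Filter.Tendsto (fun n : ℕ => ∑ k ∈ Finset.range n,
      (g (unifPart a b n (k + 1)) - g (unifPart a b n k)) • f (ξ n k)) Filter.atTop (𝓝 I) := by
  refine Metric.tendsto_atTop.2 fun ε hε => ?_
  obtain ⟨δ, hδ, hs⟩ := h ε hε
  obtain ⟨N, hN⟩ := Filter.eventually_atTop.1 ((tendsto_unifPart_mesh a b).eventually_lt_const hδ)
  refine ⟨max N 1, fun n hn => ?_⟩
  rw [dist_eq_norm]
  refine hs n _ _ (unifPart_zero a b n) (unifPart_last a b (by
    have := le_trans (le_max_right N 1) hn; omega)) (hξ n) fun k _ => ?_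
  rw [unifPart_succ_sub]
  exact hN n (le_trans (le_max_left N 1) hn)

lemma HasRSIntegral.tendsto_left {f : ℝ → F} {g : ℝ → ℝ} {a b : ℝ} {I : F} (hab : a ≤ b)
    (h : HasRSIntegral f g a b I) :
    Filter.Tendsto (fun n : ℕ => ∑ k ∈ Finset.range n,
      (g (unifPart a b n (k + 1)) - g (unifPart a b n k)) • f (unifPart a b n k))
      Filter.atTop (𝓝 I) :=
  h.tendsto fun n k _ => ⟨le_rfl, unifPart_le_succ hab n k⟩

/-- Freezing the integrand at `c` changes every left-point sum by at most oscillation times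
variation, and the bound survives the limit. -/
lemma HasRSIntegral.norm_sub_le {f : ℝ → F} {g : ℝ → ℝ} {a b K B : ℝ} {I c : F} (hab : a ≤ b)
    (h : HasRSIntegral f g a b I) (hB : ∀ u ∈ Icc a b, ‖f u - c‖ ≤ B)
    (hg : ∀ u ∈ Icc a b, ∀ v ∈ Icc a b, |g u - g v| ≤ K * |u - v|) :
    ‖I - (g b - g a) • c‖ ≤ K * B * (b - a) := by
  refine le_of_tendsto ((h.tendsto_left hab).sub_const _).norm ?_
  filter_upwards [Filter.eventually_ne_atTop 0] with n hn
  have e1 : (g b - g a) • c = ∑ k ∈ Finset.range n,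
      (g (unifPart a b n (k + 1)) - g (unifPart a b n k)) • c := by
    rw [← Finset.sum_smul, Finset.sum_range_sub (fun k => g (unifPart a b n k)),
      unifPart_zero, unifPart_last a b hn]
  rw [e1, ← Finset.sum_sub_distrib]
  have hn' : (n : ℝ) ≠ 0 := by exact_mod_cast hn
  calc _ ≤ ∑ k ∈ Finset.range n, K * ((b - a) / n) * B := by
        refine norm_sum_le_of_le _ fun k hk => ?_
        have hk' := Finset.mem_range.1 hk
        have m1 := unifPart_mem hab hk'.le hn
        have m2 := unifPart_mem hab hk' hn
        rw [← smul_sub, norm_smul, Real.norm_eq_abs]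
        have h1 := hg _ m2 _ m1
        rw [Nat.succ_eq_add_one, unifPart_succ_sub,
          abs_of_nonneg (div_nonneg (sub_nonneg.2 hab) (Nat.cast_nonneg n))] at h1
        exact mul_le_mul h1 (hB _ m1) (norm_nonneg _) ((abs_nonneg _).trans h1)
    _ = K * B * (b - a) := by
        rw [Finset.sum_const, Finset.card_range, nsmul_eq_mul]
        field_simp

/-- A continuous function is Riemann–Stieltjes integrable against a Lipschitz function. -/
lemma exists_hasRSIntegral [CompleteSpace F] {f : ℝ → F} {g : ℝ → ℝ} {a b : ℝ} (hab : a ≤ b)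
    (hf : ContinuousOn f (Icc a b)) {K : NNReal} (hg : LipschitzOnWith K g (Icc a b)) :
    ∃ I, HasRSIntegral f g a b I := by
  -- A Lipschitz extension is absolutely continuous, so increments of `g` are integrals of a
  -- derivative bounded by `K`. The Lebesgue integral of `deriv g' • f` is then the limit, by
  -- uniform continuity of `f`.
  obtain ⟨g', hg', hgg'⟩ := hg.extend_real
  refine ⟨∫ u in a..b, deriv g' u • f u, fun ε hε => ?_⟩
  have huc := isCompact_Icc.uniformContinuousOn_of_continuous hf
  set ε' := ε / ((K + 1) * (b - a + 1)) with hε'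
  have hK : (0 : ℝ) ≤ K := K.2
  have hba : 0 ≤ b - a := by linarith
  have hε'0 : 0 < ε' := by positivity
  obtain ⟨δ, hδ, hfδ⟩ := Metric.uniformContinuousOn_iff.1 huc ε' hε'0
  refine ⟨δ, hδ, fun n t ξ h0 hn hξ hmesh => ?_⟩
  have hstep : ∀ k < n, t k ≤ t (k + 1) := fun k hk => (hξ k hk).1.trans (hξ k hk).2
  have hmem : ∀ k ≤ n, t k ∈ Icc a b := fun k hk => mem_Icc_of_partition h0 hn hstep hk
  have hderiv : ∀ c e, IntervalIntegrable (deriv g') MeasureTheory.volume c e := fun c e =>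
    (hg'.lipschitzOnWith (s := uIcc c e)).absolutelyContinuousOnInterval.intervalIntegrable_deriv
  have hsub : ∀ k < n, uIcc (t k) (t (k + 1)) ⊆ Icc a b := fun k hk => by
    rw [uIcc_of_le (hstep k hk)]
    exact Icc_subset_Icc (hmem k hk.le).1 (hmem (k + 1) hk).2
  have hint : ∀ k < n, IntervalIntegrable (fun u => deriv g' u • f u) MeasureTheory.volume
      (t k) (t (k + 1)) := fun k hk =>
    (hderiv _ _).smul_continuousOn (hf.mono (hsub k hk))
  have e1 : ∫ u in a..b, deriv g' u • f u =
      ∑ k ∈ Finset.range n, ∫ u in t k..t (k + 1), deriv g' u • f u := by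
    rw [intervalIntegral.sum_integral_adjacent_intervals hint, h0, hn]
  rw [e1, ← Finset.sum_sub_distrib]
  calc _ ≤ ∑ k ∈ Finset.range n, K * ε' * (t (k + 1) - t k) := by
        refine norm_sum_le_of_le _ fun k hk => ?_
        have hk' := Finset.mem_range.1 hk
        have hξm : ξ k ∈ Icc a b := ⟨(hmem k hk'.le).1.trans (hξ k hk').1,
          (hξ k hk').2.trans (hmem (k + 1) hk').2⟩
        have e2 : (g (t (k + 1)) - g (t k)) • f (ξ k) =
            ∫ u in t k..t (k + 1), deriv g' u • f (ξ k) := by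
          rw [intervalIntegral.integral_smul_const,
            (hg'.lipschitzOnWith (s := uIcc _ _)).absolutelyContinuousOnInterval.integral_deriv_eq_sub,
            hgg' (hmem _ hk'), hgg' (hmem _ hk'.le)]
        rw [e2, ← intervalIntegral.integral_sub ((hderiv _ _).smul_continuousOn
          continuousOn_const) (hint k hk')]
        refine (intervalIntegral.norm_integral_le_of_norm_le_const (C := K * ε')
          fun u hu => ?_).trans (le_of_eq ?_)
        · rw [uIoc_of_le (hstep k hk')] at hu
          rw [← smul_sub, norm_smul]
          have hum : u ∈ Icc a b := ⟨(hmem k hk'.le).1.trans hu.1.le,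
            hu.2.trans (hmem (k + 1) hk').2⟩
          have hd : dist (ξ k) u < δ := by
            rw [Real.dist_eq, abs_lt]
            have := hmesh k hk'
            have := (hξ k hk').1
            have := (hξ k hk').2
            constructor <;> linarith [hu.1, hu.2]
          have := hfδ _ hξm _ hum hd
          rw [dist_eq_norm] at this
          exact mul_le_mul (norm_deriv_le_of_lipschitz hg') this.le (norm_nonneg _) hK
        · rw [abs_of_nonneg (by linarith [hstep k hk'])]
    _ = K * ε' * (b - a) := by
        rw [← Finset.mul_sum, Finset.sum_range_sub, h0, hn]
    _ < (K + 1) * ε' * (b - a + 1) := by nlinarith [mul_nonneg hK hε'0.le]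
    _ = ε := by rw [hε']; field_simp

/-- A path whose increments agree up to order `θ > 1` with the left point approximations has
increments equal to the Riemann–Stieltjes integrals. -/
lemma sub_eq_sum_of_approx {d : ℕ} {Y : ℝ → F} {f : Fin d → ℝ → F} {f₀ : ℝ → F}
    {w : ℝ → Fin d → ℝ} {a b C θ δ : ℝ} (hab : a ≤ b) (hθ : 1 < θ) (hδ : 0 < δ)
    (hY : ∀ u v, a ≤ u → u ≤ v → v ≤ b → v - u < δ →
      ‖Y v - Y u - (∑ i, (w v i - w u i) • f i u + (v - u) • f₀ u)‖ ≤ C * (v - u) ^ θ)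
    {I : Fin d → F} {I₀ : F} (hI : ∀ i, HasRSIntegral (f i) (fun u => w u i) a b (I i))
    (hI₀ : HasRSIntegral f₀ (fun u => u) a b I₀) : Y b - Y a = ∑ i, I i + I₀ := by
  have hlim := (tendsto_finsetSum Finset.univ fun i _ => (hI i).tendsto_left hab).add
    (hI₀.tendsto_left hab)
  -- The total of `n` errors of size `C * ((b - a) / n) ^ θ`; it vanishes because `θ > 1`.
  have hz : Filter.Tendsto (fun n : ℕ => C * ((b - a) * ((b - a) / n) ^ (θ - 1)))
      Filter.atTop (𝓝 0) := by
    have := ((tendsto_unifPart_mesh a b).rpow_const (p := θ - 1) (Or.inr (by linarith)))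
    rw [Real.zero_rpow (by linarith)] at this
    simpa using (this.const_mul (b - a)).const_mul C
  have h2 := (hlim.const_sub (Y b - Y a)).norm
  have h3 : ‖Y b - Y a - (∑ i, I i + I₀)‖ ≤ 0 := by
    refine le_of_tendsto_of_tendsto h2 hz ?_
    filter_upwards [Filter.eventually_ne_atTop 0,
      (tendsto_unifPart_mesh a b).eventually_lt_const hδ] with n hn hnδ
    have hn' : (n : ℝ) ≠ 0 := by exact_mod_cast hn
    have e1 : Y b - Y a = ∑ k ∈ Finset.range n,
        (Y (unifPart a b n (k + 1)) - Y (unifPart a b n k)) := by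
      rw [Finset.sum_range_sub (fun k => Y (unifPart a b n k)), unifPart_zero,
        unifPart_last a b hn]
    rw [e1, Finset.sum_comm, ← Finset.sum_add_distrib, ← Finset.sum_sub_distrib]
    calc _ ≤ ∑ k ∈ Finset.range n, C * ((b - a) / n) ^ θ := by
          refine norm_sum_le_of_le _ fun k hk => ?_
          have hk' := Finset.mem_range.1 hk
          have := hY _ _ (unifPart_mem hab hk'.le hn).1 (unifPart_le_succ hab n k)
            (unifPart_mem hab hk' hn).2 (by rwa [unifPart_succ_sub])
          rwa [unifPart_succ_sub] at this ⊢
      _ = _ := by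
          have h0 : 0 ≤ (b - a) / n := div_nonneg (by linarith) (Nat.cast_nonneg n)
          have : ((b - a) / n) ^ θ = ((b - a) / n) * ((b - a) / n) ^ (θ - 1) := by
            rw [← Real.rpow_one_add' h0 (by linarith)]; congr 1; ring
          rw [Finset.sum_const, Finset.card_range, nsmul_eq_mul, this]
          field_simp
  exact sub_eq_zero.1 (norm_le_zero_iff.1 h3)

/-- Integration by parts. -/
lemma HasRSIntegral.add_eq_mul {f g : ℝ → ℝ} {a b I J : ℝ} (hab : a ≤ b)
    (h1 : HasRSIntegral (fun u => f u - f a) g a b I)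
    (h2 : HasRSIntegral (fun u => g u - g a) f a b J) :
    I + J = (f b - f a) * (g b - g a) := by
  have l1 := h1.tendsto_left hab
  -- With left tags in one integral and right tags in the other, the sums add up to an exactly
  -- telescoping one.
  have l2 := h2.tendsto (ξ := fun n k => unifPart a b n (k + 1))
    fun n k _ => ⟨unifPart_le_succ hab n k, le_rfl⟩
  refine tendsto_nhds_unique (l1.add l2) (tendsto_const_nhds.congr' ?_)
  filter_upwards [Filter.eventually_ne_atTop 0] with n hn
  rw [← Finset.sum_add_distrib]
  have : ∀ k, (g (unifPart a b n (k + 1)) - g (unifPart a b n k)) •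
      (f (unifPart a b n k) - f a) + (f (unifPart a b n (k + 1)) - f (unifPart a b n k)) •
      (g (unifPart a b n (k + 1)) - g a) =
      (fun k => (f (unifPart a b n k) - f a) * (g (unifPart a b n k) - g a)) (k + 1) -
      (fun k => (f (unifPart a b n k) - f a) * (g (unifPart a b n k) - g a)) k := by
    intro k
    simp only [smul_eq_mul]
    ring
  rw [Finset.sum_congr rfl fun k _ => this k, Finset.sum_range_sub
    fun k => (f (unifPart a b n k) - f a) * (g (unifPart a b n k) - g a)]
  simp [unifPart_zero, unifPart_last a b hn]

end RiemannStieltjes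

/-! ### Pointwise bounds for rough paths and weak geometricity -/

section RoughPathFacts

variable {α T : ℝ} {d : ℕ}

lemma norm_le_of_holderNorm_le {F : Type*} [NormedAddCommGroup F] {T β : ℝ} {w : ℝ → ℝ → F}
    {H : ℝ} (hH : 0 ≤ H) (h : holderNorm T β w ≤ ENNReal.ofReal H) {s t : ℝ} (hs : 0 ≤ s)
    (hst : s < t) (ht : t ≤ T) : ‖w s t‖ ≤ H * (t - s) ^ β := by
  have h1 : ENNReal.ofReal (‖w s t‖ / (t - s) ^ β) ≤ ENNReal.ofReal H := by
    refine le_trans ?_ h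
    unfold holderNorm
    exact le_iSup_of_le s (le_iSup_of_le t (le_iSup_of_le hs (le_iSup_of_le hst
      (le_iSup_of_le ht le_rfl))))
  rw [ENNReal.ofReal_le_ofReal_iff hH, div_le_iff₀ (Real.rpow_pos_of_pos (by linarith) _)] at h1
  exact h1

lemma exists_holder_bound {F : Type*} [NormedAddCommGroup F] {T β : ℝ} {w : ℝ → ℝ → F}
    (h : holderNorm T β w < ⊤) : ∃ H, 0 ≤ H ∧ ∀ s t, 0 ≤ s → s < t → t ≤ T →
      ‖w s t‖ ≤ H * (t - s) ^ β :=
  ⟨(holderNorm T β w).toReal, ENNReal.toReal_nonneg, fun _ _ hs hst ht =>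
    norm_le_of_holderNorm_le ENNReal.toReal_nonneg (by rw [ENNReal.ofReal_toReal h.ne]) hs hst ht⟩

namespace RoughPath

lemma fst_self (W : RoughPath α T d) {s : ℝ} (h0 : 0 ≤ s) (hT : s ≤ T) : W.fst s s = 0 := by
  have := W.chen_fst s s s h0 le_rfl le_rfl hT
  simpa using this

lemma snd_self (W : RoughPath α T d) {s : ℝ} (h0 : 0 ≤ s) (hT : s ≤ T) (j k : Fin d) :
    W.snd s s (j, k) = 0 := by
  have := W.chen_snd s s s h0 le_rfl le_rfl hT j k
  rw [W.fst_self h0 hT] at this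
  simp only [PiLp.zero_apply, mul_zero, add_zero] at this
  linarith

/-- Uniform bounds on the components of a rough path. -/
lemma exists_bound (W : RoughPath α T d) (hα : 0 < α) (hα' : α < 1 / 2) :
    ∃ H, 0 ≤ H ∧ ∀ s t, 0 ≤ s → s ≤ t → t ≤ T → t - s ≤ 1 →
      (∀ i, |W.fst s t i| ≤ H * (t - s) ^ α) ∧
      (∀ j k, |W.snd s t (j, k)| ≤ H * ((t - s) ^ α) ^ 2) ∧ |t - s| ≤ H * ((t - s) ^ α) ^ 2 := by
  obtain ⟨H₁, hH₁, h1⟩ := exists_holder_bound W.holder_fst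
  obtain ⟨H₂, hH₂, h2⟩ := exists_holder_bound W.holder_snd
  -- The summand `1` pays for the time increment: `t - s ≤ (t - s) ^ (2 * α)` for `t - s ≤ 1` and `2
  -- * α < 1`, so the drift counts as a second order term.
  refine ⟨H₁ + H₂ + 1, by positivity, fun s t hs hst ht hst1 => ?_⟩
  have hη : 0 ≤ (t - s) ^ α := Real.rpow_nonneg (by linarith) _
  have hsq : (t - s) ^ (2 * α) = ((t - s) ^ α) ^ 2 := by
    rw [mul_comm, Real.rpow_mul (by linarith)]; norm_cast
  rcases hst.eq_or_lt with rfl | hlt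
  · refine ⟨fun i => ?_, fun j k => ?_, ?_⟩
    · rw [W.fst_self hs ht, PiLp.zero_apply, abs_zero]; positivity
    · rw [W.snd_self hs ht, abs_zero]; positivity
    · rw [sub_self, abs_zero]; positivity
  · refine ⟨fun i => ?_, fun j k => ?_, ?_⟩
    · refine (le_trans (PiLp.norm_apply_le (W.fst s t) i) (h1 s t hs hlt ht)).trans ?_
      gcongr; linarith
    · refine (le_trans (PiLp.norm_apply_le (W.snd s t) (j, k)) (h2 s t hs hlt ht)).trans ?_
      rw [hsq]
      gcongr; linarith
    · rw [abs_of_pos (by linarith), ← hsq]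
      calc t - s = (t - s) ^ (1 : ℝ) := (Real.rpow_one _).symm
        _ ≤ (t - s) ^ (2 * α) :=
          Real.rpow_le_rpow_of_exponent_ge (by linarith) hst1 (by linarith)
        _ ≤ _ := le_mul_of_one_le_left (by rw [hsq]; positivity) (by linarith)

lemma IsLiftOf.symm {W : RoughPath α T d} {w : ℝ → E d} (h : W.IsLiftOf w) {s t : ℝ} (hs : 0 ≤ s)
    (hst : s ≤ t) (ht : t ≤ T) (j k : Fin d) :
    W.snd s t (j, k) + W.snd s t (k, j) = W.fst s t j * W.fst s t k := by
  obtain ⟨h1, h2⟩ := h s t hs hst ht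
  rw [(h2 j k).add_eq_mul hst (h2 k j), h1]
  simp

/-- Geometric rough paths are weakly geometric. -/
lemma IsGeometric.symm {W : RoughPath α T d} (h : W.IsGeometric) {s t : ℝ} (hs : 0 ≤ s)
    (hst : s ≤ t) (ht : t ≤ T) (j k : Fin d) :
    W.snd s t (j, k) + W.snd s t (k, j) = W.fst s t j * W.fst s t k := by
  rcases hst.eq_or_lt with rfl | hlt
  · simp [W.fst_self hs ht, W.snd_self hs ht]
  set A := (t - s) ^ α
  set B := (t - s) ^ (2 * α)
  have hA : 0 ≤ A := Real.rpow_nonneg (by linarith) _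
  have hB : 0 ≤ B := Real.rpow_nonneg (by linarith) _
  set X := W.fst s t
  -- The identity holds for lifts by integration by parts. At fixed `s < t` both sides are
  -- continuous for the rough path distance, so it passes to the closure.
  have key : ∀ ε : ℝ, 0 < ε → |W.snd s t (j, k) + W.snd s t (k, j) - X j * X k| ≤
      2 * (ε * B) + ε * A * (|X j| + |X k|) + (ε * A) * (ε * A) := by
    intro ε hε
    obtain ⟨w, v, -, hv, hd⟩ := h (ENNReal.ofReal ε) (by simpa using hε)
    have h1 := norm_le_of_holderNorm_le hε.le ((le_max_left _ _).trans hd.le) hs hlt ht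
    have h2 := norm_le_of_holderNorm_le hε.le ((le_max_right _ _).trans hd.le) hs hlt ht
    have hx : ∀ i, |X i - v.fst s t i| ≤ ε * A := fun i =>
      (PiLp.norm_apply_le (W.fst s t - v.fst s t) i).trans h1
    have hxx : ∀ q, |W.snd s t q - v.snd s t q| ≤ ε * B := fun q =>
      (PiLp.norm_apply_le (W.snd s t - v.snd s t) q).trans h2
    have hsym := hv.symm hs hst ht j k
    have hp : W.snd s t (j, k) + W.snd s t (k, j) - X j * X k =
        (W.snd s t (j, k) - v.snd s t (j, k)) + (W.snd s t (k, j) - v.snd s t (k, j)) -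
        (X j * (X k - v.fst s t k) + X k * (X j - v.fst s t j) -
          (X j - v.fst s t j) * (X k - v.fst s t k)) := by
      linear_combination hsym
    rw [hp]
    have b1 : |X j * (X k - v.fst s t k)| ≤ |X j| * (ε * A) := by
      rw [abs_mul]; exact mul_le_mul_of_nonneg_left (hx k) (abs_nonneg _)
    have b2 : |X k * (X j - v.fst s t j)| ≤ |X k| * (ε * A) := by
      rw [abs_mul]; exact mul_le_mul_of_nonneg_left (hx j) (abs_nonneg _)
    have b3 : |(X j - v.fst s t j) * (X k - v.fst s t k)| ≤ (ε * A) * (ε * A) := by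
      rw [abs_mul]; exact mul_le_mul (hx j) (hx k) (abs_nonneg _) (by positivity)
    have := hxx (j, k)
    have := hxx (k, j)
    rw [abs_le] at *
    constructor <;> linarith
  have hlim : Filter.Tendsto (fun ε : ℝ => 2 * (ε * B) + ε * A * (|X j| + |X k|) +
      (ε * A) * (ε * A)) (𝓝[>] 0) (𝓝 0) := by
    have : Continuous fun ε : ℝ => 2 * (ε * B) + ε * A * (|X j| + |X k|) + (ε * A) * (ε * A) := by
      fun_prop
    have := this.tendsto 0
    simp only [zero_mul, mul_zero, add_zero] at this
    exact this.mono_left nhdsWithin_le_nhds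
  have := ge_of_tendsto hlim (Filter.eventually_of_mem self_mem_nhdsWithin fun ε hε => key ε hε)
  exact sub_eq_zero.1 (abs_eq_zero.1 (le_antisymm this (abs_nonneg _)))

/-- The second level of the lift of a Lipschitz path is of second order. -/
lemma IsLiftOf.exists_bound {W : RoughPath α T d} {w : ℝ → E d} (h : W.IsLiftOf w) {K : NNReal}
    (hw : LipschitzOnWith K w (Icc 0 T)) {s t : ℝ} (hs : 0 ≤ s) (hst : s ≤ t) (ht : t ≤ T)
    (j k : Fin d) : |W.snd s t (j, k)| ≤ (K : ℝ) ^ 2 * (t - s) ^ 2 := by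
  have hcoord : ∀ i, ∀ u ∈ Icc s t, ∀ v ∈ Icc s t, |w u i - w v i| ≤ K * |u - v| := by
    intro i u hu v hv
    have h1 := hw.dist_le_mul u ⟨hs.trans hu.1, hu.2.trans ht⟩ v ⟨hs.trans hv.1, hv.2.trans ht⟩
    rw [dist_eq_norm, Real.dist_eq] at h1
    exact (PiLp.norm_apply_le (w u - w v) i).trans h1
  have := ((h s t hs hst ht).2 j k).norm_sub_le (K := K) (B := K * (t - s)) (c := 0) hst
    (fun u hu => by
      rw [sub_zero, Real.norm_eq_abs]
      refine (hcoord j u hu s ⟨le_rfl, hst⟩).trans ?_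
      rw [abs_of_nonneg (by linarith [hu.1])]
      have := hu.2
      gcongr) (hcoord k)
  rw [smul_zero, sub_zero, Real.norm_eq_abs] at this
  exact this.trans (le_of_eq (by ring))

end RoughPath

end RoughPathFacts

/-! ### Cut-off vector fields with bounds uniform over compact sets of plaques -/

section LocalModel

lemma bddLip_of_iteratedFDeriv_le {X Y : Type*} [NormedAddCommGroup X] [NormedSpace ℝ X]
    [NormedAddCommGroup Y] [NormedSpace ℝ Y] {L : ℝ} {g : X → Y} (hg : Differentiable ℝ g)
    (h : ∀ l ≤ 1, ∀ y, ‖iteratedFDeriv ℝ l g y‖ ≤ L) : BddLip L g :=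
  ⟨fun y => by simpa using h 0 (by omega) y,
    norm_sub_le_of_fderiv hg fun y => by
      rw [← norm_iteratedFDeriv_one]; exact h 1 le_rfl y⟩

/-- `g` is of class `C³` with derivatives bounded by `L`. -/
structure BddThree {X Y : Type*} [NormedAddCommGroup X] [NormedSpace ℝ X]
    [NormedAddCommGroup Y] [NormedSpace ℝ Y] (L : ℝ) (g : X → Y) : Prop where
  diff : Differentiable ℝ g
  diff_fderiv : Differentiable ℝ (fderiv ℝ g)
  bdd : BddLip L g
  bdd_fderiv : BddLip L (fderiv ℝ g)
  bdd_fderiv_fderiv : BddLip L (fderiv ℝ (fderiv ℝ g))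

lemma BddThree.of_iteratedFDeriv_le {X Y : Type*} [NormedAddCommGroup X] [NormedSpace ℝ X]
    [NormedAddCommGroup Y] [NormedSpace ℝ Y] {L : ℝ} {g : X → Y} (hg : ContDiff ℝ 3 g)
    (h : ∀ l ≤ 3, ∀ y, ‖iteratedFDeriv ℝ l g y‖ ≤ L) : BddThree L g := by
  have h1 : ContDiff ℝ 2 (fderiv ℝ g) := hg.fderiv_right (by norm_num)
  have h2 : ContDiff ℝ 1 (fderiv ℝ (fderiv ℝ g)) := h1.fderiv_right (by norm_num)
  refine ⟨hg.differentiable (by simp), h1.differentiable (by simp),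
    bddLip_of_iteratedFDeriv_le (hg.differentiable (by simp)) fun l hl => h l (by omega),
    bddLip_of_iteratedFDeriv_le (h1.differentiable (by simp)) fun l hl y => ?_,
    bddLip_of_iteratedFDeriv_le (h2.differentiable (by simp)) fun l hl y => ?_⟩
  · rw [norm_iteratedFDeriv_fderiv]
    exact h _ (by omega) y
  · rw [norm_iteratedFDeriv_fderiv, norm_iteratedFDeriv_fderiv]
    exact h _ (by omega) y

variable {p : ℕ} {Z : Type*} [TopologicalSpace Z]

lemma leafwiseContDiffOn_fst {k : ℕ} {U : Set (E p × Z)} (hU : IsOpen U) :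
    LeafwiseContDiffOn k (fun q : E p × Z => q.1) U := by
  cases k with
  | zero => exact leafwiseContDiffOn_zero.2 continuousOn_fst
  | succ k =>
    refine (leafwiseContDiffOn_succ hU).2 ⟨continuousOn_fst, fun q _ => differentiableAt_id, ?_⟩
    have : leafFDeriv (fun q : E p × Z => q.1) = fun _ => ContinuousLinearMap.id ℝ (E p) :=
      funext fun q => fderiv_id
    rw [this]
    exact LeafwiseContDiffOn.of_transverse hU continuousOn_const fun q _ =>
      Filter.Eventually.of_forall fun _ => rfl

/-- Cutting off in the leaf variable gives uniformly bounded functions. -/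
lemma LeafwiseContDiffOn.exists_cutoff {F : Type} [NormedAddCommGroup F] [NormedSpace ℝ F]
    {f : E p × Z → F} {B₁ : Set (E p)} {B₂ : Set Z} (hB₁ : IsOpen B₁) (hB₂ : IsOpen B₂)
    (hf : LeafwiseContDiffOn 3 f (B₁ ×ˢ B₂)) {y₀ : E p} {r : ℝ} (hr : 0 < r)
    (hrB : Metric.closedBall y₀ (2 * r) ⊆ B₁) {K₂ : Set Z} (hK₂ : IsCompact K₂) (hKB : K₂ ⊆ B₂) :
    ∃ L : ℝ, ∀ z ∈ K₂, ∃ g : E p → F, BddThree L g ∧ ∀ y ∈ Metric.ball y₀ r, g y = f (y, z) := by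
  let χ : ContDiffBump y₀ := ⟨r, 2 * r, hr, by linarith⟩
  set G : E p × Z → F := fun q => χ q.1 • f q with hG
  have hU : IsOpen ((univ : Set (E p)) ×ˢ B₂) := isOpen_univ.prod hB₂
  have hG0 : ∀ y ∉ Metric.closedBall y₀ (2 * r), ∀ z, G (y, z) = 0 := by
    intro y hy z
    have : χ y = 0 := χ.zero_of_le_dist (by
      have : 2 * r < dist y y₀ := by simpa using hy
      exact this.le)
    simp [hG, this]
  -- Points outside `B₁` have a neighbourhood on which the bump vanishes, so the values of `f` there
  -- are harmless. Joint continuity of the derivatives on the compact product below then gives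
  -- bounds independent of `z ∈ K₂`.
  have hGc : LeafwiseContDiffOn 3 G (univ ×ˢ B₂) := by
    refine LeafwiseContDiffOn.of_locally fun q hq => ?_
    by_cases hqB : q.1 ∈ B₁
    · have hO := hB₁.prod hB₂
      refine ⟨B₁ ×ˢ B₂, hO, ⟨hqB, hq.2⟩, ?_⟩
      have h1 : LeafwiseContDiffOn 3 (fun q : E p × Z => χ q.1) (B₁ ×ˢ B₂) :=
        (leafwiseContDiffOn_fst hO).contDiff_comp (g := χ) χ.contDiff hO
      exact h1.bilinear (ContinuousLinearMap.lsmul ℝ ℝ) hO hf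
    · have hO : IsOpen ((Metric.closedBall y₀ (2 * r))ᶜ ×ˢ B₂) :=
        Metric.isClosed_closedBall.isOpen_compl.prod hB₂
      refine ⟨_, hO, ⟨fun h => hqB (hrB h), hq.2⟩, ?_⟩
      have h0 : LeafwiseContDiffOn 3 (fun _ : E p × Z => (0 : F))
          ((Metric.closedBall y₀ (2 * r))ᶜ ×ˢ B₂) :=
        LeafwiseContDiffOn.of_transverse hO continuousOn_const fun q _ =>
          Filter.Eventually.of_forall fun _ => rfl
      exact h0.congr hO fun q' hq' => hG0 q'.1 hq'.1 q'.2
  have hcomp : IsCompact (Metric.closedBall y₀ (2 * r) ×ˢ K₂) :=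
    (isCompact_closedBall y₀ (2 * r)).prod hK₂
  have hb : ∀ l : ℕ, ∃ L : ℝ, l ≤ 3 → ∀ q ∈ Metric.closedBall y₀ (2 * r) ×ˢ K₂,
      ‖iteratedFDeriv ℝ l (fun y => G (y, q.2)) q.1‖ ≤ L := by
    intro l
    by_cases hl : l ≤ 3
    · obtain ⟨L, hL⟩ := hcomp.exists_bound_of_continuousOn
        ((hGc.2 l hl).mono (prod_mono (subset_univ _) hKB))
      exact ⟨L, fun _ => hL⟩
    · exact ⟨0, fun h => absurd h hl⟩
  choose L hL using hb
  refine ⟨∑ l ∈ Finset.range 4, |L l|, fun z hz => ⟨fun y => G (y, z), ?_, fun y hy => ?_⟩⟩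
  · refine BddThree.of_iteratedFDeriv_le ?_ fun l hl y => ?_
    · have := hGc.1 z
      have hu : {y : E p | (y, z) ∈ (univ : Set (E p)) ×ˢ B₂} = univ := by
        ext y; simp [hKB hz]
      rw [hu, contDiffOn_univ] at this
      exact_mod_cast this
    · have hsum : |L l| ≤ ∑ l ∈ Finset.range 4, |L l| :=
        Finset.single_le_sum (f := fun l => |L l|) (fun _ _ => abs_nonneg _)
          (Finset.mem_range.2 (by omega))
      by_cases hy : y ∈ Metric.closedBall y₀ (2 * r)
      · exact ((hL l hl (y, z) ⟨hy, hz⟩).trans (le_abs_self _)).trans hsum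
      · have he : (fun y => G (y, z)) =ᶠ[𝓝 y] fun _ => 0 := by
          filter_upwards [Metric.isClosed_closedBall.isOpen_compl.mem_nhds hy] with y' hy'
            using hG0 y' hy' z
        have : iteratedFDeriv ℝ l (fun y => G (y, z)) y = 0 := by
          rw [(he.iteratedFDeriv ℝ l).eq_of_nhds]
          simp
        rw [this, norm_zero]
        exact (abs_nonneg _).trans hsum
  · have : χ y = 1 := χ.one_of_mem_closedBall (Metric.ball_subset_closedBall hy)
    simp [hG, this]

lemma BddThree.mono {X Y : Type*} [NormedAddCommGroup X] [NormedSpace ℝ X]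
    [NormedAddCommGroup Y] [NormedSpace ℝ Y] {L L' : ℝ} {g : X → Y} (h : BddThree L g)
    (hL : L ≤ L') : BddThree L' g :=
  ⟨h.diff, h.diff_fderiv, h.bdd.mono hL, h.bdd_fderiv.mono hL, h.bdd_fderiv_fderiv.mono hL⟩

variable {M : Type*} [TopologicalSpace M] {A : FoliatedAtlas p Z M} {d : ℕ}

lemma FoliatedAtlas.exists_box {φ : OpenPartialHomeomorph M (E p × Z)} (hφ : φ ∈ A.charts)
    {m : M} (hm : m ∈ φ.source) : ∃ (B₁ : Set (E p)) (B₂ : Set Z) (r : ℝ), IsOpen B₁ ∧ IsOpen B₂ ∧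
      φ.target = B₁ ×ˢ B₂ ∧ 0 < r ∧ Metric.closedBall (φ m).1 (2 * r) ⊆ B₁ ∧ (φ m).2 ∈ B₂ := by
  obtain ⟨B₁, B₂, hB₁, -, hB₂, ht⟩ := A.target_eq_prod φ hφ
  have hmt : φ m ∈ B₁ ×ˢ B₂ := ht ▸ φ.map_source hm
  obtain ⟨r, hr, hrB⟩ := Metric.nhds_basis_closedBall.mem_iff.1 (hB₁.mem_nhds hmt.1)
  exact ⟨B₁, B₂, r / 2, hB₁, hB₂, ht, by linarith, by rwa [mul_div_cancel₀ r two_ne_zero], hmt.2⟩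

/-- Around every point, in a given chart, the vector fields coincide with globally defined
vector fields whose derivatives are bounded uniformly in the transverse variable. -/
lemma exists_bddFields {V : Fin d → A.LeafVectorField} {V₀ : A.LeafVectorField}
    (hV : ∀ i, (V i).IsLeafwiseContDiff 3) (hV₀ : V₀.IsLeafwiseContDiff 3)
    {φ : OpenPartialHomeomorph M (E p × Z)} (hφ : φ ∈ A.charts)
    {B₁ : Set (E p)} {B₂ : Set Z} {r : ℝ} (hB₁ : IsOpen B₁) (hB₂ : IsOpen B₂)
    (ht : φ.target = B₁ ×ˢ B₂) (hr : 0 < r) {y₀ : E p} (hrB : Metric.closedBall y₀ (2 * r) ⊆ B₁)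
    {K₂ : Set Z} (hK₂ : IsCompact K₂) (hKB : K₂ ⊆ B₂) :
    ∃ L : ℝ, ∀ z ∈ K₂, ∃ (v : Fin d → E p → E p) (v₀ : E p → E p), BddFields L v v₀ ∧
      ∀ y ∈ Metric.ball y₀ r, (∀ i, v i y = (V i).inChart φ (y, z)) ∧
        v₀ y = V₀.inChart φ (y, z) := by
  have h1 := fun i => (ht ▸ hV i φ hφ).exists_cutoff hB₁ hB₂ hr hrB hK₂ hKB
  obtain ⟨L₀, h0⟩ := (ht ▸ hV₀ φ hφ).exists_cutoff hB₁ hB₂ hr hrB hK₂ hKB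
  choose L hL using h1
  refine ⟨∑ i, |L i| + |L₀|, fun z hz => ?_⟩
  choose v hv using fun i => hL i z hz
  obtain ⟨v₀, hv₀, hv₀'⟩ := h0 z hz
  have hb : ∀ i, BddThree (∑ i, |L i| + |L₀|) (v i) := fun i => (hv i).1.mono (by
    have := Finset.single_le_sum (f := fun i => |L i|) (fun _ _ => abs_nonneg _)
      (Finset.mem_univ i)
    linarith [le_abs_self (L i), abs_nonneg L₀])
  have hb₀ : BddThree (∑ i, |L i| + |L₀|) v₀ := hv₀.mono (by
    have := Finset.sum_nonneg (f := fun i => |L i|) (s := Finset.univ) (fun _ _ => abs_nonneg _)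
    linarith [le_abs_self L₀])
  exact ⟨v, v₀, ⟨fun i => (hb i).diff, fun i => (hb i).diff_fderiv, hb₀.diff, fun i => (hb i).bdd,
    fun i => (hb i).bdd_fderiv, fun i => (hb i).bdd_fderiv_fderiv, hb₀.bdd, hb₀.bdd_fderiv⟩,
    fun y hy => ⟨fun i => (hv i).2 y hy, hv₀' y hy⟩⟩

end LocalModel

/-! ### The Euler step of a rough path as an almost flow -/

section Step

variable {X : Type*} [NormedAddCommGroup X] [NormedSpace ℝ X] {α T : ℝ} {d : ℕ}

/-- The increment of the Euler scheme driven by a rough path. -/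
noncomputable def roughIncr (W : RoughPath α T d) (v : Fin d → X → X) (v₀ : X → X) (s t : ℝ) :
    X → X :=
  eulerIncr v v₀ (fun i => W.fst s t i) (fun j k => W.snd s t (j, k)) (t - s)

/-- One step sees only the values of the fields and the first derivatives of `v` at `y`. Hence
cut-off fields may replace the original ones wherever they agree on a neighbourhood. -/
lemma roughIncr_congr (W : RoughPath α T d) {v v' : Fin d → X → X} {v₀ v₀' : X → X} {y : X}
    (hv : ∀ i, v i =ᶠ[𝓝 y] v' i) (hv₀ : v₀ y = v₀' y) (s t : ℝ) :
    roughIncr W v v₀ s t y = roughIncr W v' v₀' s t y := by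
  have e1 : ∀ i, v i y = v' i y := fun i => (hv i).eq_of_nhds
  have e2 : ∀ i, fderiv ℝ (v i) y = fderiv ℝ (v' i) y := fun i => (hv i).fderiv_eq
  simp only [roughIncr, eulerIncr, driven, secondField, hv₀, e1, e2]

/-- The constant is chosen before the fields and depends on them only through `L`; this later gives
a common life span on all plaques of a compact family. Chen's relations identify the combined data
of `eulerIncr_defect` with those of `[s, t]`. -/
lemma BddFields.exists_isAlmostFlow (W : RoughPath α T d) (hα : 0 < α) (hα' : α < 1 / 2) (L : ℝ)
    (hL : 0 ≤ L) : ∃ K, 0 ≤ K ∧ ∀ (v : Fin d → X → X) (v₀ : X → X), BddFields L v v₀ →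
      ∀ a b, 0 ≤ a → b ≤ T → b - a ≤ 1 →
        IsAlmostFlow α K a b (fun s t y => y + roughIncr W v v₀ s t y) := by
  obtain ⟨H, hH, hW⟩ := W.exists_bound hα hα'
  set K₁ := termCount d * H * (L + 4 * L ^ 2) with hK₁
  set K₂ := 2 * d * H * (L + 4 * L ^ 2) * (termCount d * H * (L + 4 * L ^ 2)) ^ 2 +
      2 * d * H * (L + 4 * L ^ 2) * (termCount d * H * (L + 4 * L ^ 2)) +
      2 * termCount d * H * (L + 4 * L ^ 2) * (termCount d * H * (L + 4 * L ^ 2)) with hK₂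
  have hc := termCount_nonneg d
  have hK₁0 : 0 ≤ K₁ := by positivity
  have hK₂0 : 0 ≤ K₂ := by positivity
  refine ⟨K₁ + K₂, by positivity, fun v v₀ h a b ha hb hab => ?_⟩
  have hη : ∀ {s t : ℝ}, s ≤ t → 0 ≤ (t - s) ^ α := fun hst =>
    Real.rpow_nonneg (by linarith) _
  have hη1 : ∀ {s t : ℝ}, s ≤ t → t - s ≤ 1 → (t - s) ^ α ≤ 1 := fun hst h1 =>
    Real.rpow_le_one (by linarith) h1 hα.le
  have hsq : ∀ {s t : ℝ}, s ≤ t → t - s ≤ 1 → H * ((t - s) ^ α) ^ 2 ≤ H * (t - s) ^ α := by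
    intro s t hst h1
    have := hη hst
    have := hη1 hst h1
    have : ((t - s) ^ α) ^ 2 ≤ (t - s) ^ α := by nlinarith
    gcongr
  refine ⟨fun s t hs hst ht => ?_, fun s t hs hst ht x r y r' => ?_, fun s u t hs hsu hut ht => ?_⟩
  · obtain ⟨w1, w2, w3⟩ := hW s t (ha.trans hs) hst (ht.trans hb) (by linarith)
    have hq := hsq hst (by linarith)
    have := h.eulerIncr_bdd w1 (fun j k => (w2 j k).trans hq) (w3.trans hq)
    simp only [add_sub_cancel_left]
    refine this.mono ?_
    calc _ = K₁ * (t - s) ^ α := by rw [hK₁]; ring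
      _ ≤ _ := by
        have := hη hst
        gcongr; linarith
  · obtain ⟨w1, w2, w3⟩ := hW s t (ha.trans hs) hst (ht.trans hb) (by linarith)
    have hq := hsq hst (by linarith)
    have := h.eulerIncr_four_point w1 (fun j k => (w2 j k).trans hq) (w3.trans hq) x r y r'
    simp only [add_sub_cancel_left]
    refine this.trans ?_
    have hnn := hη hst
    refine mul_le_mul_of_nonneg_right ?_ (by positivity)
    calc _ = K₁ * (t - s) ^ α := by rw [hK₁]; ring
      _ ≤ _ := by gcongr; linarith
  · have hst := hsu.trans hut
    obtain ⟨w1, w2, w3⟩ := hW s u (ha.trans hs) hsu ((hut.trans ht).trans hb) (by linarith)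
    obtain ⟨w1', w2', w3'⟩ := hW u t (ha.trans (hs.trans hsu)) hut (ht.trans hb) (by linarith)
    have m1 : (u - s) ^ α ≤ (t - s) ^ α := by
      have : 0 ≤ u - s := by linarith
      gcongr
    have m2 : (t - u) ^ α ≤ (t - s) ^ α := by
      have : 0 ≤ t - u := by linarith
      gcongr
    have n1 := hη hsu
    have n2 := hη hut
    have l1 : H * (u - s) ^ α ≤ H * (t - s) ^ α := by gcongr
    have l2 : H * (t - u) ^ α ≤ H * (t - s) ^ α := by gcongr
    have q1 : H * ((u - s) ^ α) ^ 2 ≤ H * ((t - s) ^ α) ^ 2 := by gcongr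
    have q2 : H * ((t - u) ^ α) ^ 2 ≤ H * ((t - s) ^ α) ^ 2 := by gcongr
    have key := h.eulerIncr_defect hH (hη hst) (hη1 hst (by linarith))
      (fun i => (w1 i).trans l1) (fun j k => (w2 j k).trans q1) (w3.trans q1)
      (fun i => (w1' i).trans l2) (fun j k => (w2' j k).trans q2) (w3'.trans q2)
    have hcube : ((t - s) ^ α) ^ 3 = (t - s) ^ (3 * α) := by
      rw [mul_comm 3 α, Real.rpow_mul (by linarith)]; norm_cast
    rw [hcube] at key
    have hst0 : 0 ≤ s := ha.trans hs
    have c1 : (fun i => W.fst s u i + W.fst u t i) = fun i => W.fst s t i := by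
      funext i
      rw [W.chen_fst s u t hst0 hsu hut (ht.trans hb)]
      rfl
    have c2 : (fun j k => W.snd s u (j, k) + W.snd u t (j, k) + W.fst s u j * W.fst u t k) =
        fun j k => W.snd s t (j, k) := by
      funext j k
      rw [W.chen_snd s u t hst0 hsu hut (ht.trans hb)]
    have c3 : u - s + (t - u) = t - s := by ring
    rw [c1, c2, c3] at key
    refine key.mono ?_
    have : 0 ≤ (t - s) ^ (3 * α) := Real.rpow_nonneg (by linarith) _
    exact mul_le_mul_of_nonneg_right (le_add_of_nonneg_left hK₁0) this

lemma BddFields.continuousOn_step (W : RoughPath α T d) {L : ℝ} {v : Fin d → X → X} {v₀ : X → X}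
    (h : BddFields L v v₀) {a b : ℝ} (ha : 0 ≤ a) (hb : b ≤ T) :
    ContinuousOn (fun q : (ℝ × ℝ) × X => q.2 + roughIncr W v v₀ q.1.1 q.1.2 q.2)
      {q | a ≤ q.1.1 ∧ q.1.1 ≤ q.1.2 ∧ q.1.2 ≤ b} := by
  have hm : MapsTo (fun q : (ℝ × ℝ) × X => q.1) {q | a ≤ q.1.1 ∧ q.1.1 ≤ q.1.2 ∧ q.1.2 ≤ b}
      (simplex T) := fun q hq => ⟨ha.trans hq.1, hq.2.1, hq.2.2.trans hb⟩
  have w1 := W.continuousOn_fst.comp continuous_fst.continuousOn hm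
  have w2 := W.continuousOn_snd.comp continuous_fst.continuousOn hm
  have hv : ∀ i, Continuous (v i) := fun i => (h.diff i).continuous
  have ha' : ∀ j k, Continuous (secondField v j k) := fun j k =>
    ((h.diff_fderiv k).continuous).clm_apply (hv j)
  have hv₀ : Continuous v₀ := h.diff_zero.continuous
  refine continuous_snd.continuousOn.add (((continuousOn_finsetSum _ fun i _ => ?_).add
    (continuousOn_finsetSum _ fun j _ => continuousOn_finsetSum _ fun k _ => ?_)).add ?_)
  · exact ((PiLp.continuous_apply 2 _ i).comp_continuousOn w1).smul
      ((hv i).comp continuous_snd).continuousOn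
  · exact ((PiLp.continuous_apply 2 _ (j, k)).comp_continuousOn w2).smul
      ((ha' j k).comp continuous_snd).continuousOn
  · exact (by fun_prop : Continuous fun q : (ℝ × ℝ) × X => (q.1.2 - q.1.1) • v₀ q.2).continuousOn

end Step

/-! ### Solutions move in plaques and follow the Euler scheme -/

section LocalSolutions

variable {p d : ℕ} {Z M : Type*} [TopologicalSpace Z] [TopologicalSpace M]
  {A : FoliatedAtlas p Z M} {α T : ℝ}

/-- The vector fields in the plaque `z` of a chart. -/
def chartFields (V : Fin d → A.LeafVectorField) (φ : OpenPartialHomeomorph M (E p × Z)) (z : Z) :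
    Fin d → E p → E p :=
  fun i y => (V i).inChart φ (y, z)

/-- Near the time `c`, the path `x` moves in a plaque of the chart `φ` and follows the Euler scheme
up to order `3 * α`. -/
def IsLocalSolutionAt (V : Fin d → A.LeafVectorField) (V₀ : A.LeafVectorField)
    (W : RoughPath α T d) (a b : ℝ) (x : ℝ → M) (φ : OpenPartialHomeomorph M (E p × Z))
    (c : ℝ) : Prop :=
  ∃ ε > 0, ∃ C : ℝ, ∀ s t, a ≤ s → s ≤ t → t ≤ b → |s - c| < ε → |t - c| < ε →
    x s ∈ φ.source ∧ x t ∈ φ.source ∧ (φ (x t)).2 = (φ (x s)).2 ∧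
    ‖(φ (x t)).1 - ((φ (x s)).1 + roughIncr W (chartFields V φ (φ (x s)).2)
      (fun y => V₀.inChart φ (y, (φ (x s)).2)) s t (φ (x s)).1)‖ ≤ C * (t - s) ^ (3 * α)

/-- Phrased with an explicit expression `F` on an open piece of a plaque so that it can be iterated:
its conclusion supplies the expression needed for a second derivative. -/
lemma FoliatedAtlas.deriv_eq_fderiv {k : ℕ} (hk : 1 ≤ k) {f : M → ℝ} (hf : A.LeafwiseContDiff k f)
    (V : A.LeafVectorField) {φ : OpenPartialHomeomorph M (E p × Z)} (hφ : φ ∈ A.charts) {z : Z}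
    {O : Set (E p)} (hO : IsOpen O) (hOt : ∀ y ∈ O, (y, z) ∈ φ.target) {F : E p → ℝ}
    (hF : ∀ y ∈ O, f (φ.symm (y, z)) = F y) {y : E p} (hy : y ∈ O) :
    V.deriv f (φ.symm (y, z)) = fderiv ℝ F y (V.inChart φ (y, z)) := by
  rw [FoliatedAtlas.deriv_symm_apply hk hf V hφ (hOt y hy)]
  have : (fun y => f (φ.symm (y, z))) =ᶠ[𝓝 y] F := by
    filter_upwards [hO.mem_nhds hy] with y' hy' using hF y' hy'
  simp only [leafFDeriv]
  rw [this.fderiv_eq]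

lemma exists_pos_forall_mem {X : Type*} [TopologicalSpace X] {x : ℝ → X} {a b c : ℝ}
    (hx : ContinuousOn x (Icc a b)) (hc : c ∈ Icc a b) {O : Set X} (hO : O ∈ 𝓝 (x c)) :
    ∃ ε > 0, ∀ s ∈ Icc a b, |s - c| < ε → x s ∈ O := by
  obtain ⟨ε, hε, h⟩ := Metric.mem_nhdsWithin_iff.1 ((hx c hc) hO)
  exact ⟨ε, hε, fun s hs hsc => h ⟨by simpa [Real.dist_eq] using hsc, hs⟩⟩

/-- An increment bound of order above one says that the path is approximated by the integral of
zero. -/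
lemma eq_of_abs_sub_le_rpow {u : ℝ → ℝ} {a b C θ : ℝ} (hab : a ≤ b) (hθ : 1 < θ)
    (h : ∀ s t, a ≤ s → s ≤ t → t ≤ b → |u t - u s| ≤ C * (t - s) ^ θ) : u b = u a := by
  have h0 : HasRSIntegral (fun _ => (0 : ℝ)) (fun u => u) a b 0 := fun ε hε =>
    ⟨1, one_pos, fun n t ξ _ _ _ _ => by simpa using hε⟩
  have := sub_eq_sum_of_approx (d := 0) (Y := u) (f := fun _ _ => 0) (f₀ := fun _ => 0)
    (w := fun _ _ => 0) (I := fun _ => 0) hab hθ one_pos (fun s t h1 h2 h3 _ => by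
      simpa using h s t h1 h2 h3) (fun i => i.elim0) h0
  simp only [Finset.univ_eq_empty, Finset.sum_empty, add_zero] at this
  linarith

lemma norm_le_sum_abs (x : E p) : ‖x‖ ≤ ∑ i, |x i| := by
  have h : x = ∑ i, x i • EuclideanSpace.basisFun (Fin p) ℝ i := by
    conv_lhs => rw [← (EuclideanSpace.basisFun (Fin p) ℝ).sum_repr x]
    rfl
  calc ‖x‖ = ‖∑ i, x i • EuclideanSpace.basisFun (Fin p) ℝ i‖ := by rw [← h]
    _ ≤ ∑ i, |x i| := (norm_sum_le _ _).trans (le_of_eq (Finset.sum_congr rfl fun i _ => by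
        rw [norm_smul, (EuclideanSpace.basisFun (Fin p) ℝ).norm_eq_one, mul_one,
          Real.norm_eq_abs]))

/-- Solutions of the rough differential equation move in plaques and follow the Euler scheme. -/
theorem IsRDESolution.isLocalSolutionAt [LocallyCompactSpace Z] [TopologicalSpace.MetrizableSpace Z]
    [T2Space M] {V : Fin d → A.LeafVectorField} {V₀ : A.LeafVectorField}
    (hV : ∀ i, (V i).IsLeafwiseContDiff 3) (hα : 1 / 3 < α)
    {W : RoughPath α T d} {a b : ℝ} {m : M} {x : ℝ → M} (hx : IsRDESolution A V V₀ W a b m x)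
    {c : ℝ} (hc : c ∈ Icc a b) {φ : OpenPartialHomeomorph M (E p × Z)} (hφ : φ ∈ A.charts)
    (hxc : x c ∈ φ.source) : IsLocalSolutionAt V V₀ W a b x φ c := by
  let _ : MetricSpace Z := TopologicalSpace.metrizableSpaceMetric Z
  obtain ⟨hxcont, -, hxf⟩ := hx
  obtain ⟨B₁, B₂, r, hB₁, hB₂, ht, hr, hrB, hzB⟩ := FoliatedAtlas.exists_box hφ hxc
  set y₀ := (φ (x c)).1
  set z₀ := (φ (x c)).2
  obtain ⟨K₂, hK₂, hzK, hKB⟩ := exists_compact_subset hB₂ hzB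
  obtain ⟨ρ, hρ, hρK⟩ := Metric.mem_nhds_iff.1 (mem_interior_iff_mem_nhds.1 hzK)
  let χ : ContDiffBump y₀ := ⟨r, 2 * r, hr, by linarith⟩
  have hχ0 : ∀ y ∉ Metric.closedBall y₀ (2 * r), χ y = 0 := fun y hy => χ.zero_of_le_dist (by
    have : 2 * r < dist y y₀ := by simpa using hy
    exact this.le)
  have hχ1 : ∀ y ∈ Metric.ball y₀ r, χ y = 1 := fun y hy =>
    χ.one_of_mem_closedBall (Metric.ball_subset_closedBall hy)
  -- Equal to `1` within distance `ρ / 2` of `z₀` and to `0` from distance `ρ` on, hence off `K₂`.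
  set c₂ : Z → ℝ := fun z => max 0 (min 1 (2 - dist z z₀ / (ρ / 2))) with hc₂
  have hc₂c : Continuous c₂ := by fun_prop
  have hc₂0 : ∀ z ∉ K₂, c₂ z = 0 := by
    intro z hz
    have h1 : ρ ≤ dist z z₀ := not_lt.1 fun h => hz (hρK h)
    have h2 : 2 ≤ dist z z₀ / (ρ / 2) := by rw [le_div_iff₀ (by linarith)]; linarith
    simp only [hc₂]
    rw [max_eq_left]
    exact (min_le_right _ _).trans (by linarith)
  have hc₂1 : ∀ z ∈ Metric.ball z₀ (ρ / 2), c₂ z = 1 := by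
    intro z hz
    have h1 : dist z z₀ / (ρ / 2) ≤ 1 := by
      rw [div_le_one (by linarith)]; exact (Metric.mem_ball.1 hz).le
    simp only [hc₂]
    rw [min_eq_left (by linarith), max_eq_right zero_le_one]
  have hball : ∀ z ∈ Metric.ball z₀ (ρ / 2), ∀ y ∈ Metric.ball y₀ r, (y, z) ∈ φ.target := by
    intro z hz y hy
    rw [ht]
    exact ⟨hrB (Metric.ball_subset_closedBall (Metric.ball_subset_ball (by linarith) hy)),
      hKB (hρK (Metric.ball_subset_ball (by linarith) hz))⟩
  have hKt : Metric.closedBall y₀ (2 * r) ×ˢ K₂ ⊆ φ.target := ht ▸ prod_mono hrB hKB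
  have hf : ∀ i : Fin p, ∃ f : M → ℝ, (∀ k, A.LeafwiseContDiff k f) ∧
      ∀ q ∈ φ.target, f (φ.symm q) = χ q.1 * q.1 i * c₂ q.2 := fun i =>
    FoliatedAtlas.exists_leafwiseContDiff_extension hφ (isCompact_closedBall y₀ (2 * r)) hK₂ hKt
      (G := fun y => χ y * y i)
      (fun k => χ.contDiff.mul (EuclideanSpace.proj (𝕜 := ℝ) i).contDiff)
      (fun y hy => by simp [hχ0 y hy]) hc₂c hc₂0
  choose f hfs hfe using hf
  -- Near `x c` this test function is the transverse distance to `z₀`: locally constant along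
  -- plaques, so all its leafwise derivatives vanish, and zero only on the plaque of `x c`. The
  -- functions `f i` play the same role for the leaf coordinates.
  obtain ⟨h, hhs, hhe⟩ := FoliatedAtlas.exists_leafwiseContDiff_extension hφ
    (isCompact_closedBall y₀ (2 * r)) hK₂ hKt (G := fun y => χ y) (fun k => χ.contDiff) hχ0
    (c := fun z => c₂ z * dist z z₀) (by fun_prop) (fun z hz => by simp [hc₂0 z hz])
  have hVd : ∀ k, ∀ z ∈ Metric.ball z₀ (ρ / 2), ∀ y ∈ Metric.ball y₀ r,
      DifferentiableAt ℝ (fun y => (V k).inChart φ (y, z)) y := fun k z hz y hy =>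
    (hV k φ hφ).differentiableAt (q := (y, z)) (by norm_num) φ.open_target (hball z hz y hy)
  choose C hC using fun i => hxf (f i) (hfs i 3)
  obtain ⟨Ch, hCh⟩ := hxf h (hhs 3)
  obtain ⟨ε, hε, hεx⟩ := exists_pos_forall_mem hxcont hc (O := φ.source ∩
    φ ⁻¹' (Metric.ball y₀ r ×ˢ Metric.ball z₀ (ρ / 2)))
    ((φ.continuousOn.isOpen_inter_preimage φ.open_source
      (Metric.isOpen_ball.prod Metric.isOpen_ball)).mem_nhds
      ⟨hxc, Metric.mem_ball_self hr, Metric.mem_ball_self (by linarith)⟩)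
  have hz : ∀ s ∈ Icc a b, |s - c| < ε → (φ (x s)).2 = z₀ := by
    have key : ∀ s t, a ≤ s → s ≤ t → t ≤ b → |s - c| < ε → |t - c| < ε →
        |dist (φ (x t)).2 z₀ - dist (φ (x s)).2 z₀| ≤ Ch * (t - s) ^ (3 * α) := by
      intro s t h1 h2 h3 h4 h5
      obtain ⟨hss, hsy, hsz⟩ := hεx s ⟨h1, h2.trans h3⟩ h4
      obtain ⟨hts, hty, htz⟩ := hεx t ⟨h1.trans h2, h3⟩ h5
      have hval : ∀ m ∈ φ.source, φ m ∈ Metric.ball y₀ r ×ˢ Metric.ball z₀ (ρ / 2) →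
          h m = dist (φ m).2 z₀ := by
        rintro m hm ⟨hmy, hmz⟩
        have := hhe (φ m) (φ.map_source hm)
        rw [φ.left_inv hm, hχ1 _ hmy, hc₂1 _ hmz] at this
        simpa using this
      have hF : ∀ y ∈ Metric.ball y₀ r, h (φ.symm (y, (φ (x s)).2)) =
          (fun _ => dist (φ (x s)).2 z₀) y := by
        intro y hy
        rw [hhe _ (hball _ hsz y hy), hχ1 _ hy, hc₂1 _ hsz]
        simp
      have hd : ∀ (U : A.LeafVectorField), ∀ y ∈ Metric.ball y₀ r,
          U.deriv h (φ.symm (y, (φ (x s)).2)) = (fun _ => (0 : ℝ)) y := by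
        intro U y hy
        rw [FoliatedAtlas.deriv_eq_fderiv le_rfl (hhs 1) U hφ Metric.isOpen_ball (hball _ hsz) hF hy]
        simp
      have hxs : φ.symm ((φ (x s)).1, (φ (x s)).2) = x s := φ.left_inv hss
      have hd1 : ∀ U : A.LeafVectorField, U.deriv h (x s) = 0 := fun U => by
        rw [← hxs]; exact hd U _ hsy
      have hd2 : ∀ j k, (V j).deriv ((V k).deriv h) (x s) = 0 := by
        intro j k
        rw [← hxs, FoliatedAtlas.deriv_eq_fderiv le_rfl
          ((hhs 2).deriv ((hV k).of_le (by norm_num))) (V j) hφ Metric.isOpen_ball (hball _ hsz)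
          (hd (V k)) hsy]
        simp
      have := hCh s t h1 h2 h3
      simp only [hd1, hd2, hval _ hss ⟨hsy, hsz⟩, hval _ hts ⟨hty, htz⟩, zero_mul,
        Finset.sum_const_zero, add_zero, sub_zero] at this
      exact this
    intro s hs hsc
    have hcc : |c - c| < ε := by simpa using hε
    refine dist_eq_zero.1 ?_
    have hz0 : dist (φ (x c)).2 z₀ = 0 := dist_self _
    rw [← hz0]
    have habs : ∀ u, c ≤ u ∧ u ≤ s ∨ s ≤ u ∧ u ≤ c → |u - c| < ε := by
      intro u hu
      rw [abs_lt] at hsc ⊢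
      rcases hu with hu | hu <;> constructor <;> linarith [hu.1, hu.2]
    rcases le_total c s with hcs | hcs
    · exact eq_of_abs_sub_le_rpow hcs (by linarith) fun u v hu huv hv =>
        key u v (hc.1.trans hu) huv (hv.trans hs.2) (habs u (Or.inl ⟨hu, huv.trans hv⟩))
          (habs v (Or.inl ⟨hu.trans huv, hv⟩))
    · exact (eq_of_abs_sub_le_rpow hcs (by linarith) fun u v hu huv hv =>
        key u v (hs.1.trans hu) huv (hv.trans hc.2) (habs u (Or.inr ⟨hu, huv.trans hv⟩))
          (habs v (Or.inr ⟨hu.trans huv, hv⟩))).symm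
  refine ⟨ε, hε, ∑ i, C i, fun s t h1 h2 h3 h4 h5 => ?_⟩
  obtain ⟨hss, hsy, hsz⟩ := hεx s ⟨h1, h2.trans h3⟩ h4
  obtain ⟨hts, hty, htz⟩ := hεx t ⟨h1.trans h2, h3⟩ h5
  refine ⟨hss, hts, by rw [hz s ⟨h1, h2.trans h3⟩ h4, hz t ⟨h1.trans h2, h3⟩ h5], ?_⟩
  refine (norm_le_sum_abs _).trans ?_
  rw [Finset.sum_mul]
  refine Finset.sum_le_sum fun i _ => ?_
  refine le_trans (le_of_eq ?_) (hC i s t h1 h2 h3)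
  set z := (φ (x s)).2 with hzdef
  have hval : ∀ m ∈ φ.source, φ m ∈ Metric.ball y₀ r ×ˢ Metric.ball z₀ (ρ / 2) →
      f i m = (φ m).1 i := by
    rintro m hm ⟨hmy, hmz⟩
    have := hfe i (φ m) (φ.map_source hm)
    rw [φ.left_inv hm, hχ1 _ hmy, hc₂1 _ hmz] at this
    simpa using this
  have hF : ∀ y ∈ Metric.ball y₀ r, f i (φ.symm (y, z)) =
      EuclideanSpace.proj (𝕜 := ℝ) i y := by
    intro y hy
    rw [hfe i _ (hball _ hsz y hy), hχ1 _ hy, hc₂1 _ hsz]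
    simp
  have hd : ∀ (U : A.LeafVectorField), ∀ y ∈ Metric.ball y₀ r,
      U.deriv (f i) (φ.symm (y, z)) = EuclideanSpace.proj (𝕜 := ℝ) i (U.inChart φ (y, z)) := by
    intro U y hy
    rw [FoliatedAtlas.deriv_eq_fderiv le_rfl (hfs i 1) U hφ Metric.isOpen_ball (hball _ hsz) hF hy,
      ContinuousLinearMap.fderiv]
  have hxs : φ.symm ((φ (x s)).1, z) = x s := φ.left_inv hss
  have hd1 : ∀ U : A.LeafVectorField, U.deriv (f i) (x s) = U.inChart φ ((φ (x s)).1, z) i :=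
    fun U => by
      have e := hd U _ hsy
      rw [hxs] at e
      exact e
  have hd2 : ∀ j k, (V j).deriv ((V k).deriv (f i)) (x s) =
      secondField (chartFields V φ z) j k (φ (x s)).1 i := by
    intro j k
    have e1 := FoliatedAtlas.deriv_eq_fderiv le_rfl
      ((hfs i 2).deriv ((hV k).of_le (by norm_num))) (V j) hφ Metric.isOpen_ball (hball _ hsz)
      (hd (V k)) hsy
    rw [hxs] at e1
    have e2 := ((EuclideanSpace.proj (𝕜 := ℝ) i).hasFDerivAt.comp (φ (x s)).1
      (hVd k z hsz _ hsy).hasFDerivAt).fderiv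
    have e3 : (fun y => EuclideanSpace.proj (𝕜 := ℝ) i ((V k).inChart φ (y, z))) =
      (EuclideanSpace.proj (𝕜 := ℝ) i) ∘ fun y => (V k).inChart φ (y, z) := rfl
    rw [e1, e3, e2]
    rfl
  rw [hval _ hss ⟨hsy, hsz⟩, hval _ hts ⟨hty, htz⟩]
  simp only [hd1, hd2, roughIncr, eulerIncr, driven, PiLp.sub_apply, PiLp.add_apply,
    WithLp.ofLp_sum, Finset.sum_apply, PiLp.smul_apply, smul_eq_mul, chartFields,
    mul_comm (W.fst s t _), mul_comm (W.snd s t _), mul_comm (t - s)]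
  congr 1
  ring

end LocalSolutions

/-! ### From local Euler estimates to the global definition of a solution -/

section LocalToGlobal

/-- Compactness is applied to the left endpoint `s` alone; halving `ε` keeps `t` inside the
neighbourhood that controls `s`. -/
lemma exists_uniform_of_local {Φ : ℝ → ℝ → ℝ} {a b θ : ℝ}
    (h : ∀ c ∈ Icc a b, ∃ ε > 0, ∃ C : ℝ, ∀ s t, a ≤ s → s ≤ t → t ≤ b → |s - c| < ε →
      |t - c| < ε → Φ s t ≤ C * (t - s) ^ θ) :
    ∃ δ > 0, ∃ C, 0 ≤ C ∧ ∀ s t, a ≤ s → s ≤ t → t ≤ b → t - s < δ → Φ s t ≤ C * (t - s) ^ θ := by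
  have key : ∃ δ > 0, ∃ C, 0 ≤ C ∧ ∀ s ∈ Icc a b, ∀ t, a ≤ s → s ≤ t → t ≤ b → t - s < δ →
      Φ s t ≤ C * (t - s) ^ θ := by
    refine isCompact_Icc.induction_on (p := fun S => ∃ δ > 0, ∃ C, 0 ≤ C ∧ ∀ s ∈ S, ∀ t,
      a ≤ s → s ≤ t → t ≤ b → t - s < δ → Φ s t ≤ C * (t - s) ^ θ) ?_ ?_ ?_ ?_
    · exact ⟨1, one_pos, 0, le_rfl, fun s hs => hs.elim⟩
    · rintro S S' hS ⟨δ, hδ, C, hC, hh⟩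
      exact ⟨δ, hδ, C, hC, fun s hs => hh s (hS hs)⟩
    · rintro S S' ⟨δ, hδ, C, hC, hh⟩ ⟨δ', hδ', C', hC', hh'⟩
      refine ⟨min δ δ', lt_min hδ hδ', C + C', by positivity, fun s hs t h1 h2 h3 h4 => ?_⟩
      have hp : 0 ≤ (t - s) ^ θ := Real.rpow_nonneg (by linarith) _
      rcases hs with hs | hs
      · refine (hh s hs t h1 h2 h3 (h4.trans_le (min_le_left _ _))).trans ?_
        gcongr; linarith
      · refine (hh' s hs t h1 h2 h3 (h4.trans_le (min_le_right _ _))).trans ?_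
        gcongr; linarith
    · intro c hc
      obtain ⟨ε, hε, C, hC⟩ := h c hc
      refine ⟨Metric.ball c (ε / 2), mem_nhdsWithin_of_mem_nhds
        (Metric.ball_mem_nhds c (by linarith)), ε / 2, by linarith, |C|, abs_nonneg C,
        fun s hs t h1 h2 h3 h4 => ?_⟩
      have hsc : |s - c| < ε / 2 := by simpa [Real.dist_eq] using hs
      have htc : |t - c| < ε := by rw [abs_lt] at hsc ⊢; constructor <;> linarith [hsc.1, hsc.2]
      refine (hC s t h1 h2 h3 (by linarith) htc).trans ?_
      have hp : 0 ≤ (t - s) ^ θ := Real.rpow_nonneg (by linarith) _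
      gcongr
      exact le_abs_self C
  obtain ⟨δ, hδ, C, hC, hh⟩ := key
  exact ⟨δ, hδ, C, hC, fun s t h1 h2 h3 => hh s ⟨h1, h2.trans h3⟩ t h1 h2 h3⟩

/-- Pairs with `t - s ≥ δ` are covered by the crude bound `B`, at the price of a constant `|B| / δ ^
θ`. -/
lemma exists_global_of_local {Φ : ℝ → ℝ → ℝ} {a b θ B : ℝ} (hθ : 0 ≤ θ)
    (hB : ∀ s t, a ≤ s → s ≤ t → t ≤ b → Φ s t ≤ B)
    (h : ∀ c ∈ Icc a b, ∃ ε > 0, ∃ C : ℝ, ∀ s t, a ≤ s → s ≤ t → t ≤ b → |s - c| < ε →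
      |t - c| < ε → Φ s t ≤ C * (t - s) ^ θ) :
    ∃ C, ∀ s t, a ≤ s → s ≤ t → t ≤ b → Φ s t ≤ C * (t - s) ^ θ := by
  obtain ⟨δ, hδ, C, hC, hh⟩ := exists_uniform_of_local h
  refine ⟨C + |B| / δ ^ θ, fun s t h1 h2 h3 => ?_⟩
  have hp : 0 ≤ (t - s) ^ θ := Real.rpow_nonneg (by linarith) _
  have hδθ : 0 < δ ^ θ := Real.rpow_pos_of_pos hδ θ
  rcases lt_or_ge (t - s) δ with hlt | hge
  · refine (hh s t h1 h2 h3 hlt).trans ?_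
    gcongr
    have : 0 ≤ |B| / δ ^ θ := by positivity
    linarith
  · calc Φ s t ≤ |B| := (hB s t h1 h2 h3).trans (le_abs_self B)
      _ = |B| / δ ^ θ * δ ^ θ := by field_simp
      _ ≤ |B| / δ ^ θ * (t - s) ^ θ := by gcongr
      _ ≤ _ := by gcongr; linarith

variable {p d : ℕ} {Z M : Type*} [TopologicalSpace Z] [TopologicalSpace M]
  {A : FoliatedAtlas p Z M} {α T : ℝ}

lemma BddFields.mono {X : Type*} [NormedAddCommGroup X] [NormedSpace ℝ X] {L L' : ℝ}
    {v : Fin d → X → X} {v₀ : X → X} (h : BddFields L v v₀) (hL : L ≤ L') : BddFields L' v v₀ :=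
  ⟨h.diff, h.diff_fderiv, h.diff_zero, fun i => (h.bdd i).mono hL,
    fun i => (h.bdd_fderiv i).mono hL, fun i => (h.bdd_fderiv_fderiv i).mono hL,
    h.bdd_zero.mono hL, h.bdd_zero_fderiv.mono hL⟩

lemma isCompact_triangle (a b : ℝ) : IsCompact {q : ℝ × ℝ | a ≤ q.1 ∧ q.1 ≤ q.2 ∧ q.2 ≤ b} := by
  refine (isCompact_Icc.prod isCompact_Icc : IsCompact (Icc a b ×ˢ Icc a b)).of_isClosed_subset
    ?_ fun q hq => ⟨⟨hq.1, hq.2.1.trans hq.2.2⟩, hq.1.trans hq.2.1, hq.2.2⟩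
  exact (isClosed_le continuous_const continuous_fst).inter
    ((isClosed_le continuous_fst continuous_snd).inter
      (isClosed_le continuous_snd continuous_const))

lemma roughIncr_chartFields {W : RoughPath α T d} {V : Fin d → A.LeafVectorField}
    {V₀ : A.LeafVectorField} {φ : OpenPartialHomeomorph M (E p × Z)} {z : Z} {O : Set (E p)}
    (hO : IsOpen O) {v : Fin d → E p → E p} {v₀ : E p → E p}
    (hv : ∀ y ∈ O, (∀ i, v i y = (V i).inChart φ (y, z)) ∧ v₀ y = V₀.inChart φ (y, z))
    {y : E p} (hy : y ∈ O) (s t : ℝ) :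
    roughIncr W (chartFields V φ z) (fun y => V₀.inChart φ (y, z)) s t y =
      roughIncr W v v₀ s t y :=
  roughIncr_congr W (fun i => by
    filter_upwards [hO.mem_nhds hy] with y' hy' using ((hv y' hy').1 i).symm) (hv y hy).2.symm s t

/-- A path that locally follows the Euler scheme solves the rough differential equation. -/
theorem isRDESolution_of_isLocalSolutionAt {V : Fin d → A.LeafVectorField}
    {V₀ : A.LeafVectorField}
    (hV : ∀ i, (V i).IsLeafwiseContDiff 3) (hV₀ : V₀.IsLeafwiseContDiff 3) (hα : 1 / 3 < α)
    (hα' : α < 1 / 2) {W : RoughPath α T d} (hW : W.IsGeometric) {a b : ℝ} (ha : 0 ≤ a)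
    (hb : b ≤ T) {m : M} {x : ℝ → M} (hx : ContinuousOn x (Icc a b)) (hxa : x a = m)
    (hloc : ∀ c ∈ Icc a b, ∃ φ ∈ A.charts, x c ∈ φ.source ∧
      IsLocalSolutionAt V V₀ W a b x φ c) : IsRDESolution A V V₀ W a b m x := by
  refine ⟨hx, hxa, fun f hf => ?_⟩
  have hVf : ∀ i, A.LeafwiseContDiff 2 ((V i).deriv f) := fun i =>
    hf.deriv ((hV i).of_le (by norm_num))
  have hVVf : ∀ j k, A.LeafwiseContDiff 1 ((V j).deriv ((V k).deriv f)) := fun j k =>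
    (hVf k).deriv ((hV j).of_le (by norm_num))
  have hV₀f : A.LeafwiseContDiff 2 (V₀.deriv f) := hf.deriv (hV₀.of_le (by norm_num))
  obtain ⟨B, hB⟩ : ∃ B, ∀ q ∈ {q : ℝ × ℝ | a ≤ q.1 ∧ q.1 ≤ q.2 ∧ q.2 ≤ b},
      ‖f (x q.2) - f (x q.1) - (∑ i, (V i).deriv f (x q.1) * W.fst q.1 q.2 i +
        ∑ j, ∑ k, (V j).deriv ((V k).deriv f) (x q.1) * W.snd q.1 q.2 (j, k) +
        V₀.deriv f (x q.1) * (q.2 - q.1))‖ ≤ B := by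
    refine (isCompact_triangle a b).exists_bound_of_continuousOn ?_
    have hm : {q : ℝ × ℝ | a ≤ q.1 ∧ q.1 ≤ q.2 ∧ q.2 ≤ b} ⊆ simplex T :=
      fun q hq => ⟨ha.trans hq.1, hq.2.1, hq.2.2.trans hb⟩
    have x1 : ContinuousOn (fun q : ℝ × ℝ => x q.1) {q | a ≤ q.1 ∧ q.1 ≤ q.2 ∧ q.2 ≤ b} :=
      hx.comp continuous_fst.continuousOn fun q hq => ⟨hq.1, hq.2.1.trans hq.2.2⟩
    have x2 : ContinuousOn (fun q : ℝ × ℝ => x q.2) {q | a ≤ q.1 ∧ q.1 ≤ q.2 ∧ q.2 ≤ b} :=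
      hx.comp continuous_snd.continuousOn fun q hq => ⟨hq.1.trans hq.2.1, hq.2.2⟩
    refine ((hf.continuous.comp_continuousOn x2).sub (hf.continuous.comp_continuousOn x1)).sub
      (((continuousOn_finsetSum _ fun i _ => ?_).add
        (continuousOn_finsetSum _ fun j _ => continuousOn_finsetSum _ fun k _ => ?_)).add ?_)
    · exact ((hVf i).continuous.comp_continuousOn x1).mul
        ((PiLp.continuous_apply 2 _ i).comp_continuousOn (W.continuousOn_fst.mono hm))
    · exact ((hVVf j k).continuous.comp_continuousOn x1).mul
        ((PiLp.continuous_apply 2 _ (j, k)).comp_continuousOn (W.continuousOn_snd.mono hm))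
    · exact (hV₀f.continuous.comp_continuousOn x1).mul
        (continuous_snd.sub continuous_fst).continuousOn
  refine exists_global_of_local (B := B) (Φ := fun s t => |f (x t) - f (x s)
        - (∑ i, (V i).deriv f (x s) * W.fst s t i
          + ∑ j, ∑ k, (V j).deriv ((V k).deriv f) (x s) * W.snd s t (j, k)
          + V₀.deriv f (x s) * (t - s))|) (by linarith)
    (fun s t h1 h2 h3 => hB (s, t) ⟨h1, h2, h3⟩) fun c hc => ?_
  obtain ⟨φ, hφ, hxc, ε₁, hε₁, C, hC⟩ := hloc c hc
  obtain ⟨B₁, B₂, r, hB₁, hB₂, ht, hr, hrB, hzB⟩ := FoliatedAtlas.exists_box hφ hxc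
  set y₀ := (φ (x c)).1
  set z₀ := (φ (x c)).2 with hz₀
  obtain ⟨L₁, hL₁⟩ := exists_bddFields hV hV₀ hφ hB₁ hB₂ ht hr hrB isCompact_singleton
    (singleton_subset_iff.2 hzB)
  obtain ⟨v, v₀, hvb, hv⟩ := hL₁ z₀ rfl
  obtain ⟨L₂, hL₂⟩ := (ht ▸ hf φ hφ).exists_cutoff hB₁ hB₂ hr hrB isCompact_singleton
    (singleton_subset_iff.2 hzB)
  obtain ⟨F, hF, hFe⟩ := hL₂ z₀ rfl
  have hF' := hF.mono (le_max_right L₁ L₂)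
  obtain ⟨H, hH, hWb⟩ := W.exists_bound (by linarith) hα'
  obtain ⟨C', hC'⟩ := (hvb.mono (le_max_left L₁ L₂)).chain_rule hF'.diff hF'.diff_fderiv
    hF'.bdd_fderiv hF'.bdd_fderiv_fderiv hH (abs_nonneg C)
  obtain ⟨ε₂, hε₂, hεx⟩ := exists_pos_forall_mem hx hc (O := φ.source ∩
    φ ⁻¹' (Metric.ball y₀ r ×ˢ univ))
    ((φ.continuousOn.isOpen_inter_preimage φ.open_source
      (Metric.isOpen_ball.prod isOpen_univ)).mem_nhds
      ⟨hxc, Metric.mem_ball_self hr, mem_univ _⟩)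
  refine ⟨min (min ε₁ ε₂) (1 / 2), by positivity, C', fun s t h1 h2 h3 h4 h5 => ?_⟩
  rw [lt_min_iff, lt_min_iff] at h4 h5
  obtain ⟨⟨h4, h4'⟩, h4''⟩ := h4
  obtain ⟨⟨h5, h5'⟩, h5''⟩ := h5
  have hts : t - s ≤ 1 := by rw [abs_lt] at h4'' h5''; linarith [h4''.1, h5''.2]
  obtain ⟨hss, hsy, -⟩ := hεx s ⟨h1, h2.trans h3⟩ h4'
  obtain ⟨hts', hty, -⟩ := hεx t ⟨h1.trans h2, h3⟩ h5'
  obtain ⟨-, -, hzz, hest⟩ := hC s t h1 h2 h3 h4 h5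
  have hcc : |c - c| < ε₁ := by simpa using hε₁
  have hzs : (φ (x s)).2 = z₀ := by
    rcases le_total c s with hcs | hcs
    · exact (hC c s hc.1 hcs (h2.trans h3) hcc h4).2.2.1
    · exact (hC s c h1 hcs hc.2 h4 hcc).2.2.1.symm
  have hzt : (φ (x t)).2 = z₀ := hzz.trans hzs
  have hball : ∀ y ∈ Metric.ball y₀ r, (y, z₀) ∈ φ.target := by
    intro y hy
    rw [ht]
    exact ⟨hrB (Metric.ball_subset_closedBall (Metric.ball_subset_ball (by linarith) hy)), hzB⟩
  rw [hzs, roughIncr_chartFields Metric.isOpen_ball hv hsy] at hest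
  have hxs : φ.symm ((φ (x s)).1, z₀) = x s := by rw [← hzs]; exact φ.left_inv hss
  have hxt : φ.symm ((φ (x t)).1, z₀) = x t := by rw [← hzt]; exact φ.left_inv hts'
  have hFe' : ∀ y ∈ Metric.ball y₀ r, f (φ.symm (y, z₀)) = F y := fun y hy => (hFe y hy).symm
  have hd : ∀ k, ∀ y ∈ Metric.ball y₀ r,
      (V k).deriv f (φ.symm (y, z₀)) = fderiv ℝ F y (v k y) := by
    intro k y hy
    rw [FoliatedAtlas.deriv_eq_fderiv (by norm_num) hf (V k) hφ Metric.isOpen_ball hball hFe' hy,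
      (hv y hy).1 k]
  have e1 : ∀ i, (V i).deriv f (x s) = fderiv ℝ F (φ (x s)).1 (v i (φ (x s)).1) := fun i => by
    have := hd i _ hsy
    rwa [hxs] at this
  have e0 : V₀.deriv f (x s) = fderiv ℝ F (φ (x s)).1 (v₀ (φ (x s)).1) := by
    have := FoliatedAtlas.deriv_eq_fderiv (by norm_num) hf V₀ hφ Metric.isOpen_ball hball hFe' hsy
    rwa [← (hv _ hsy).2, hxs] at this
  have e2 : ∀ j k, (V j).deriv ((V k).deriv f) (x s) =
      fderiv ℝ (fun y => fderiv ℝ F y (v k y)) (φ (x s)).1 (v j (φ (x s)).1) := by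
    intro j k
    have := FoliatedAtlas.deriv_eq_fderiv (by norm_num) (hVf k) (V j) hφ Metric.isOpen_ball hball
      (hd k) hsy
    rwa [← (hv _ hsy).1 j, hxs] at this
  obtain ⟨w1, w2, w3⟩ := hWb s t (ha.trans h1) h2 (h3.trans hb) hts
  have hcube : ((t - s) ^ α) ^ 3 = (t - s) ^ (3 * α) := by
    rw [mul_comm 3 α, Real.rpow_mul (by linarith)]; norm_cast
  have hp : 0 ≤ (t - s) ^ (3 * α) := Real.rpow_nonneg (by linarith) _
  -- The chain rule with `η = (t - s) ^ α`; its symmetry hypothesis is supplied by geometricity of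
  -- `W`.
  have hfin := hC' (fun i => W.fst s t i) (fun j k => W.snd s t (j, k)) (t - s) ((t - s) ^ α)
    (Real.rpow_nonneg (by linarith) _) (Real.rpow_le_one (by linarith) hts (by linarith))
    w1 w2 w3 (fun j k => hW.symm (ha.trans h1) h2 (h3.trans hb) j k) (φ (x s)).1 (φ (x t)).1 (by
      rw [hcube]
      refine hest.trans ?_
      gcongr
      exact le_abs_self C)
  rw [hcube, ← hFe' _ hsy, ← hFe' _ hty, hxs, hxt] at hfin
  refine le_trans (le_of_eq ?_) hfin
  simp only [driven, smul_eq_mul, e1, e2, e0, mul_comm (W.fst s t _), mul_comm (W.snd s t _),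
    mul_comm (t - s)]

end LocalToGlobal

/-! ### Existence and uniqueness for the rough equation -/

section ExistenceUniqueness

variable {p d : ℕ} {Z M : Type*} [TopologicalSpace Z] [TopologicalSpace M]
  {A : FoliatedAtlas p Z M} {α T : ℝ} {V : Fin d → A.LeafVectorField} {V₀ : A.LeafVectorField}
  {W : RoughPath α T d}

lemma le_mul_rpow_of_le {x C C' s t θ : ℝ} (hst : s ≤ t) (h : x ≤ C * (t - s) ^ θ) (hC : C ≤ C') :
    x ≤ C' * (t - s) ^ θ := by
  have hp : 0 ≤ (t - s) ^ θ := Real.rpow_nonneg (by linarith) _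
  exact h.trans (by gcongr)

/-- Solutions of the rough differential equation are unique. -/
theorem IsRDESolution.eqOn [LocallyCompactSpace Z] [TopologicalSpace.MetrizableSpace Z]
    [T2Space M] (hV : ∀ i, (V i).IsLeafwiseContDiff 3) (hV₀ : V₀.IsLeafwiseContDiff 3)
    (hα : 1 / 3 < α) (hα' : α < 1 / 2) {a b : ℝ} (ha : 0 ≤ a) (hb : b ≤ T) {m : M} {x y : ℝ → M}
    (hx : IsRDESolution A V V₀ W a b m x) (hy : IsRDESolution A V V₀ W a b m y) :
    EqOn y x (Icc a b) := by
  rcases lt_or_ge b a with hba | hab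
  · rw [Icc_eq_empty (not_le.2 hba)]; exact eqOn_empty _ _
  have hcl : IsClosed ({t | y t = x t} ∩ Icc a b) := by
    have := (hy.1.prodMk hx.1).preimage_isClosed_of_isClosed isClosed_Icc isClosed_diagonal
    rw [inter_comm]
    exact this
  -- The coincidence set is closed and contains `a`, so agreement has only to be continued a little
  -- to the right of each of its points.
  refine hcl.Icc_subset_of_forall_mem_nhdsWithin (hy.2.1.trans hx.2.1.symm) ?_
  rintro c ⟨hyx, hac, hcb⟩
  have hyx : y c = x c := hyx
  obtain ⟨φ, hφ, hxc⟩ := A.cover (x c)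
  have hc : c ∈ Icc a b := ⟨hac, hcb.le⟩
  obtain ⟨ε₁, hε₁, C₁, hC₁⟩ := hx.isLocalSolutionAt hV hα hc hφ hxc
  obtain ⟨ε₂, hε₂, C₂, hC₂⟩ := hy.isLocalSolutionAt hV hα hc hφ (hyx ▸ hxc)
  obtain ⟨B₁, B₂, r, hB₁, hB₂, ht, hr, hrB, hzB⟩ := FoliatedAtlas.exists_box hφ hxc
  set y₀ := (φ (x c)).1
  set z₀ := (φ (x c)).2 with hz₀
  obtain ⟨L, hL⟩ := exists_bddFields hV hV₀ hφ hB₁ hB₂ ht hr hrB isCompact_singleton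
    (singleton_subset_iff.2 hzB)
  obtain ⟨v, v₀, hvb, hv⟩ := hL z₀ rfl
  obtain ⟨K, hK, hflow⟩ := BddFields.exists_isAlmostFlow (X := E p) W (by linarith) hα' L
    hvb.nonneg
  have hO : φ.source ∩ φ ⁻¹' (Metric.ball y₀ r ×ˢ univ) ∈ 𝓝 (x c) :=
    (φ.continuousOn.isOpen_inter_preimage φ.open_source
      (Metric.isOpen_ball.prod isOpen_univ)).mem_nhds
      ⟨hxc, Metric.mem_ball_self hr, mem_univ _⟩
  obtain ⟨ε₃, hε₃, hε₃x⟩ := exists_pos_forall_mem hx.1 hc hO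
  obtain ⟨ε₄, hε₄, hε₄y⟩ := exists_pos_forall_mem hy.1 hc (hyx ▸ hO)
  set ε := min (min ε₁ ε₂) (min ε₃ ε₄) with hε
  have hε0 : 0 < ε := by positivity
  set b' := min b (c + min 1 (ε / 2)) with hb'
  have hcb' : c < b' := lt_min hcb (by linarith [lt_min one_pos (half_pos hε0)])
  have hb'b : b' ≤ b := min_le_left _ _
  have hb'1 : b' - c ≤ 1 := by
    have := min_le_right b (c + min 1 (ε / 2))
    have := min_le_left 1 (ε / 2)
    linarith
  have hb'ε : ∀ t, c ≤ t → t ≤ b' → |t - c| < ε := by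
    intro t h1 h2
    have := min_le_right b (c + min 1 (ε / 2))
    have := min_le_right 1 (ε / 2)
    rw [abs_of_nonneg (by linarith)]
    linarith
  have hεle : ε ≤ ε₁ ∧ ε ≤ ε₂ ∧ ε ≤ ε₃ ∧ ε ≤ ε₄ := by simp [hε]
  have hS := hflow v v₀ hvb c b' (ha.trans hac) (hb'b.trans hb) hb'1
  have key : ∀ (u : ℝ → M) (e C : ℝ), u c = x c → ε ≤ e → (∀ t ∈ Icc a b, |t - c| < ε →
      u t ∈ φ.source ∩ φ ⁻¹' (Metric.ball y₀ r ×ˢ univ)) →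
      (∀ s t, a ≤ s → s ≤ t → t ≤ b → |s - c| < e → |t - c| < e →
        u s ∈ φ.source ∧ u t ∈ φ.source ∧ (φ (u t)).2 = (φ (u s)).2 ∧
        ‖(φ (u t)).1 - ((φ (u s)).1 + roughIncr W (chartFields V φ (φ (u s)).2)
        (fun y => V₀.inChart φ (y, (φ (u s)).2)) s t (φ (u s)).1)‖ ≤ C * (t - s) ^ (3 * α)) →
      (∀ t, c ≤ t → t ≤ b' → u t ∈ φ.source ∧ (φ (u t)).2 = z₀) ∧
      ∀ s t, c ≤ s → s ≤ t → t ≤ b' →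
        ‖(φ (u t)).1 - ((φ (u s)).1 + roughIncr W v v₀ s t (φ (u s)).1)‖ ≤
          C * (t - s) ^ (3 * α) := by
    intro u e C huc he hmem hest
    have hz : ∀ t, c ≤ t → t ≤ b' → u t ∈ φ.source ∧ (φ (u t)).2 = z₀ := by
      intro t h1 h2
      have := hest c t hac h1 (h2.trans hb'b) (by simpa using hε0.trans_le he)
        ((hb'ε t h1 h2).trans_le he)
      exact ⟨this.2.1, this.2.2.1.trans (by rw [huc])⟩
    refine ⟨hz, fun s t h1 h2 h3 => ?_⟩
    have h4 := hest s t (hac.trans h1) h2 (h3.trans hb'b)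
      ((hb'ε s h1 (h2.trans h3)).trans_le he) ((hb'ε t (h1.trans h2) h3).trans_le he)
    have hsy := (hmem s ⟨hac.trans h1, (h2.trans h3).trans hb'b⟩ (hb'ε s h1 (h2.trans h3))).2.1
    rw [(hz s h1 (h2.trans h3)).2, roughIncr_chartFields Metric.isOpen_ball hv hsy] at h4
    exact h4.2.2.2
  obtain ⟨hxz, hxe⟩ := key x ε₁ C₁ rfl hεle.1 (fun t ht h => hε₃x t ht (h.trans_le hεle.2.2.1)) hC₁
  obtain ⟨hyz, hye⟩ := key y ε₂ C₂ hyx hεle.2.1 (fun t ht h => hε₄y t ht (h.trans_le hεle.2.2.2)) hC₂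
  obtain ⟨h, hh, heq⟩ := hS.unique hα hK (x := fun t => (φ (x t)).1) (y := fun t => (φ (y t)).1)
    (C := max C₁ C₂)
    (fun s t h1 h2 h3 => le_mul_rpow_of_le h2 (hxe s t h1 h2 h3) (le_max_left _ _))
    (fun s t h1 h2 h3 => le_mul_rpow_of_le h2 (hye s t h1 h2 h3) (le_max_right _ _))
    (by simp only [hyx])
  refine Filter.mem_of_superset (Ioo_mem_nhdsGT (lt_min hcb' (by linarith : c < c + h))) ?_
  rintro t ⟨h1, h2⟩
  rw [lt_min_iff] at h2
  have e1 := heq t h1.le h2.1.le h2.2.le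
  obtain ⟨s1, z1⟩ := hxz t h1.le h2.1.le
  obtain ⟨s2, z2⟩ := hyz t h1.le h2.1.le
  exact φ.injOn s2 s1 (Prod.ext e1.symm (z2.trans z1.symm))

lemma continuousOn_of_norm_sub_le_rpow {X : Type*} [NormedAddCommGroup X] {y : ℝ → X}
    {a b C β : ℝ} (hβ : 0 < β)
    (h : ∀ s t, a ≤ s → s ≤ t → t ≤ b → ‖y t - y s‖ ≤ C * (t - s) ^ β) :
    ContinuousOn y (Icc a b) := by
  refine Metric.continuousOn_iff.2 fun t ht ε hε => ?_
  obtain ⟨δ, hδ, -, hδ'⟩ := exists_pos_rpow_le hβ (ε := ε / (2 * (|C| + 1))) (by positivity)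
  refine ⟨δ, hδ, fun s hs hst => ?_⟩
  rw [Real.dist_eq] at hst
  have key : ‖y s - y t‖ ≤ |C| * |s - t| ^ β := by
    rcases le_total s t with hle | hle
    · have := h s t hs.1 hle ht.2
      rw [norm_sub_rev, abs_sub_comm, abs_of_nonneg (a := t - s) (by linarith)]
      exact le_mul_rpow_of_le hle this (le_abs_self C)
    · have := h t s ht.1 hle hs.2
      rw [abs_of_nonneg (a := s - t) (by linarith)]
      exact le_mul_rpow_of_le hle this (le_abs_self C)
  rw [dist_eq_norm]
  calc ‖y s - y t‖ ≤ |C| * |s - t| ^ β := key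
    _ ≤ (|C| + 1) * (ε / (2 * (|C| + 1))) := by
        gcongr
        · linarith
        · exact hδ' _ (abs_nonneg _) hst.le
    _ = ε / 2 := by field_simp
    _ < ε := by linarith

/-- Locally, solutions exist for a uniform time. -/
lemma exists_local_solution [LocallyCompactSpace Z]
    (hV : ∀ i, (V i).IsLeafwiseContDiff 3) (hV₀ : V₀.IsLeafwiseContDiff 3)
    (hα : 1 / 3 < α) (hα' : α < 1 / 2) (hW : W.IsGeometric) (m₀ : M) :
    ∃ N ∈ 𝓝 m₀, ∃ τ > 0, ∀ m ∈ N, ∀ c c', 0 ≤ c → c < c' → c' ≤ T → c' - c ≤ τ →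
      ∃ x : ℝ → M, IsRDESolution A V V₀ W c c' m x := by
  obtain ⟨φ, hφ, hm₀⟩ := A.cover m₀
  obtain ⟨B₁, B₂, r, hB₁, hB₂, ht, hr, hrB, hzB⟩ := FoliatedAtlas.exists_box hφ hm₀
  set y₀ := (φ m₀).1
  set z₀ := (φ m₀).2 with hz₀
  obtain ⟨K₂, hK₂, hzK, hKB⟩ := exists_compact_subset hB₂ hzB
  obtain ⟨L, hL⟩ := exists_bddFields hV hV₀ hφ hB₁ hB₂ ht hr hrB hK₂ hKB
  have hL0 : 0 ≤ L := by
    obtain ⟨v, v₀, hvb, -⟩ := hL z₀ (interior_subset hzK)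
    exact hvb.nonneg
  obtain ⟨K, hK, hflow⟩ := BddFields.exists_isAlmostFlow (X := E p) W (by linarith) hα' L hL0
  set κ : ℝ := (2 / 3) ^ (3 * α - 1) with hκ
  have hκ1 : κ < 1 := two_thirds_rpow_lt_one (by linarith)
  have hκ0 : 0 ≤ κ := by positivity
  set κ' : ℝ := (1 + κ) / 2 with hκ'
  have hκ'1 : κ' < 1 := by linarith
  set K₁ := K / (1 - κ') with hK₁
  have hK₁0 : 0 ≤ K₁ := div_nonneg hK (by linarith)
  -- The first bound gives `κ * (1 + K * (c' - c) ^ α) ≤ κ'`, as the existence lemma requires. The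
  -- second limits the displacement to `r / 4`, so a path from the ball of radius `r / 2` stays
  -- where the cut-off fields are the true ones.
  obtain ⟨τ₁, hτ₁, hτ₁1, hτ₁'⟩ := exists_pos_rpow_le (β := α) (by linarith)
    (ε := min ((1 - κ) / 2 / (K + 1)) (r / 4 / (K + K₁ + 1)))
    (lt_min (div_pos (by linarith) (by linarith)) (by positivity))
  refine ⟨φ.source ∩ φ ⁻¹' (Metric.ball y₀ (r / 2) ×ˢ interior K₂),
    (φ.continuousOn.isOpen_inter_preimage φ.open_source
      (Metric.isOpen_ball.prod isOpen_interior)).mem_nhds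
      ⟨hm₀, Metric.mem_ball_self (by linarith), hzK⟩, τ₁, hτ₁, ?_⟩
  rintro m ⟨hm, hmy, hmz⟩ c c' hc hcc' hc'T hτ
  set z := (φ m).2 with hz
  obtain ⟨v, v₀, hvb, hv⟩ := hL z (interior_subset hmz)
  have hS := hflow v v₀ hvb c c' hc hc'T (hτ.trans hτ₁1)
  have hsm := hτ₁' (c' - c) (by linarith) hτ
  replace hsm : (c' - c) ^ α * (K + 1) ≤ (1 - κ) / 2 ∧ (c' - c) ^ α * (K + K₁ + 1) ≤ r / 4 :=
    ⟨(le_div_iff₀ (by linarith)).1 (hsm.trans (min_le_left _ _)),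
      (le_div_iff₀ (by linarith)).1 (hsm.trans (min_le_right _ _))⟩
  have hp0 : 0 ≤ (c' - c) ^ α := Real.rpow_nonneg (by linarith) _
  obtain ⟨y, hyc, hye⟩ := hS.exists_path hα hK hκ'1 hcc' (by
    calc κ * (1 + K * (c' - c) ^ α) ≤ κ * 1 + 1 * (K * (c' - c) ^ α) := by
          rw [mul_add]; gcongr
      _ ≤ κ' := by simp only [hκ']; linarith [hsm.1]) (hvb.continuousOn_step W hc hc'T) (φ m).1
  have hyh : ∀ s t, c ≤ s → s ≤ t → t ≤ c' → ‖y t - y s‖ ≤ (K + K₁) * (t - s) ^ α := by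
    intro s t h1 h2 h3
    have e1 := hye s t h1 h2 h3
    have e2 := (hS.incr s t h1 h2 h3).norm_le (y s)
    have e3 : (t - s) ^ (3 * α) ≤ (t - s) ^ α := by
      rcases h2.eq_or_lt with rfl | hlt
      · simp [Real.zero_rpow (by linarith : 3 * α ≠ 0), Real.zero_rpow (by linarith : α ≠ 0)]
      · exact Real.rpow_le_rpow_of_exponent_ge (by linarith) (by linarith) (by linarith)
    calc ‖y t - y s‖ = ‖(y t - (y s + roughIncr W v v₀ s t (y s))) +
          ((y s + roughIncr W v v₀ s t (y s)) - y s)‖ := by congr 1; abel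
      _ ≤ K₁ * (t - s) ^ (3 * α) + K * (t - s) ^ α := (norm_add_le _ _).trans (add_le_add e1 e2)
      _ ≤ K₁ * (t - s) ^ α + K * (t - s) ^ α := by gcongr
      _ = _ := by ring
  have hyb : ∀ t ∈ Icc c c', y t ∈ Metric.ball y₀ r := by
    intro t ht
    have h1 := hyh c t le_rfl ht.1 ht.2
    have h2 : (t - c) ^ α ≤ (c' - c) ^ α :=
      Real.rpow_le_rpow (by linarith [ht.1]) (by linarith [ht.2]) (by linarith)
    have h3 : (K + K₁) * (t - c) ^ α ≤ r / 4 := by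
      have : (K + K₁) * (t - c) ^ α ≤ (K + K₁) * (c' - c) ^ α := by gcongr
      linarith [hsm.2]
    rw [hyc] at h1
    have h4 : dist (φ m).1 y₀ < r / 2 := hmy
    rw [Metric.mem_ball]
    calc dist (y t) y₀ ≤ dist (y t) (φ m).1 + dist (φ m).1 y₀ := dist_triangle _ _ _
      _ < r := by rw [dist_eq_norm]; linarith
  have hycont : ContinuousOn y (Icc c c') :=
    continuousOn_of_norm_sub_le_rpow (by linarith) hyh
  have htar : ∀ t ∈ Icc c c', (y t, z) ∈ φ.target := by
    intro t ht'
    rw [ht]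
    exact ⟨hrB (Metric.ball_subset_closedBall
      (Metric.ball_subset_ball (by linarith) (hyb t ht'))), hKB (interior_subset hmz)⟩
  refine ⟨fun t => φ.symm (y t, z), isRDESolution_of_isLocalSolutionAt hV hV₀ hα hα' hW hc hc'T
    (φ.continuousOn_symm.comp (hycont.prodMk continuousOn_const) htar) ?_ fun u hu => ?_⟩
  · rw [hyc]
    exact φ.left_inv hm
  · refine ⟨φ, hφ, φ.map_target (htar u hu), 1, one_pos, K₁, fun s t h1 h2 h3 _ _ => ?_⟩
    have hs : s ∈ Icc c c' := ⟨h1, h2.trans h3⟩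
    have ht' : t ∈ Icc c c' := ⟨h1.trans h2, h3⟩
    refine ⟨φ.map_target (htar s hs), φ.map_target (htar t ht'), ?_, ?_⟩
    · rw [φ.right_inv (htar s hs), φ.right_inv (htar t ht')]
    · rw [φ.right_inv (htar s hs), φ.right_inv (htar t ht'),
        roughIncr_chartFields Metric.isOpen_ball hv (hyb s hs)]
      exact hye s t h1 h2 h3

/-- Solutions can be concatenated. -/
lemma IsRDESolution.concat [LocallyCompactSpace Z] [TopologicalSpace.MetrizableSpace Z]
    [T2Space M] (hV : ∀ i, (V i).IsLeafwiseContDiff 3) (hV₀ : V₀.IsLeafwiseContDiff 3)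
    (hα : 1 / 3 < α) (hα' : α < 1 / 2) (hW : W.IsGeometric) {a u b : ℝ} (ha : 0 ≤ a) (hau : a ≤ u)
    (hub : u ≤ b) (hb : b ≤ T) {m : M} {x y : ℝ → M} (hx : IsRDESolution A V V₀ W a u m x)
    (hy : IsRDESolution A V V₀ W u b (x u) y) :
    IsRDESolution A V V₀ W a b m (fun t => if t ≤ u then x t else y t) := by
  set w : ℝ → M := fun t => if t ≤ u then x t else y t with hw
  have hwx : ∀ t ≤ u, w t = x t := fun t h => if_pos h
  have hwy : ∀ t, u ≤ t → w t = y t := by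
    intro t h
    rcases h.eq_or_lt with rfl | h
    · rw [hwx _ le_rfl, hy.2.1]
    · exact if_neg (not_le.2 h)
  have hwc : ContinuousOn w (Icc a b) := by
    rw [← Icc_union_Icc_eq_Icc hau hub]
    exact (hx.1.congr fun t ht => hwx t ht.2).union_of_isClosed
      (hy.1.congr fun t ht => hwy t ht.1) isClosed_Icc isClosed_Icc
  refine isRDESolution_of_isLocalSolutionAt hV hV₀ hα hα' hW ha hb hwc
    ((hwx a hau).trans hx.2.1) fun c hc => ?_
  obtain ⟨φ, hφ, hwφ⟩ := A.cover (w c)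
  refine ⟨φ, hφ, hwφ, ?_⟩
  rcases lt_trichotomy c u with hcu | hcu | hcu
  · rw [hwx c hcu.le] at hwφ
    obtain ⟨ε, hε, C, hC⟩ := hx.isLocalSolutionAt hV hα ⟨hc.1, hcu.le⟩ hφ hwφ
    refine ⟨min ε (u - c), lt_min hε (by linarith), C, fun s t h1 h2 h3 h4 h5 => ?_⟩
    rw [lt_min_iff] at h4 h5
    have htu : t ≤ u := by linarith [(abs_lt.1 h5.2).2]
    rw [hwx s (h2.trans htu), hwx t htu]
    exact hC s t h1 h2 htu h4.1 h5.1
  · subst hcu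
    have hxφ : x c ∈ φ.source := by rwa [hwx c le_rfl] at hwφ
    obtain ⟨ε₁, hε₁, C₁, hC₁⟩ := hx.isLocalSolutionAt hV hα ⟨hau, le_rfl⟩ hφ hxφ
    obtain ⟨ε₂, hε₂, C₂, hC₂⟩ := hy.isLocalSolutionAt hV hα ⟨le_rfl, hub⟩ hφ
      (by rw [hy.2.1]; exact hxφ)
    obtain ⟨B₁, B₂, r, hB₁, hB₂, ht, hr, hrB, hzB⟩ := FoliatedAtlas.exists_box hφ hwφ
    set y₀ := (φ (w c)).1 with hy₀
    set z₀ := (φ (w c)).2 with hz₀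
    obtain ⟨L, hL⟩ := exists_bddFields hV hV₀ hφ hB₁ hB₂ ht hr hrB isCompact_singleton
      (singleton_subset_iff.2 hzB)
    obtain ⟨v, v₀, hvb, hv⟩ := hL z₀ rfl
    obtain ⟨K, hK, hflow⟩ := BddFields.exists_isAlmostFlow (X := E p) W (by linarith) hα' L
      hvb.nonneg
    obtain ⟨ε₃, hε₃, hεw⟩ := exists_pos_forall_mem hwc hc (O := φ.source ∩
      φ ⁻¹' (Metric.ball y₀ r ×ˢ univ))
      ((φ.continuousOn.isOpen_inter_preimage φ.open_source
        (Metric.isOpen_ball.prod isOpen_univ)).mem_nhds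
        ⟨hwφ, Metric.mem_ball_self hr, mem_univ _⟩)
    refine ⟨min (min ε₁ ε₂) (min ε₃ (1 / 2)), by positivity,
      |C₁| + |C₂| + K + K * |C₁|, fun s t h1 h2 h3 h4 h5 => ?_⟩
    simp only [lt_min_iff] at h4 h5
    obtain ⟨⟨s1, s2⟩, s3, s4⟩ := h4
    obtain ⟨⟨t1, t2⟩, t3, t4⟩ := h5
    have hKC : 0 ≤ K * |C₁| := by positivity
    have hcc : ∀ {e : ℝ}, 0 < e → |c - c| < e := fun he => by simpa using he
    rcases le_total t c with htc | htc
    · rw [hwx s (h2.trans htc), hwx t htc]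
      obtain ⟨e1, e2, e3, e4⟩ := hC₁ s t h1 h2 htc s1 t1
      exact ⟨e1, e2, e3, le_mul_rpow_of_le h2 e4 (by
        linarith [le_abs_self C₁, abs_nonneg C₂])⟩
    rcases le_total c s with hcs | hcs
    · rw [hwy s hcs, hwy t htc]
      obtain ⟨e1, e2, e3, e4⟩ := hC₂ s t hcs h2 h3 s2 t2
      exact ⟨e1, e2, e3, le_mul_rpow_of_le h2 e4 (by
        linarith [le_abs_self C₂, abs_nonneg C₁])⟩
    -- The interval straddles the junction `c`: the estimates on `[s, c]` and `[c, t]` are combined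
    -- through the almost flow, whose defect is again of order `3 * α`.
    obtain ⟨e1, -, e3, e4⟩ := hC₁ s c h1 hcs le_rfl s1 (hcc hε₁)
    obtain ⟨-, f2, f3, f4⟩ := hC₂ c t le_rfl htc h3 (hcc hε₂) t2
    rw [← hwx s hcs] at e1 e3 e4
    rw [← hwx c le_rfl] at e3 e4
    rw [← hwy t htc] at f2 f3 f4
    rw [← hwy c le_rfl] at f3 f4
    have hzs : (φ (w s)).2 = z₀ := e3.symm
    refine ⟨e1, f2, f3.trans e3, ?_⟩
    have hsy := (hεw s ⟨h1, h2.trans h3⟩ s3).2.1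
    have hts : t - s ≤ 1 := by linarith [(abs_lt.1 s4).1, (abs_lt.1 t4).2]
    rw [hzs, roughIncr_chartFields Metric.isOpen_ball hv hsy] at e4 ⊢
    rw [← hz₀, roughIncr_chartFields Metric.isOpen_ball hv (Metric.mem_ball_self hr)] at f4
    have hS := hflow v v₀ hvb s t (ha.trans h1) (h3.trans hb) hts
    have hcon := hS.concat_le le_rfl hcs htc le_rfl (φ (w s)).1 (φ (w c)).1 (φ (w t)).1
    refine hcon.trans ?_
    set P := (t - s) ^ (3 * α) with hP
    have hP0 : 0 ≤ P := Real.rpow_nonneg (by linarith) _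
    have p1 : ‖(φ (w c)).1 - ((φ (w s)).1 + roughIncr W v v₀ s c (φ (w s)).1)‖ ≤ |C₁| * P := by
      refine e4.trans ((le_mul_rpow_of_le hcs le_rfl (le_abs_self C₁)).trans ?_)
      have : (c - s) ^ (3 * α) ≤ P :=
        Real.rpow_le_rpow (by linarith) (by linarith) (by linarith)
      gcongr
    have p2 : ‖(φ (w t)).1 - ((φ (w c)).1 + roughIncr W v v₀ c t (φ (w c)).1)‖ ≤ |C₂| * P := by
      refine f4.trans ((le_mul_rpow_of_le htc le_rfl (le_abs_self C₂)).trans ?_)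
      have : (t - c) ^ (3 * α) ≤ P :=
        Real.rpow_le_rpow (by linarith) (by linarith) (by linarith)
      gcongr
    have p3 : (1 + K * (t - c) ^ α) ≤ 1 + K := by
      have : (t - c) ^ α ≤ 1 := Real.rpow_le_one (by linarith) (by linarith) (by linarith)
      nlinarith
    calc _ ≤ |C₂| * P + (1 + K) * (|C₁| * P) + K * P := by gcongr
      _ = _ := by ring
  · rw [hwy c hcu.le] at hwφ
    obtain ⟨ε, hε, C, hC⟩ := hy.isLocalSolutionAt hV hα ⟨hcu.le, hc.2⟩ hφ hwφ
    refine ⟨min ε (c - u), lt_min hε (by linarith), C, fun s t h1 h2 h3 h4 h5 => ?_⟩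
    rw [lt_min_iff] at h4 h5
    have hus : u ≤ s := by linarith [(abs_lt.1 h4.2).1]
    rw [hwy s hus, hwy t (hus.trans h2)]
    exact hC s t hus h2 h3 h4.1 h5.1

/-- Existence of solutions of the rough differential equation. -/
theorem exists_isRDESolution [LocallyCompactSpace Z] [TopologicalSpace.MetrizableSpace Z]
    [T2Space M] [CompactSpace M] (hV : ∀ i, (V i).IsLeafwiseContDiff 3)
    (hV₀ : V₀.IsLeafwiseContDiff 3) (hα : 1 / 3 < α) (hα' : α < 1 / 2) (hW : W.IsGeometric)
    {a b : ℝ} (ha : 0 ≤ a) (hab : a < b) (hb : b ≤ T) (m : M) :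
    ∃ x : ℝ → M, IsRDESolution A V V₀ W a b m x := by
  obtain ⟨τ, hτ, hsol⟩ : ∃ τ > 0, ∀ m ∈ (univ : Set M), ∀ c c', 0 ≤ c → c < c' → c' ≤ T →
      c' - c ≤ τ → ∃ x : ℝ → M, IsRDESolution A V V₀ W c c' m x := by
    refine isCompact_univ.induction_on (p := fun S => ∃ τ > 0, ∀ m ∈ S, ∀ c c', 0 ≤ c → c < c' →
      c' ≤ T → c' - c ≤ τ → ∃ x : ℝ → M, IsRDESolution A V V₀ W c c' m x) ?_ ?_ ?_ ?_
    · exact ⟨1, one_pos, fun m hm => hm.elim⟩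
    · rintro S S' hS ⟨τ, hτ, h⟩
      exact ⟨τ, hτ, fun m hm => h m (hS hm)⟩
    · rintro S S' ⟨τ, hτ, h⟩ ⟨τ', hτ', h'⟩
      refine ⟨min τ τ', lt_min hτ hτ', fun m hm c c' h1 h2 h3 h4 => ?_⟩
      rw [le_min_iff] at h4
      rcases hm with hm | hm
      · exact h m hm c c' h1 h2 h3 h4.1
      · exact h' m hm c c' h1 h2 h3 h4.2
    · intro m₀ _
      obtain ⟨N, hN, τ, hτ, h⟩ := exists_local_solution hV hV₀ hα hα' hW m₀
      exact ⟨N, mem_nhdsWithin_of_mem_nhds hN, τ, hτ, h⟩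
  -- Since the step `τ` does not depend on the starting point, it can be iterated; the minimum with
  -- `b` makes the construction stationary once `b` is reached.
  have key : ∀ n : ℕ, ∃ x : ℝ → M,
      IsRDESolution A V V₀ W a (min b (a + (n + 1 : ℕ) * τ)) m x := by
    intro n
    induction n with
    | zero =>
      refine hsol m (mem_univ m) a _ ha (lt_min hab (by simpa using hτ))
        ((min_le_left _ _).trans hb) ?_
      have := min_le_right b (a + (0 + 1 : ℕ) * τ)
      push_cast at this ⊢
      linarith
    | succ n ih =>
      obtain ⟨x, hx⟩ := ih
      set u := min b (a + (n + 1 : ℕ) * τ) with hu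
      have hn : 0 ≤ (n : ℝ) * τ := by positivity
      have hau : a ≤ u := le_min hab.le (by push_cast; nlinarith)
      rcases (min_le_left b (a + (n + 1 : ℕ) * τ)).eq_or_lt with hub | hub
      · have : min b (a + (n + 1 + 1 : ℕ) * τ) = u := by
          rw [hu, hub]
          rw [min_eq_left_iff] at hub ⊢
          push_cast at hub ⊢
          nlinarith
        rw [this]
        exact ⟨x, hx⟩
      · have hu' : u = a + (n + 1 : ℕ) * τ := by
          rw [hu]
          exact min_eq_right (by rcases min_lt_iff.1 hub with h | h; exacts [absurd h (lt_irrefl b), h.le])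
        have hlt : u < min b (a + (n + 1 + 1 : ℕ) * τ) := by
          refine lt_min hub ?_
          rw [hu']; push_cast; nlinarith
        obtain ⟨y, hy⟩ := hsol (x u) (mem_univ _) u _ (ha.trans hau) hlt
          ((min_le_left _ _).trans hb) (by
            have := min_le_right b (a + (n + 1 + 1 : ℕ) * τ)
            rw [hu'] at *
            push_cast at this ⊢
            linarith)
        exact ⟨_, hx.concat hV hV₀ hα hα' hW ha hau hlt.le ((min_le_left _ _).trans hb) hy⟩
  obtain ⟨n, hn⟩ := exists_nat_ge ((b - a) / τ)
  obtain ⟨x, hx⟩ := key n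
  have : min b (a + (n + 1 : ℕ) * τ) = b := by
    rw [div_le_iff₀ hτ] at hn
    rw [min_eq_left_iff]
    push_cast
    linarith
  rw [this] at hx
  exact ⟨x, hx⟩

end ExistenceUniqueness

/-! ### Lipschitz drivers and the Riemann–Stieltjes equation -/

section OrdinaryEquations

variable {p d : ℕ} {Z M : Type*} [TopologicalSpace Z] [TopologicalSpace M]
  {A : FoliatedAtlas p Z M} {α T : ℝ} {V : Fin d → A.LeafVectorField} {V₀ : A.LeafVectorField}
  {W : RoughPath α T d} {w : ℝ → E d}

lemma lipschitzOnWith_coord {K : NNReal} {S : Set ℝ} (hw : LipschitzOnWith K w S) (i : Fin d) :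
    LipschitzOnWith K (fun u => w u i) S := by
  refine LipschitzOnWith.of_dist_le_mul fun u hu v hv => ?_
  refine le_trans ?_ (hw.dist_le_mul u hu v hv)
  rw [dist_eq_norm, dist_eq_norm]
  exact PiLp.norm_apply_le (w u - w v) i

lemma sq_le_rpow_of_le_one {x θ : ℝ} (hx : 0 ≤ x) (hx1 : x ≤ 1) (hθ : 0 < θ) (hθ2 : θ ≤ 2) :
    x ^ 2 ≤ x ^ θ := by
  rcases hx.eq_or_lt with rfl | hx
  · simp [Real.zero_rpow hθ.ne']
  · rw [← Real.rpow_natCast]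
    exact Real.rpow_le_rpow_of_exponent_ge hx hx1 (by simpa using hθ2)

/-- For the lift of a Lipschitz path, the second order terms of the Euler scheme are negligible. -/
lemma RoughPath.IsLiftOf.norm_roughIncr_sub_le (hl : W.IsLiftOf w) {K : NNReal}
    (hw : LipschitzOnWith K w (Icc 0 T)) {X : Type*} [NormedAddCommGroup X] [NormedSpace ℝ X]
    {L : ℝ} {v : Fin d → X → X} {v₀ : X → X} (hv : BddFields L v v₀) {s t : ℝ} (hs : 0 ≤ s)
    (hst : s ≤ t) (ht : t ≤ T) (y : X) :
    ‖roughIncr W v v₀ s t y - (∑ i, (w t i - w s i) • v i y + (t - s) • v₀ y)‖ ≤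
      d * d * ((K : ℝ) ^ 2 * L ^ 2) * (t - s) ^ 2 := by
  have e : roughIncr W v v₀ s t y - (∑ i, (w t i - w s i) • v i y + (t - s) • v₀ y) =
      ∑ j, ∑ k, W.snd s t (j, k) • secondField v j k y := by
    simp only [roughIncr, eulerIncr, driven, (hl s t hs hst ht).1, PiLp.sub_apply]
    abel
  have h : ∀ j k, ‖W.snd s t (j, k) • secondField v j k y‖ ≤
      (K : ℝ) ^ 2 * (t - s) ^ 2 * L ^ 2 := by
    intro j k
    rw [norm_smul, Real.norm_eq_abs]
    gcongr
    · exact hl.exists_bound hw hs hst ht j k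
    · calc ‖secondField v j k y‖ ≤ ‖fderiv ℝ (v k) y‖ * ‖v j y‖ :=
            ContinuousLinearMap.le_opNorm _ _
        _ ≤ L * L := mul_le_mul ((hv.bdd_fderiv k).norm_le y) ((hv.bdd j).norm_le y)
            (norm_nonneg _) hv.nonneg
        _ = L ^ 2 := by ring
  rw [e]
  calc _ ≤ ∑ _j : Fin d, ∑ _k : Fin d, (K : ℝ) ^ 2 * (t - s) ^ 2 * L ^ 2 :=
        norm_sum_le_of_le _ fun j _ => norm_sum_le_of_le _ fun k _ => h j k
    _ = _ := by simp; ring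

/-- In a neighbourhood of a point of a chart, the vector fields in a plaque are restrictions of
bounded vector fields. -/
lemma exists_bddFields_near [LocallyCompactSpace Z] (hV : ∀ i, (V i).IsLeafwiseContDiff 3)
    (hV₀ : V₀.IsLeafwiseContDiff 3) {a b c : ℝ} {x : ℝ → M} (hx : ContinuousOn x (Icc a b))
    (hc : c ∈ Icc a b) {φ : OpenPartialHomeomorph M (E p × Z)} (hφ : φ ∈ A.charts)
    (hxc : x c ∈ φ.source) :
    ∃ (L : ℝ) (v : Fin d → E p → E p) (v₀ : E p → E p) (O : Set (E p)), BddFields L v v₀ ∧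
      IsOpen O ∧ (∀ y ∈ O, (∀ i, v i y = (V i).inChart φ (y, (φ (x c)).2)) ∧
        v₀ y = V₀.inChart φ (y, (φ (x c)).2)) ∧
      ∃ ε > 0, ε ≤ 1 / 2 ∧ ∀ s ∈ Icc a b, |s - c| < ε → x s ∈ φ.source ∧ (φ (x s)).1 ∈ O := by
  obtain ⟨B₁, B₂, r, hB₁, hB₂, ht, hr, hrB, hzB⟩ := FoliatedAtlas.exists_box hφ hxc
  obtain ⟨L, hL⟩ := exists_bddFields hV hV₀ hφ hB₁ hB₂ ht hr hrB isCompact_singleton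
    (singleton_subset_iff.2 hzB)
  obtain ⟨v, v₀, hvb, hv⟩ := hL (φ (x c)).2 rfl
  obtain ⟨ε, hε, hεx⟩ := exists_pos_forall_mem hx hc (O := φ.source ∩
    φ ⁻¹' (Metric.ball (φ (x c)).1 r ×ˢ univ))
    ((φ.continuousOn.isOpen_inter_preimage φ.open_source
      (Metric.isOpen_ball.prod isOpen_univ)).mem_nhds
      ⟨hxc, Metric.mem_ball_self hr, mem_univ _⟩)
  refine ⟨L, v, v₀, _, hvb, Metric.isOpen_ball, hv, min ε (1 / 2), by positivity,
    min_le_right _ _, fun s hs hsc => ?_⟩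
  obtain ⟨h1, h2, -⟩ := hεx s hs (hsc.trans_le (min_le_left _ _))
  exact ⟨h1, h2⟩

/-- Solutions of the ordinary equation follow the Euler scheme. -/
lemma IsODESolution.isLocalSolutionAt [LocallyCompactSpace Z]
    (hV : ∀ i, (V i).IsLeafwiseContDiff 3)
    (hV₀ : V₀.IsLeafwiseContDiff 3) (hα : 1 / 3 < α) (hα' : α < 1 / 2) (hl : W.IsLiftOf w)
    {K : NNReal} (hw : LipschitzOnWith K w (Icc 0 T)) {a b : ℝ} (ha : 0 ≤ a) (hb : b ≤ T) {m : M}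
    {x : ℝ → M} (hx : IsODESolution A V V₀ w a b m x) {c : ℝ} (hc : c ∈ Icc a b)
    {φ : OpenPartialHomeomorph M (E p × Z)} (hφ : φ ∈ A.charts) (hxc : x c ∈ φ.source) :
    IsLocalSolutionAt V V₀ W a b x φ c := by
  obtain ⟨hxcont, -, hxI⟩ := hx
  obtain ⟨L, v, v₀, O, hvb, hO, hv, ε, hε, hε2, hεx⟩ :=
    exists_bddFields_near hV hV₀ hxcont hc hφ hxc
  have hL := hvb.nonneg
  have hbetween : ∀ s t u, |s - c| < ε → |t - c| < ε → u ∈ Icc s t → |u - c| < ε := by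
    intro s t u hs ht hu
    rw [abs_lt] at *
    exact ⟨by linarith [hs.1, hu.1], by linarith [ht.2, hu.2]⟩
  have hODE := fun s t (h1 : a ≤ s) (h2 : s ≤ t) (h3 : t ≤ b) (h4 : |s - c| < ε)
    (h5 : |t - c| < ε) => hxI φ hφ s t h1 h2 h3 fun u hu =>
      (hεx u ⟨h1.trans hu.1, hu.2.trans h3⟩ (hbetween s t u h4 h5 hu)).1
  have hcc : |c - c| < ε := by simpa using hε
  have hz : ∀ s ∈ Icc a b, |s - c| < ε → (φ (x s)).2 = (φ (x c)).2 := by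
    intro s hs hsc
    rcases le_total c s with hcs | hcs
    · exact (hODE c s hc.1 hcs hs.2 hcc hsc).1
    · exact (hODE s c hs.1 hcs hc.2 hsc hcc).1.symm
  have hval : ∀ s ∈ Icc a b, |s - c| < ε →
      (∀ i, (V i).inChart φ (φ (x s)) = v i (φ (x s)).1) ∧
        V₀.inChart φ (φ (x s)) = v₀ (φ (x s)).1 := by
    intro s hs hsc
    have e : φ (x s) = ((φ (x s)).1, (φ (x c)).2) := Prod.ext rfl (hz s hs hsc)
    obtain ⟨h1, h2⟩ := hv _ (hεx s hs hsc).2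
    exact ⟨fun i => by rw [h1 i, ← e], by rw [h2, ← e]⟩
  -- Used twice: frozen values `0` show that the path is Lipschitz; with the fields frozen at time
  -- `s`, the Lipschitz bound makes `B` of order `t - s` and the error of order two.
  have hbound : ∀ s t, a ≤ s → s ≤ t → t ≤ b → |s - c| < ε → |t - c| < ε →
      ∀ (B : ℝ) (e : Fin d → E p) (e₀ : E p),
      (∀ u ∈ Icc s t, (∀ i, ‖v i (φ (x u)).1 - e i‖ ≤ B) ∧ ‖v₀ (φ (x u)).1 - e₀‖ ≤ B) →
      ‖(φ (x t)).1 - (φ (x s)).1 - (∑ i, (w t i - w s i) • e i + (t - s) • e₀)‖ ≤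
        (d * K + 1) * B * (t - s) := by
    intro s t h1 h2 h3 h4 h5 B e e₀ hB
    obtain ⟨-, I, I₀, hI, hI₀, hsum⟩ := hODE s t h1 h2 h3 h4 h5
    have hmem : ∀ u ∈ Icc s t, u ∈ Icc a b := fun u hu => ⟨h1.trans hu.1, hu.2.trans h3⟩
    have n1 : ∀ i, ‖I i - (w t i - w s i) • e i‖ ≤ K * B * (t - s) := by
      intro i
      refine (hI i).norm_sub_le h2 (fun u hu => ?_) fun u hu u' hu' => ?_
      · rw [(hval u (hmem u hu) (hbetween s t u h4 h5 hu)).1 i]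
        exact (hB u hu).1 i
      · have := (lipschitzOnWith_coord hw i).dist_le_mul u
          ⟨ha.trans (hmem u hu).1, (hmem u hu).2.trans hb⟩ u'
          ⟨ha.trans (hmem u' hu').1, (hmem u' hu').2.trans hb⟩
        rwa [Real.dist_eq, Real.dist_eq] at this
    have n2 : ‖I₀ - (t - s) • e₀‖ ≤ 1 * B * (t - s) := by
      refine hI₀.norm_sub_le h2 (fun u hu => ?_) fun u hu u' hu' => by rw [one_mul]
      rw [(hval u (hmem u hu) (hbetween s t u h4 h5 hu)).2]
      exact (hB u hu).2
    rw [hsum]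
    calc ‖∑ i, I i + I₀ - (∑ i, (w t i - w s i) • e i + (t - s) • e₀)‖
        = ‖∑ i, (I i - (w t i - w s i) • e i) + (I₀ - (t - s) • e₀)‖ := by
          rw [Finset.sum_sub_distrib]; congr 1; abel
      _ ≤ ∑ _i : Fin d, (K * B * (t - s)) + 1 * B * (t - s) :=
          (norm_add_le _ _).trans (add_le_add (norm_sum_le_of_le _ fun i _ => n1 i) n2)
      _ = _ := by simp; ring
  have hlip : ∀ s t, a ≤ s → s ≤ t → t ≤ b → |s - c| < ε → |t - c| < ε →
      ‖(φ (x t)).1 - (φ (x s)).1‖ ≤ (d * K + 1) * L * (t - s) := by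
    intro s t h1 h2 h3 h4 h5
    have := hbound s t h1 h2 h3 h4 h5 L 0 0 fun u _ =>
      ⟨fun i => by simpa using (hvb.bdd i).norm_le _, by simpa using hvb.bdd_zero.norm_le _⟩
    simpa using this
  set D : ℝ := d * K + 1 with hD
  have hD0 : 0 ≤ D := by positivity
  refine ⟨ε, hε, D * (L * (D * L)) + d * d * ((K : ℝ) ^ 2 * L ^ 2),
    fun s t h1 h2 h3 h4 h5 => ?_⟩
  have hs : s ∈ Icc a b := ⟨h1, h2.trans h3⟩
  have hts : t - s ≤ 1 := by linarith [(abs_lt.1 h4).1, (abs_lt.1 h5).2]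
  refine ⟨(hεx s hs h4).1, (hεx t ⟨h1.trans h2, h3⟩ h5).1, (hODE s t h1 h2 h3 h4 h5).1, ?_⟩
  rw [hz s hs h4, roughIncr_chartFields hO hv (hεx s hs h4).2]
  have n1 := hbound s t h1 h2 h3 h4 h5 (L * (D * L * (t - s))) (fun i => v i (φ (x s)).1)
    (v₀ (φ (x s)).1) fun u hu => by
      have hu1 : ‖(φ (x u)).1 - (φ (x s)).1‖ ≤ D * L * (t - s) := by
        refine (hlip s u h1 hu.1 (hu.2.trans h3) h4 (hbetween s t u h4 h5 hu)).trans ?_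
        have := hu.2
        gcongr
      exact ⟨fun i => ((hvb.bdd i).lip _ _).trans (by gcongr),
        (hvb.bdd_zero.lip _ _).trans (by gcongr)⟩
  have n2 := hl.norm_roughIncr_sub_le hw hvb (ha.trans h1) h2 (h3.trans hb) (φ (x s)).1
  have n3 : (t - s) ^ 2 ≤ (t - s) ^ (3 * α) :=
    sq_le_rpow_of_le_one (by linarith) hts (by linarith) (by linarith)
  set S := ∑ i, (w t i - w s i) • v i (φ (x s)).1 + (t - s) • v₀ (φ (x s)).1
  set R := roughIncr W v v₀ s t (φ (x s)).1
  calc ‖(φ (x t)).1 - ((φ (x s)).1 + R)‖ = ‖((φ (x t)).1 - (φ (x s)).1 - S) - (R - S)‖ := by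
        congr 1; abel
    _ ≤ D * (L * (D * L * (t - s))) * (t - s) + d * d * ((K : ℝ) ^ 2 * L ^ 2) * (t - s) ^ 2 :=
        (norm_sub_le _ _).trans (add_le_add n1 n2)
    _ = (D * (L * (D * L)) + d * d * ((K : ℝ) ^ 2 * L ^ 2)) * (t - s) ^ 2 := by ring
    _ ≤ _ := by gcongr

/-- For the lift of a Lipschitz path, the solutions of the rough and of the ordinary differential
equation are the same. -/
theorem isRDESolution_iff_isODESolution [LocallyCompactSpace Z]
    [TopologicalSpace.MetrizableSpace Z] [T2Space M] (hV : ∀ i, (V i).IsLeafwiseContDiff 3)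
    (hV₀ : V₀.IsLeafwiseContDiff 3) (hα : 1 / 3 < α) (hα' : α < 1 / 2) (hW : W.IsGeometric)
    (hl : W.IsLiftOf w) {K : NNReal} (hw : LipschitzOnWith K w (Icc 0 T)) {a b : ℝ} (ha : 0 ≤ a)
    (hb : b ≤ T) {m : M} {x : ℝ → M} :
    IsRDESolution A V V₀ W a b m x ↔ IsODESolution A V V₀ w a b m x := by
  refine ⟨fun hx => ⟨hx.1, hx.2.1, fun φ hφ s t h1 h2 h3 hφx => ?_⟩, fun hx =>
    isRDESolution_of_isLocalSolutionAt hV hV₀ hα hα' hW ha hb hx.1 hx.2.1 fun c hc => ?_⟩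
  swap
  · obtain ⟨φ, hφ, hxc⟩ := A.cover (x c)
    exact ⟨φ, hφ, hxc, hx.isLocalSolutionAt hV hV₀ hα hα' hl hw ha hb hc hφ hxc⟩
  have hsub : Icc s t ⊆ Icc a b := Icc_subset_Icc h1 h3
  have hφc : ContinuousOn (fun u => φ (x u)) (Icc s t) :=
    φ.continuousOn.comp (hx.1.mono hsub) hφx
  -- Each local estimate gives a constant transverse coordinate only near its time; a closed-open
  -- argument extends this to all of `[s, t]`.
  have hz : ∀ u ∈ Icc s t, (φ (x u)).2 = (φ (x s)).2 := by
    have hcl : IsClosed ({u | (φ (x u)).2 = (φ (x s)).2} ∩ Icc s t) := by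
      rw [inter_comm]
      exact (continuous_snd.comp_continuousOn hφc).preimage_isClosed_of_isClosed isClosed_Icc
        (isClosed_singleton (x := (φ (x s)).2))
    refine hcl.Icc_subset_of_forall_mem_nhdsWithin rfl ?_
    rintro c ⟨hcz, hsc, hct⟩
    obtain ⟨ε, hε, C, hC⟩ := hx.isLocalSolutionAt hV hα (hsub ⟨hsc, hct.le⟩) hφ
      (hφx c ⟨hsc, hct.le⟩)
    refine Filter.mem_of_superset (Ioo_mem_nhdsGT (lt_min hct (by linarith : c < c + ε))) ?_
    rintro u ⟨hu1, hu2⟩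
    rw [lt_min_iff] at hu2
    refine (hC c u (h1.trans hsc) hu1.le (hu2.1.le.trans h3) (by simpa using hε) ?_).2.2.1.trans hcz
    rw [abs_of_nonneg (by linarith)]
    linarith
  have hcont : ∀ U : A.LeafVectorField, U.IsLeafwiseContDiff 3 →
      ContinuousOn (fun u => U.inChart φ (φ (x u))) (Icc s t) := fun U hU =>
    (hU φ hφ).continuousOn.comp hφc fun u hu => φ.map_source (hφx u hu)
  have hsT : Icc s t ⊆ Icc 0 T := Icc_subset_Icc (ha.trans h1) (h3.trans hb)
  choose I hI using fun i => exists_hasRSIntegral h2 (hcont (V i) (hV i))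
    ((lipschitzOnWith_coord hw i).mono hsT)
  obtain ⟨I₀, hI₀⟩ := exists_hasRSIntegral h2 (hcont V₀ hV₀) (LipschitzWith.id.lipschitzOnWith)
  refine ⟨hz t ⟨h2, le_rfl⟩, I, I₀, hI, hI₀, ?_⟩
  -- Dropping the second level costs `O((u' - u) ^ 2)`, which is below order `3 * α`. What is left
  -- is a left-point approximation with error exponent above one, so the Riemann sums converge to
  -- the increment.
  obtain ⟨δ, hδ, C, -, hC⟩ := exists_uniform_of_local (a := s) (b := t) (θ := 3 * α)
    (Φ := fun u u' => ‖(φ (x u')).1 - (φ (x u)).1 - (∑ i, (w u' i - w u i) •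
      (V i).inChart φ (φ (x u)) + (u' - u) • V₀.inChart φ (φ (x u)))‖) fun c hc => by
    obtain ⟨ε₁, hε₁, C₁, hC₁⟩ := hx.isLocalSolutionAt hV hα (hsub hc) hφ (hφx c hc)
    obtain ⟨L, v, v₀, O, hvb, hO, hv, ε₂, hε₂, hε2, hεx⟩ :=
      exists_bddFields_near hV hV₀ hx.1 (hsub hc) hφ (hφx c hc)
    refine ⟨min ε₁ ε₂, lt_min hε₁ hε₂, C₁ + d * d * ((K : ℝ) ^ 2 * L ^ 2),
      fun u u' g1 g2 g3 g4 g5 => ?_⟩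
    rw [lt_min_iff] at g4 g5
    have hu : u ∈ Icc s t := ⟨g1, g2.trans g3⟩
    have huz : (φ (x u)).2 = (φ (x c)).2 := (hz u hu).trans (hz c hc).symm
    have hest := (hC₁ u u' (h1.trans g1) g2 (g3.trans h3) g4.1 g5.1).2.2.2
    have hy := (hεx u (hsub hu) g4.2).2
    rw [huz, roughIncr_chartFields hO hv hy] at hest
    have n2 := hl.norm_roughIncr_sub_le hw hvb (hsT hu).1 g2 (g3.trans (hsT ⟨h2, le_rfl⟩).2)
      (φ (x u)).1
    have hts : u' - u ≤ 1 := by linarith [(abs_lt.1 g4.2).1, (abs_lt.1 g5.2).2]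
    have n3 : (u' - u) ^ 2 ≤ (u' - u) ^ (3 * α) :=
      sq_le_rpow_of_le_one (by linarith) hts (by linarith) (by linarith)
    have e : φ (x u) = ((φ (x u)).1, (φ (x c)).2) := Prod.ext rfl huz
    have e1 : ∀ i, (V i).inChart φ (φ (x u)) = v i (φ (x u)).1 := fun i => by
      rw [(hv _ hy).1 i, ← e]
    have e2 : V₀.inChart φ (φ (x u)) = v₀ (φ (x u)).1 := by rw [(hv _ hy).2, ← e]
    simp only [e1, e2]
    set S := ∑ i, (w u' i - w u i) • v i (φ (x u)).1 + (u' - u) • v₀ (φ (x u)).1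
    set R := roughIncr W v v₀ u u' (φ (x u)).1
    calc ‖(φ (x u')).1 - (φ (x u)).1 - S‖ = ‖((φ (x u')).1 - ((φ (x u)).1 + R)) + (R - S)‖ := by
          congr 1; abel
      _ ≤ C₁ * (u' - u) ^ (3 * α) + d * d * ((K : ℝ) ^ 2 * L ^ 2) * (u' - u) ^ 2 :=
          (norm_add_le _ _).trans (add_le_add hest n2)
      _ ≤ C₁ * (u' - u) ^ (3 * α) + d * d * ((K : ℝ) ^ 2 * L ^ 2) * (u' - u) ^ (3 * α) := by
          gcongr
      _ = _ := by ring
  exact sub_eq_sum_of_approx (Y := fun u => (φ (x u)).1) (w := fun u i => w u i) h2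
    (by linarith) hδ hC hI hI₀

end OrdinaryEquations

end FoliatedRDE

/-! ### The theorem -/

theorem mainTheorem5 {p d : ℕ} {Z M : Type*}
    [TopologicalSpace Z] [LocallyCompactSpace Z] [TopologicalSpace.SeparableSpace Z]
    [TopologicalSpace.MetrizableSpace Z]
    [TopologicalSpace M] [CompactSpace M] [TopologicalSpace.MetrizableSpace M]
    (A : FoliatedRDE.FoliatedAtlas p Z M)
    (V : Fin d → A.LeafVectorField) (V₀ : A.LeafVectorField)
    (hV : ∀ i, (V i).IsLeafwiseContDiff 3) (hV₀ : V₀.IsLeafwiseContDiff 3)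
    (α T : ℝ) (hα : 1 / 3 < α) (hα' : α < 1 / 2) (hT : 0 < T)
    (W : FoliatedRDE.RoughPath α T d) (hW : W.IsGeometric)
    (a b : ℝ) (ha : 0 ≤ a) (hab : a < b) (hb : b ≤ T) (m : M) :
    (∃ x : ℝ → M, FoliatedRDE.IsRDESolution A V V₀ W a b m x ∧
      ∀ y : ℝ → M, FoliatedRDE.IsRDESolution A V V₀ W a b m y → Set.EqOn y x (Set.Icc a b)) ∧
    ∀ w : ℝ → FoliatedRDE.E d, FoliatedRDE.IsLipschitzPath T w → W.IsLiftOf w →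
      (∃ x : ℝ → M, FoliatedRDE.IsODESolution A V V₀ w a b m x ∧
        ∀ y : ℝ → M, FoliatedRDE.IsODESolution A V V₀ w a b m y → Set.EqOn y x (Set.Icc a b)) ∧
      ∀ x : ℝ → M, FoliatedRDE.IsRDESolution A V V₀ W a b m x ↔
        FoliatedRDE.IsODESolution A V V₀ w a b m x := by

  obtain ⟨x, hx⟩ := FoliatedRDE.exists_isRDESolution hV hV₀ hα hα' hW ha hab hb m
  refine ⟨⟨x, hx, fun y hy => hx.eqOn hV hV₀ hα hα' ha hb hy⟩, fun w ⟨_, K, hK⟩ hl => ?_⟩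
  have key : ∀ y : ℝ → M, FoliatedRDE.IsRDESolution A V V₀ W a b m y ↔
      FoliatedRDE.IsODESolution A V V₀ w a b m y := fun y =>
    FoliatedRDE.isRDESolution_iff_isODESolution hV hV₀ hα hα' hW hl hK ha hb
  exact ⟨⟨x, (key x).1 hx, fun y hy => hx.eqOn hV hV₀ hα hα' ha hb ((key y).2 hy)⟩, key⟩
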